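/- **Setting.** Let $d\in\{2,3\}$, $\Omega\subset\mathbb R^d$ a bounded domain, $T>0$, $a>0$, $\gamma>1$, $\mu>0$, $\lambda\ge-\frac2d\mu$, and $\Omega_\tau=(0,\tau)\times\Omega$, $\overline\Omega_\tau=[0,\tau]\times\overline\Omega$. Put $(\nabla u)_{ij}=\partial_j u_i$, $\mathbb S(A)=\mu\big(A+A^T-\frac2d\,\mathrm{tr}(A)\,\mathbb I\big)+\lambda\,\mathrm{tr}(A)\,\mathbb I$, $p(z)=az^\gamma$, $P(z)=\frac{a}{\gamma-1}z^\gamma$. For $\varrho\ge0$, $\theta>0$ let $S(\varrho,\theta)=\varrho\ln\big((a\theta^\gamma)^{1/(\gamma-1)}\big)$; let $p(\varrho,S)=\varrho^\gamma\exp\big((\gamma-1)S/\varrho\big)$ for $\varrho>0$, $p(0,0)=0$, and $P(\varrho,S)=\frac1{\gamma-1}p(\varrho,S)$. For probability measures $\mathcal V_{(t,x)}$ on $\mathbb R^{d+2}=\{(\tilde\varrho,\tilde\theta,\tilde u)\}$ write $\langle\mathcal V_{(t,x)};g\rangle=\int g\,d\mathcal V_{(t,x)}$, and $\tilde S=S(\tilde\varrho,\tilde\theta)$.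 **DMV solutions.** A dissipative measure-valued (DMV) solution with initial data $(\varrho_0,\theta_0,u_0)$ of finite energy is a weakly-$*$ measurable family $\mathcal V=\{\mathcal V_{(t,x)}\}$ of probability measures on $\mathbb R^{d+2}$ (with initial measures $\mathcal V_{(0,x)}$, measurable in $x$), such that for some $c_\star>0$ the measures $\mathcal V_{(t,x)}$, for a.a. $(t,x)\in\Omega_T$, and $\mathcal V_{(0,x)}$, for a.a. $x\in\Omega$, are concentrated on $\{\tilde\varrho\ge0,\ \tilde\theta\ge c_\star\}$, together with an energy defect $\mathfrak E\in L^\infty_{\mathrm{weak}^*}(0,T;\mathcal M^+(\overline\Omega))$, a dissipation defect $\mathfrak D\in\mathcal M^+(\overline\Omega_T)$ and a Reynolds defect $\mathfrak R\in L^\infty_{\mathrm{weak}^*}(0,T;\mathcal M(\overline\Omega)^{d\times d}_{\mathrm{sym},+})$ with $\underline d\,\mathfrak E\le\mathrm{tr}\,\mathfrak R\le\overline d\,\mathfrak E$ for constants $0<\underline d\le\overline d$, such that: * $u_{\mathcal V}=\langle\mathcal V;\tilde u\rangle\in L^2(0,T;W^{1,2}_0(\Omega)^d)$, $\langle\mathcal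 V;\frac12\tilde\varrho|\tilde u|^2+P(\tilde\varrho\tilde\theta)\rangle\in L^1(\Omega_T)$, and for a.a. $\tau\in(0,T)$ $$\int_\Omega\Big\langle\mathcal V_{(\tau,\cdot)};\tfrac12\tilde\varrho|\tilde u|^2+P(\tilde\varrho\tilde\theta)\Big\rangle dx+\int_0^\tau\!\!\int_\Omega\mathbb S(\nabla u_{\mathcal V}):\nabla u_{\mathcal V}\,dx\,dt+\int_{\overline\Omega}d\mathfrak E(\tau)+\int_{\overline\Omega_\tau}d\mathfrak D\le\int_\Omega\big[\tfrac12\varrho_0|u_0|^2+P(\varrho_0\theta_0)\big]dx ;$$ * $\langle\mathcal V;\tilde\varrho\rangle,\langle\mathcal V;\tilde\varrho\tilde\theta\rangle\in C_{\mathrm{weak}}([0,T];L^\gamma(\Omega))$ and $\langle\mathcal V;\tilde\varrho\tilde u\rangle\in C_{\mathrm{weak}}([0,T];L^{2\gamma/(\gamma+1)}(\Omega)^d)$; for a.a. $x\in\Omega$ the values at $t=0$ are $\langle\mathcal V_{(0,x)};\tilde\varrho\rangle=\varrho_0$, $\langle\mathcal V_{(0,x)};\tilde\varrho\tilde\theta\rangle=\varrho_0\theta_0$,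 $\langle\mathcal V_{(0,x)};\tilde\varrho\tilde u\rangle=\varrho_0u_0$, $\langle\mathcal V_{(0,x)};\tilde\varrho\ln\tilde\theta\rangle=\varrho_0\ln\theta_0$; * for all $\tau\in[0,T]$ and $\varphi\in W^{1,\infty}(\Omega_T)$ (continuous representative), with $g=\tilde\varrho$ and with $g=\tilde\varrho\tilde\theta$, $$\Big[\int_\Omega\langle\mathcal V_{(t,\cdot)};g\rangle\varphi\,dx\Big]_{t=0}^{t=\tau}=\int_0^\tau\!\!\int_\Omega\big[\langle\mathcal V;g\rangle\partial_t\varphi+\langle\mathcal V;g\tilde u\rangle\cdot\nabla\varphi\big]dx\,dt ;$$ * for all $\tau\in[0,T]$ and $\varphi\in C^1(\overline\Omega_T)^d$ with $\varphi=0$ on $[0,T]\times\partial\Omega$, $$\Big[\int_\Omega\langle\mathcal V_{(t,\cdot)};\tilde\varrho\tilde u\rangle\cdot\varphi\,dx\Big]_{t=0}^{t=\tau}=\int_0^\tau\!\!\int_\Omega\big[\langle\mathcal V;\tilde\varrho\tilde u\rangle\cdot\partial_t\varphi+\langle\mathcal V;\tilde\varrho\tilde u\otimes\tilde u+p(\tilde\varrho\tilde\theta)\mathbb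 I\rangle:\nabla\varphi-\mathbb S(\nabla u_{\mathcal V}):\nabla\varphi\big]dx\,dt+\int_0^\tau\!\!\int_{\overline\Omega}\nabla\varphi:d\mathfrak R(t)\,dt ;$$ * for all $0\le\psi\in W^{1,\infty}(\Omega_T)$ and a.a. $\tau\in(0,T)$, $$\Big[\int_\Omega\langle\mathcal V_{(t,\cdot)};\tilde\varrho\ln\tilde\theta\rangle\psi\,dx\Big]_{t=0}^{t=\tau}\ge\int_0^\tau\!\!\int_\Omega\big[\langle\mathcal V;\tilde\varrho\ln\tilde\theta\rangle\partial_t\psi+\langle\mathcal V;\tilde\varrho\ln(\tilde\theta)\,\tilde u\rangle\cdot\nabla\psi\big]dx\,dt ;$$ * there is $C_P>0$ such that for all $U\in L^2(0,T;W^{1,2}_0(\Omega)^d)$ and a.a. $\tau\in(0,T)$ $$\int_0^\tau\!\!\int_\Omega\langle\mathcal V;|\tilde u-U|^2\rangle dx\,dt\le C_P\Big(\int_0^\tau\!\!\int_\Omega|\nabla(u_{\mathcal V}-U)|^2dx\,dt+\int_0^\tau\!\!\int_{\overline\Omega}d\mathfrak E(t)\,dt+\int_{\overline\Omega_\tau}d\mathfrak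 D\Big).$$ **Lemma (relative energy inequality).** Let $\mathcal V$ be a DMV solution with defects $\mathfrak E,\mathfrak D,\mathfrak R$, and let $\varrho,\theta\in C^1(\overline\Omega_T)$, $\varrho,\theta>0$ on $\overline\Omega_T$, and $u\in C^1(\overline\Omega_T)^d\cap L^2(0,T;W^{2,\infty}(\Omega)^d)$ with $u=0$ on $[0,T]\times\partial\Omega$. Put $S=S(\varrho,\theta)$, $\vartheta=\frac1{\gamma-1}\frac{\partial p(\varrho,S)}{\partial S}$, $p=p(\varrho,S)$, and $$E(\mathcal V|\varrho,\theta,u)=\Big\langle\mathcal V;\tfrac12\tilde\varrho|\tilde u-u|^2+P(\tilde\varrho,\tilde S)-\frac{\partial P(\varrho,S)}{\partial\varrho}(\tilde\varrho-\varrho)-\frac{\partial P(\varrho,S)}{\partial S}(\tilde S-S)-P(\varrho,S)\Big\rangle .$$ The function averaged here is nonnegative $\mathcal V_{(0,x)}$-a.s. for a.a. $x\in\Omega$, so that $\int_\Omega E(\mathcal V_{(0,\cdot)}|\varrho,\theta,u)\,dx\in[0,\infty]$ is defined. All terms below with $t>0$ are well defined and finite, and for a.a. $\tau\in(0,T)$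 $$\begin{aligned} &\int_\Omega E(\mathcal V_{(\tau,\cdot)}|\varrho,\theta,u)\,dx+\int_{\overline\Omega}d\mathfrak E(\tau)+\int_{\overline\Omega_\tau}d\mathfrak D+\int_0^\tau\!\!\int_\Omega\mathbb S(\nabla(u_{\mathcal V}-u)):\nabla(u_{\mathcal V}-u)\,dx\,dt\\ &\le\int_\Omega E(\mathcal V_{(0,\cdot)}|\varrho,\theta,u)\,dx-\int_0^\tau\!\!\int_\Omega\big\langle\mathcal V;\tilde\varrho(\tilde u-u)^T\cdot\nabla u\cdot(\tilde u-u)\big\rangle dx\,dt\\ &\quad-\int_0^\tau\!\!\int_\Omega\Big\langle\mathcal V;p(\tilde\varrho,\tilde S)-\frac{\partial p}{\partial\varrho}(\tilde\varrho-\varrho)-\frac{\partial p}{\partial S}(\tilde S-S)-p\Big\rangle\mathrm{div}\,u\,dx\,dt\\ &\quad+\int_0^\tau\!\!\int_\Omega\Big\langle\mathcal V;\frac{\tilde\varrho}{\varrho}(u-\tilde u)\Big\rangle\cdot\big[\varrho\partial_tu+\varrho\nabla u\cdot u+\nabla p-\mathrm{div}\,\mathbb S(\nabla u)\big]dx\,dt\\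 &\quad+\int_0^\tau\!\!\int_\Omega\Big\langle\mathcal V;(\varrho-\tilde\varrho)\frac1\varrho\frac{\partial p}{\partial\varrho}\Big\rangle\big[\partial_t\varrho+\mathrm{div}(\varrho u)\big]dx\,dt+\int_0^\tau\!\!\int_\Omega\Big\langle\mathcal V;(\varrho-\tilde\varrho)\frac1\varrho\frac{\partial p}{\partial S}\Big\rangle\big[\partial_tS+\mathrm{div}(Su)\big]dx\,dt\\ &\quad+\int_0^\tau\!\!\int_\Omega\Big\langle\mathcal V;\frac{\tilde\varrho}{\varrho}S-\tilde S\Big\rangle\Big[\partial_t\vartheta+u\cdot\nabla\vartheta+\frac{\partial p}{\partial S}\,\mathrm{div}\,u\Big]dx\,dt+\int_0^\tau\!\!\int_\Omega\Big\langle\mathcal V;\Big(\frac{\tilde\varrho}{\varrho}S-\tilde S\Big)(\tilde u-u)\Big\rangle\cdot\nabla\vartheta\,dx\,dt\\ &\quad-\int_0^\tau\!\!\int_{\overline\Omega}\nabla u:d\mathfrak R(t)\,dt+\int_0^\tau\!\!\int_\Omega\Big\langle\mathcal V;(\tilde\varrho-\varrho)\frac1\varrho\,\mathrm{div}\,\mathbb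 S(\nabla u)\cdot(u-\tilde u)\Big\rangle dx\,dt , \end{aligned}$$ where the derivatives of $p$ are taken at $(\varrho,S)$. -/

import Mathlib

open MeasureTheory Set Filter Topology
open scoped ENNReal ContDiff

noncomputable section

namespace NSPT

/-- Physical space `ℝ^d` with the Euclidean norm. -/
abbrev Sp (d : ℕ) : Type := EuclideanSpace ℝ (Fin d)

/-- Phase space `ℝ^{d+2}`, with points `y = (ϱ̃, θ̃, ũ)`: `y.1` is the density, `y.2.1` the potential
temperature and `y.2.2` the velocity. -/
abbrev Phase (d : ℕ) : Type := ℝ × ℝ × Sp d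

/-- `d × d` matrices. -/
abbrev Mat (d : ℕ) : Type := Matrix (Fin d) (Fin d) ℝ

/-- The constants of the system: pressure constant `a`, adiabatic index `γ`, viscosities `μ`, `λ`. -/
structure Coeffs where
  a : ℝ
  gamma : ℝ
  mu : ℝ
  lam : ℝ

/-! ### Calculus on space and space-time -/

/-- `Ω_τ = (0, τ) × Ω`. -/
def slab {d : ℕ} (Ω : Set (Sp d)) (τ : ℝ) : Set (ℝ × Sp d) := Ioo 0 τ ×ˢ Ω

/-- `[0, τ] × closure Ω`, the closure of `Ω_τ`. -/
def closedSlab {d : ℕ} (Ω : Set (Sp d)) (τ : ℝ) : Set (ℝ × Sp d) := Icc 0 τ ×ˢ closure Ω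

/-- Frobenius product `A : B`. -/
def frob {d : ℕ} (A B : Mat d) : ℝ := ∑ i, ∑ j, A i j * B i j

/-- The `j`-th coordinate vector. -/
abbrev basisVec {d : ℕ} (j : Fin d) : Sp d := EuclideanSpace.single j (1 : ℝ)

/-- Classical gradient matrix `(∇v)_{ij} = ∂_j v_i`. -/
def gradMat {d : ℕ} (v : Sp d → Sp d) (x : Sp d) : Mat d :=
  Matrix.of fun i j => (fderiv ℝ v x (basisVec j)) i

/-- Classical divergence `∑ i, ∂_i v_i`. -/
def divg {d : ℕ} (v : Sp d → Sp d) (x : Sp d) : ℝ := ∑ i, (fderiv ℝ v x (basisVec i)) i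

/-- Classical time derivative. -/
def dt {d : ℕ} {F : Type*} [NormedAddCommGroup F] [NormedSpace ℝ F]
    (f : ℝ → Sp d → F) (t : ℝ) (x : Sp d) : F := deriv (fun s => f s x) t

/-- The continuous extension to the closure of `Ω_T` of the spatial gradient of `v`. -/
def closedGrad {d : ℕ} (Ω : Set (Sp d)) (T : ℝ) (v : ℝ → Sp d → Sp d) (t : ℝ) (x : Sp d) : Mat d :=
  extendFrom (slab Ω T) (fun q : ℝ × Sp d => gradMat (v q.1) q.2) (t, x)

/-- The class `C¹` on the closure of `Ω_T`: continuous on `[0,T] × closure Ω`, differentiable in `Ω_T`,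
with a space-time derivative that extends continuously to `[0,T] × closure Ω`. -/
def IsC1Closed {d : ℕ} {F : Type*} [NormedAddCommGroup F] [NormedSpace ℝ F]
    (Ω : Set (Sp d)) (T : ℝ) (f : ℝ → Sp d → F) : Prop :=
  ContinuousOn (fun q : ℝ × Sp d => f q.1 q.2) (closedSlab Ω T) ∧
  ∃ Df : ℝ × Sp d → (ℝ × Sp d →L[ℝ] F), ContinuousOn Df (closedSlab Ω T) ∧
    ∀ q ∈ slab Ω T, HasFDerivAt (fun q : ℝ × Sp d => f q.1 q.2) (Df q) q

/-- `φ ∈ W^{1,∞}(Ω_T)` with weak derivatives `∂_t φ = φt` and `∇_x φ = φx`; `φ` is the continuous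
representative (defined up to the times `0` and `T`). -/
structure IsW1Inf {d : ℕ} (Ω : Set (Sp d)) (T : ℝ)
    (φ φt : ℝ → Sp d → ℝ) (φx : ℝ → Sp d → Sp d) : Prop where
  cont : ContinuousOn (fun q : ℝ × Sp d => φ q.1 q.2) (Icc 0 T ×ˢ Ω)
  mem : MemLp (fun q : ℝ × Sp d => φ q.1 q.2) ⊤ (volume.restrict (slab Ω T))
  mem_t : MemLp (fun q : ℝ × Sp d => φt q.1 q.2) ⊤ (volume.restrict (slab Ω T))
  mem_x : MemLp (fun q : ℝ × Sp d => φx q.1 q.2) ⊤ (volume.restrict (slab Ω T))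
  weak_t : ∀ ψ : ℝ × Sp d → ℝ, ContDiff ℝ ∞ ψ → HasCompactSupport ψ → tsupport ψ ⊆ slab Ω T →
    ∫ q in slab Ω T, φ q.1 q.2 * fderiv ℝ ψ q (1, 0) = - ∫ q in slab Ω T, φt q.1 q.2 * ψ q
  weak_x : ∀ ψ : ℝ × Sp d → ℝ, ContDiff ℝ ∞ ψ → HasCompactSupport ψ → tsupport ψ ⊆ slab Ω T →
    ∀ i, ∫ q in slab Ω T, φ q.1 q.2 * fderiv ℝ ψ q (0, basisVec i)
      = - ∫ q in slab Ω T, φx q.1 q.2 i * ψ q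

/-- `w ∈ W_0^{1,2}(Ω)^d` with (weak) gradient `W`: the pair `(w, W)` is the `L²` limit of pairs
`(φ, ∇φ)` with `φ ∈ C_c^∞(Ω)^d`. -/
def IsW012 {d : ℕ} (Ω : Set (Sp d)) (w : Sp d → Sp d) (W : Sp d → Mat d) : Prop :=
  MemLp w 2 (volume.restrict Ω) ∧ (∀ i j, MemLp (fun x => W x i j) 2 (volume.restrict Ω)) ∧
  ∀ ε > 0, ∃ φ : Sp d → Sp d, ContDiff ℝ ∞ φ ∧ HasCompactSupport φ ∧ tsupport φ ⊆ Ω ∧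
    ∫ x in Ω, ‖φ x - w x‖ ^ 2 < ε ∧
    ∫ x in Ω, frob (gradMat φ x - W x) (gradMat φ x - W x) < ε

/-- `U ∈ L²(0,T; W_0^{1,2}(Ω)^d)` with spatial gradient `G`. -/
def IsL2W012 {d : ℕ} (Ω : Set (Sp d)) (T : ℝ) (U : ℝ → Sp d → Sp d) (G : ℝ → Sp d → Mat d) : Prop :=
  MemLp (fun q : ℝ × Sp d => U q.1 q.2) 2 (volume.restrict (slab Ω T)) ∧
  (∀ i j, MemLp (fun q : ℝ × Sp d => G q.1 q.2 i j) 2 (volume.restrict (slab Ω T))) ∧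
  ∀ᵐ t ∂(volume.restrict (Ioo 0 T)), IsW012 Ω (U t) (G t)

/-- `f ∈ C_weak([0,T]; L^p(Ω))`, `1 < p < ∞` (the dual exponent is `p / (p - 1)`). -/
def IsCWeak {d : ℕ} {F : Type*} [NormedAddCommGroup F] [InnerProductSpace ℝ F]
    (Ω : Set (Sp d)) (T p : ℝ) (f : ℝ → Sp d → F) : Prop :=
  (∀ t ∈ Icc 0 T, MemLp (f t) (ENNReal.ofReal p) (volume.restrict Ω)) ∧
  ∀ ψ : Sp d → F, MemLp ψ (ENNReal.ofReal (p / (p - 1))) (volume.restrict Ω) →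
    ContinuousOn (fun t => ∫ x in Ω, inner ℝ (f t x) (ψ x)) (Icc 0 T)

/-! ### Constitutive relations -/

/-- Viscous stress `S(A) = μ (A + Aᵀ - (2/d) tr(A) I) + λ tr(A) I` for a velocity gradient `A`. -/
def stress {d : ℕ} (c : Coeffs) (A : Mat d) : Mat d :=
  c.mu • (A + A.transpose - ((2 / (d : ℝ)) * A.trace) • (1 : Mat d)) + (c.lam * A.trace) • (1 : Mat d)

/-- Pressure as a function of the total potential temperature, `p(z) = a z^γ`. -/
def pressure (c : Coeffs) (z : ℝ) : ℝ := c.a * z ^ c.gamma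

/-- Pressure potential `P(z) = a/(γ-1) z^γ`. -/
def pot (c : Coeffs) (z : ℝ) : ℝ := c.a / (c.gamma - 1) * z ^ c.gamma

/-- Total physical entropy `S(ϱ,θ) = ϱ ln((a θ^γ)^{1/(γ-1)})`, used for `θ > 0` only. -/
def entropy (c : Coeffs) (ρ θ : ℝ) : ℝ := ρ * Real.log ((c.a * θ ^ c.gamma) ^ (1 / (c.gamma - 1)))

/-- Pressure as a function of density and entropy: `p(ϱ,S) = ϱ^γ exp((γ-1) S/ϱ)` for `ϱ > 0`, and
`p(0,S) = 0` for `S ≤ 0`. (The measures below charge only states with `ϱ ≥ 0` and `θ > 0`; there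
`S(ϱ,θ)` is a real number and `ϱ = 0` forces `S = 0`, so the values `S = -∞` and `p = ∞` do not occur.) -/
def pressureRS (c : Coeffs) (ρ S : ℝ) : ℝ :=
  if 0 < ρ then ρ ^ c.gamma * Real.exp ((c.gamma - 1) * (S / ρ)) else 0

/-- Pressure potential as a function of density and entropy. -/
def potRS (c : Coeffs) (ρ S : ℝ) : ℝ := 1 / (c.gamma - 1) * pressureRS c ρ S

/-- `∂p(ϱ,S)/∂ϱ`. -/
def dpdρ (c : Coeffs) (ρ S : ℝ) : ℝ := deriv (fun r => pressureRS c r S) ρ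

/-- `∂p(ϱ,S)/∂S`. -/
def dpdS (c : Coeffs) (ρ S : ℝ) : ℝ := deriv (fun s => pressureRS c ρ s) S

/-- `∂P(ϱ,S)/∂ϱ`. -/
def dPdρ (c : Coeffs) (ρ S : ℝ) : ℝ := deriv (fun r => potRS c r S) ρ

/-- `∂P(ϱ,S)/∂S`. -/
def dPdS (c : Coeffs) (ρ S : ℝ) : ℝ := deriv (fun s => potRS c ρ s) S

/-! ### Parametrized measures -/

/-- `⟨V_{(t,x)}; g⟩`. -/
def avg {d : ℕ} {F : Type*} [NormedAddCommGroup F] [NormedSpace ℝ F]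
    (V : ℝ → Sp d → ProbabilityMeasure (Phase d)) (g : Phase d → F) (t : ℝ) (x : Sp d) : F :=
  ∫ y, g y ∂(V t x : Measure (Phase d))

/-- The mean velocity `u_V = ⟨V; ũ⟩`. -/
def meanVel {d : ℕ} (V : ℝ → Sp d → ProbabilityMeasure (Phase d)) : ℝ → Sp d → Sp d :=
  avg V fun y => y.2.2

/-- `g` is `V_{(t,x)}`-integrable for a.a. `(t,x) ∈ Ω_T`; here `g` may depend on `(t,x)`. -/
def PhaseIntegrable {d : ℕ} {F : Type*} [NormedAddCommGroup F] [NormedSpace ℝ F]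
    (Ω : Set (Sp d)) (T : ℝ) (V : ℝ → Sp d → ProbabilityMeasure (Phase d))
    (g : ℝ → Sp d → Phase d → F) : Prop :=
  ∀ᵐ q ∂(volume.restrict (slab Ω T)), Integrable (g q.1 q.2) (V q.1 q.2 : Measure (Phase d))

/-- `½ ϱ̃ |ũ|² + P(ϱ̃ θ̃)`. -/
def energyDensity {d : ℕ} (c : Coeffs) (y : Phase d) : ℝ :=
  1 / 2 * y.1 * ‖y.2.2‖ ^ 2 + pot c (y.1 * y.2.1)

/-- `ϱ̃ ũ ⊗ ũ + p(ϱ̃ θ̃) I`, entrywise. -/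
def momFlux {d : ℕ} (c : Coeffs) (i j : Fin d) (y : Phase d) : ℝ :=
  y.1 * y.2.2 i * y.2.2 j + pressure c (y.1 * y.2.1) * (1 : Mat d) i j

/-- `∫_{closure Ω} A : dM` for a matrix `M` of signed measures. -/
def pairing {d : ℕ} (Ω : Set (Sp d)) (A : Sp d → Mat d)
    (M : Fin d → Fin d → SignedMeasure (Sp d)) : ℝ :=
  ∑ i, ∑ j, ∫ᵛ x in closure Ω, A x i j ∂•(M i j)

/-- `E ∈ L^∞_{weak*}(0,T; M⁺(closure Ω))`. -/
structure IsEnergyDefect {d : ℕ} (Ω : Set (Sp d)) (T : ℝ) (E : ℝ → Measure (Sp d)) : Prop where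
  support : ∀ᵐ t ∂(volume.restrict (Ioo 0 T)), E t (closure Ω)ᶜ = 0
  bounded : ∃ C : ℝ, ∀ᵐ t ∂(volume.restrict (Ioo 0 T)), E t univ ≤ ENNReal.ofReal C
  meas : ∀ φ : C(Sp d, ℝ),
    AEMeasurable (fun t => ∫ x in closure Ω, φ x ∂(E t)) (volume.restrict (Ioo 0 T))

/-- `D ∈ M⁺([0,T] × closure Ω)`. -/
structure IsDissipationDefect {d : ℕ} (Ω : Set (Sp d)) (T : ℝ) (D : Measure (ℝ × Sp d)) : Prop where
  finite : IsFiniteMeasure D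
  support : D (closedSlab Ω T)ᶜ = 0

/-- `R ∈ L^∞_{weak*}(0,T; M(closure Ω)^{d×d}_{sym,+})`: a family of matrices of signed measures,
symmetric and positive semidefinite. -/
structure IsReynoldsDefect {d : ℕ} (Ω : Set (Sp d)) (T : ℝ)
    (R : ℝ → Fin d → Fin d → SignedMeasure (Sp d)) : Prop where
  support : ∀ᵐ t ∂(volume.restrict (Ioo 0 T)), ∀ i j, ∀ A : Set (Sp d), MeasurableSet A →
    Disjoint A (closure Ω) → R t i j A = 0
  bounded : ∃ C : ℝ, ∀ᵐ t ∂(volume.restrict (Ioo 0 T)), ∀ i j,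
    (R t i j).variation univ ≤ ENNReal.ofReal C
  meas : ∀ φ : C(Sp d, ℝ), ∀ i j,
    AEMeasurable (fun t => ∫ᵛ x in closure Ω, φ x ∂•(R t i j)) (volume.restrict (Ioo 0 T))
  symm : ∀ᵐ t ∂(volume.restrict (Ioo 0 T)), ∀ i j, R t i j = R t j i
  psd : ∀ᵐ t ∂(volume.restrict (Ioo 0 T)), ∀ ξ : Sp d, ∀ φ : C(Sp d, ℝ), (∀ x, 0 ≤ φ x) →
    0 ≤ pairing Ω (fun x => Matrix.of fun i j => φ x * (ξ i * ξ j)) (R t)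

/-- Dissipative measure-valued solutions of the compressible Navier–Stokes system with potential
temperature transport, initial data `(ρ₀, θ₀, u₀)`, no-slip boundary condition.
`V t x` is the measure at `(t,x)`, the initial one being `V 0 x`; `G` is the gradient of the mean
velocity; `E`, `D`, `R` are the energy, dissipation and Reynolds defects. -/
structure IsDMVSolution {d : ℕ} (c : Coeffs) (Ω : Set (Sp d)) (T : ℝ)
    (ρ₀ θ₀ : Sp d → ℝ) (u₀ : Sp d → Sp d)
    (V : ℝ → Sp d → ProbabilityMeasure (Phase d)) (G : ℝ → Sp d → Mat d)
    (E : ℝ → Measure (Sp d)) (D : Measure (ℝ × Sp d))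
    (R : ℝ → Fin d → Fin d → SignedMeasure (Sp d)) : Prop where
  /-- Weak-star measurability. (`Measure` carries the σ-algebra generated by the evaluations at
  measurable sets; on probability measures it is the Borel σ-algebra of weak convergence.) -/
  meas : AEMeasurable (fun q : ℝ × Sp d => (V q.1 q.2 : Measure (Phase d)))
    (volume.restrict (slab Ω T))
  meas_zero : AEMeasurable (fun x => (V 0 x : Measure (Phase d))) (volume.restrict Ω)
  support : ∃ cs > 0,
    (∀ᵐ q ∂(volume.restrict (slab Ω T)), ∀ᵐ y ∂(V q.1 q.2 : Measure (Phase d)), 0 ≤ y.1 ∧ cs ≤ y.2.1) ∧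
    (∀ᵐ x ∂(volume.restrict Ω), ∀ᵐ y ∂(V 0 x : Measure (Phase d)), 0 ≤ y.1 ∧ cs ≤ y.2.1)
  -- energy inequality
  vel_integrable : PhaseIntegrable Ω T V fun _ _ y => y.2.2
  vel_mem : IsL2W012 Ω T (meanVel V) G
  energy_phase : PhaseIntegrable Ω T V fun _ _ y => energyDensity c y
  energy_integrable : IntegrableOn (fun q : ℝ × Sp d => avg V (energyDensity c) q.1 q.2) (slab Ω T)
  energy_init : IntegrableOn (fun x => energyDensity c (ρ₀ x, θ₀ x, u₀ x)) Ω
  energy_defect : IsEnergyDefect Ω T E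
  dissipation_defect : IsDissipationDefect Ω T D
  energy_ineq : ∀ᵐ τ ∂(volume.restrict (Ioo 0 T)),
    (∫ x in Ω, avg V (energyDensity c) τ x)
      + (∫ q in slab Ω τ, frob (stress c (G q.1 q.2)) (G q.1 q.2))
      + (E τ).real (closure Ω) + D.real (closedSlab Ω τ)
      ≤ ∫ x in Ω, energyDensity c (ρ₀ x, θ₀ x, u₀ x)
  -- continuity equation; `r` is the weakly continuous representative of the mean density
  continuity : ∃ r : ℝ → Sp d → ℝ, IsCWeak Ω T c.gamma r ∧
    (∀ᵐ q ∂(volume.restrict (slab Ω T)), r q.1 q.2 = avg V (fun y => y.1) q.1 q.2) ∧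
    (∀ᵐ x ∂(volume.restrict Ω), r 0 x = ρ₀ x) ∧
    ∀ φ φt φx, IsW1Inf Ω T φ φt φx → ∀ τ ∈ Icc 0 T,
      (∫ x in Ω, r τ x * φ τ x) - (∫ x in Ω, r 0 x * φ 0 x)
        = ∫ q in slab Ω τ, (avg V (fun y => y.1) q.1 q.2 * φt q.1 q.2
            + inner ℝ (avg V (fun y => y.1 • y.2.2) q.1 q.2) (φx q.1 q.2))
  -- momentum equation
  reynolds_defect : IsReynoldsDefect Ω T R
  reynolds_trace : ∃ dlow dup : ℝ, 0 < dlow ∧ dlow ≤ dup ∧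
    ∀ᵐ t ∂(volume.restrict (Ioo 0 T)), ∀ A : Set (Sp d), MeasurableSet A →
      dlow * (E t).real A ≤ ∑ i, R t i i A ∧ ∑ i, R t i i A ≤ dup * (E t).real A
  momentum : ∃ m : ℝ → Sp d → Sp d, IsCWeak Ω T (2 * c.gamma / (c.gamma + 1)) m ∧
    (∀ᵐ q ∂(volume.restrict (slab Ω T)), m q.1 q.2 = avg V (fun y => y.1 • y.2.2) q.1 q.2) ∧
    (∀ᵐ x ∂(volume.restrict Ω), m 0 x = ρ₀ x • u₀ x) ∧
    ∀ φ : ℝ → Sp d → Sp d, IsC1Closed Ω T φ →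
      (∀ t ∈ Icc 0 T, ∀ x ∈ frontier Ω, φ t x = 0) → ∀ τ ∈ Icc 0 T,
      (∫ x in Ω, inner ℝ (m τ x) (φ τ x)) - (∫ x in Ω, inner ℝ (m 0 x) (φ 0 x))
        = (∫ q in slab Ω τ, (inner ℝ (avg V (fun y => y.1 • y.2.2) q.1 q.2) (dt φ q.1 q.2)
            + frob (Matrix.of fun i j => avg V (momFlux c i j) q.1 q.2) (gradMat (φ q.1) q.2)))
          - (∫ q in slab Ω τ, frob (stress c (G q.1 q.2)) (gradMat (φ q.1) q.2))
          + ∫ t in Ioo 0 τ, pairing Ω (closedGrad Ω T φ t) (R t)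
  -- potential temperature equation
  temperature : ∃ z : ℝ → Sp d → ℝ, IsCWeak Ω T c.gamma z ∧
    (∀ᵐ q ∂(volume.restrict (slab Ω T)), z q.1 q.2 = avg V (fun y => y.1 * y.2.1) q.1 q.2) ∧
    (∀ᵐ x ∂(volume.restrict Ω), z 0 x = ρ₀ x * θ₀ x) ∧
    ∀ φ φt φx, IsW1Inf Ω T φ φt φx → ∀ τ ∈ Icc 0 T,
      (∫ x in Ω, z τ x * φ τ x) - (∫ x in Ω, z 0 x * φ 0 x)
        = ∫ q in slab Ω τ, (avg V (fun y => y.1 * y.2.1) q.1 q.2 * φt q.1 q.2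
            + inner ℝ (avg V (fun y => (y.1 * y.2.1) • y.2.2) q.1 q.2) (φx q.1 q.2))
  -- initial conditions for the measures `V_{(0,x)}`
  init : ∀ᵐ x ∂(volume.restrict Ω),
    (Integrable (fun y : Phase d => y.1) (V 0 x : Measure (Phase d)) ∧
      avg V (fun y => y.1) 0 x = ρ₀ x) ∧
    (Integrable (fun y : Phase d => y.1 • y.2.2) (V 0 x : Measure (Phase d)) ∧
      avg V (fun y => y.1 • y.2.2) 0 x = ρ₀ x • u₀ x) ∧
    (Integrable (fun y : Phase d => y.1 * y.2.1) (V 0 x : Measure (Phase d)) ∧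
      avg V (fun y => y.1 * y.2.1) 0 x = ρ₀ x * θ₀ x) ∧
    (Integrable (fun y : Phase d => y.1 * Real.log y.2.1) (V 0 x : Measure (Phase d)) ∧
      avg V (fun y => y.1 * Real.log y.2.1) 0 x = ρ₀ x * Real.log (θ₀ x))
  -- entropy inequality
  entropy_ineq : ∀ ψ ψt ψx, IsW1Inf Ω T ψ ψt ψx → (∀ t ∈ Icc 0 T, ∀ x ∈ Ω, 0 ≤ ψ t x) →
    ∀ᵐ τ ∂(volume.restrict (Ioo 0 T)),
      (∫ x in Ω, avg V (fun y => y.1 * Real.log y.2.1) τ x * ψ τ x)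
          - (∫ x in Ω, avg V (fun y => y.1 * Real.log y.2.1) 0 x * ψ 0 x)
        ≥ ∫ q in slab Ω τ, (avg V (fun y => y.1 * Real.log y.2.1) q.1 q.2 * ψt q.1 q.2
            + inner ℝ (avg V (fun y => (y.1 * Real.log y.2.1) • y.2.2) q.1 q.2) (ψx q.1 q.2))
  -- Poincaré's inequality
  poincare : ∃ CP > 0, ∀ U GU, IsL2W012 Ω T U GU → ∀ᵐ τ ∂(volume.restrict (Ioo 0 T)),
    ∫⁻ q in slab Ω τ, ∫⁻ y, ENNReal.ofReal (‖y.2.2 - U q.1 q.2‖ ^ 2) ∂(V q.1 q.2 : Measure (Phase d))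
      ≤ ENNReal.ofReal (CP *
        ((∫ q in slab Ω τ, frob (G q.1 q.2 - GU q.1 q.2) (G q.1 q.2 - GU q.1 q.2))
          + (∫ t in Ioo 0 τ, (E t).real (closure Ω)) + D.real (closedSlab Ω τ)))

/-! ### Test triples and the relative energy -/

/-- A triple of functions `(ϱ, θ, u)` of time and space. -/
structure Triple (d : ℕ) where
  ρ : ℝ → Sp d → ℝ
  θ : ℝ → Sp d → ℝ
  u : ℝ → Sp d → Sp d

namespace Triple

/-- `S = S(ϱ,θ)`. -/
def S {d : ℕ} (w : Triple d) (c : Coeffs) (t : ℝ) (x : Sp d) : ℝ := entropy c (w.ρ t x) (w.θ t x)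

/-- `p(ϱ,S)`. -/
def p {d : ℕ} (w : Triple d) (c : Coeffs) (t : ℝ) (x : Sp d) : ℝ := pressureRS c (w.ρ t x) (w.S c t x)

/-- `∂p(ϱ,S)/∂ϱ`. -/
def p_ρ {d : ℕ} (w : Triple d) (c : Coeffs) (t : ℝ) (x : Sp d) : ℝ := dpdρ c (w.ρ t x) (w.S c t x)

/-- `∂p(ϱ,S)/∂S`. -/
def p_S {d : ℕ} (w : Triple d) (c : Coeffs) (t : ℝ) (x : Sp d) : ℝ := dpdS c (w.ρ t x) (w.S c t x)

/-- Absolute temperature `ϑ = 1/(γ-1) ∂p(ϱ,S)/∂S`. -/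
def temp {d : ℕ} (w : Triple d) (c : Coeffs) (t : ℝ) (x : Sp d) : ℝ :=
  1 / (c.gamma - 1) * w.p_S c t x

end Triple

/-- Admissible test triples: `ϱ, θ, u ∈ C¹` on the closure of `Ω_T`, `ϱ, θ > 0` there,
`u ∈ L²(0,T; W^{2,∞}(Ω))`, `u = 0` on `[0,T] × ∂Ω`. The function `H` is the weak second spatial
derivative of `u`: `H t x i j k = ∂_k ∂_j u_i (t,x)`. -/
structure IsTestTriple {d : ℕ} (Ω : Set (Sp d)) (T : ℝ) (w : Triple d)
    (H : ℝ → Sp d → Fin d → Fin d → Fin d → ℝ) : Prop where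
  ρ_C1 : IsC1Closed Ω T w.ρ
  θ_C1 : IsC1Closed Ω T w.θ
  u_C1 : IsC1Closed Ω T w.u
  ρ_pos : ∀ t ∈ Icc 0 T, ∀ x ∈ closure Ω, 0 < w.ρ t x
  θ_pos : ∀ t ∈ Icc 0 T, ∀ x ∈ closure Ω, 0 < w.θ t x
  u_bdry : ∀ t ∈ Icc 0 T, ∀ x ∈ frontier Ω, w.u t x = 0
  H_meas : AEStronglyMeasurable (fun q : ℝ × Sp d => H q.1 q.2) (volume.restrict (slab Ω T))
  H_bound : ∃ h : ℝ → ℝ, MemLp h 2 (volume.restrict (Ioo 0 T)) ∧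
    ∀ᵐ t ∂(volume.restrict (Ioo 0 T)), ∀ᵐ x ∂(volume.restrict Ω), ‖H t x‖ ≤ h t
  H_weak : ∀ᵐ t ∂(volume.restrict (Ioo 0 T)), ∀ i j k, ∀ ψ : Sp d → ℝ,
    ContDiff ℝ ∞ ψ → HasCompactSupport ψ → tsupport ψ ⊆ Ω →
    ∫ x in Ω, gradMat (w.u t) x i j * fderiv ℝ ψ x (basisVec k) = - ∫ x in Ω, H t x i j k * ψ x

/-- `div S(∇u)`, `i`-th component `∑ j, ∂_j S(∇u)_{ij} = ∑ j, S(∂_j ∇u)_{ij}` (`S` is linear), in terms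
of the second derivatives `H i j k = ∂_k ∂_j u_i`. -/
def divStress {d : ℕ} (c : Coeffs) (H : Fin d → Fin d → Fin d → ℝ) : Sp d :=
  WithLp.toLp 2 fun i => ∑ j, stress c (Matrix.of fun k l => H k l j) i j

/-- The integrand of the relative energy, as a function of the state `y = (ϱ̃, θ̃, ũ)`. -/
def relDensity {d : ℕ} (c : Coeffs) (w : Triple d) (t : ℝ) (x : Sp d) (y : Phase d) : ℝ :=
  1 / 2 * y.1 * ‖y.2.2 - w.u t x‖ ^ 2 + potRS c y.1 (entropy c y.1 y.2.1)
    - dPdρ c (w.ρ t x) (w.S c t x) * (y.1 - w.ρ t x)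
    - dPdS c (w.ρ t x) (w.S c t x) * (entropy c y.1 y.2.1 - w.S c t x)
    - potRS c (w.ρ t x) (w.S c t x)

/-- The relative energy `E(V_{(t,x)} | ϱ, θ, u)`. -/
def relEnergy {d : ℕ} (c : Coeffs) (V : ℝ → Sp d → ProbabilityMeasure (Phase d)) (w : Triple d)
    (t : ℝ) (x : Sp d) : ℝ := avg V (relDensity c w t x) t x

/-- `∫_Ω E(V_{(0,x)} | ϱ, θ, u) dx ∈ [0,∞]`; the integrand is nonnegative on the states that are
charged by `V_{(0,x)}`, and the initial value may be infinite. -/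
def initRelEnergy {d : ℕ} (c : Coeffs) (Ω : Set (Sp d))
    (V : ℝ → Sp d → ProbabilityMeasure (Phase d)) (w : Triple d) : ℝ≥0∞ :=
  ∫⁻ x in Ω, ∫⁻ y, ENNReal.ofReal (relDensity c w 0 x y) ∂(V 0 x : Measure (Phase d))

/-! ### The averaged functions in the remainder -/

/-- `ϱ̃ (ũ - u)ᵀ · ∇u · (ũ - u)`. -/
def phiConv {d : ℕ} (w : Triple d) (t : ℝ) (x : Sp d) (y : Phase d) : ℝ :=
  y.1 * inner ℝ (y.2.2 - w.u t x) (fderiv ℝ (w.u t) x (y.2.2 - w.u t x))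

/-- `p(ϱ̃,S̃) - ∂p/∂ϱ(ϱ,S) (ϱ̃ - ϱ) - ∂p/∂S(ϱ,S) (S̃ - S) - p(ϱ,S)`. -/
def phiPress {d : ℕ} (c : Coeffs) (w : Triple d) (t : ℝ) (x : Sp d) (y : Phase d) : ℝ :=
  pressureRS c y.1 (entropy c y.1 y.2.1) - w.p_ρ c t x * (y.1 - w.ρ t x)
    - w.p_S c t x * (entropy c y.1 y.2.1 - w.S c t x) - w.p c t x

/-- `(ϱ̃/ϱ) (u - ũ)`. -/
def phiMom {d : ℕ} (w : Triple d) (t : ℝ) (x : Sp d) (y : Phase d) : Sp d :=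
  (y.1 / w.ρ t x) • (w.u t x - y.2.2)

/-- `(ϱ - ϱ̃) (1/ϱ) ∂p/∂ϱ(ϱ,S)`. -/
def phiMass {d : ℕ} (c : Coeffs) (w : Triple d) (t : ℝ) (x : Sp d) (y : Phase d) : ℝ :=
  (w.ρ t x - y.1) * (1 / w.ρ t x) * w.p_ρ c t x

/-- `(ϱ - ϱ̃) (1/ϱ) ∂p/∂S(ϱ,S)`. -/
def phiEnt {d : ℕ} (c : Coeffs) (w : Triple d) (t : ℝ) (x : Sp d) (y : Phase d) : ℝ :=
  (w.ρ t x - y.1) * (1 / w.ρ t x) * w.p_S c t x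

/-- `(ϱ̃/ϱ) S - S̃`. -/
def phiTemp {d : ℕ} (c : Coeffs) (w : Triple d) (t : ℝ) (x : Sp d) (y : Phase d) : ℝ :=
  y.1 / w.ρ t x * w.S c t x - entropy c y.1 y.2.1

/-- `((ϱ̃/ϱ) S - S̃) (ũ - u)`. -/
def phiFlux {d : ℕ} (c : Coeffs) (w : Triple d) (t : ℝ) (x : Sp d) (y : Phase d) : Sp d :=
  phiTemp c w t x y • (y.2.2 - w.u t x)

/-- `(ϱ̃ - ϱ) (1/ϱ) div S(∇u) · (u - ũ)`. -/
def phiVisc {d : ℕ} (c : Coeffs) (w : Triple d) (H : ℝ → Sp d → Fin d → Fin d → Fin d → ℝ)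
    (t : ℝ) (x : Sp d) (y : Phase d) : ℝ :=
  (y.1 - w.ρ t x) * (1 / w.ρ t x) * inner ℝ (divStress c (H t x)) (w.u t x - y.2.2)

/-! ### The space-time integrands of the inequality -/

section Terms

variable {d : ℕ} (c : Coeffs) (V : ℝ → Sp d → ProbabilityMeasure (Phase d)) (w : Triple d)

/-- `S(∇(u_V - u)) : ∇(u_V - u)`, with `G = ∇u_V`. -/
def termDiss (G : ℝ → Sp d → Mat d) (t : ℝ) (x : Sp d) : ℝ :=
  frob (stress c (G t x - gradMat (w.u t) x)) (G t x - gradMat (w.u t) x)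

/-- `⟨V; ϱ̃ (ũ - u)ᵀ · ∇u · (ũ - u)⟩`. -/
def termConv (t : ℝ) (x : Sp d) : ℝ := avg V (phiConv w t x) t x

/-- `⟨V; p(ϱ̃,S̃) - ∂p/∂ϱ (ϱ̃ - ϱ) - ∂p/∂S (S̃ - S) - p⟩ div u`. -/
def termPress (t : ℝ) (x : Sp d) : ℝ := avg V (phiPress c w t x) t x * divg (w.u t) x

/-- `⟨V; (ϱ̃/ϱ)(u - ũ)⟩ · [ϱ ∂_t u + ϱ ∇u · u + ∇p - div S(∇u)]`. -/
def termMom (H : ℝ → Sp d → Fin d → Fin d → Fin d → ℝ) (t : ℝ) (x : Sp d) : ℝ :=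
  inner ℝ (avg V (phiMom w t x) t x)
    (w.ρ t x • dt w.u t x + w.ρ t x • fderiv ℝ (w.u t) x (w.u t x) + gradient (w.p c t) x
      - divStress c (H t x))

/-- `⟨V; (ϱ - ϱ̃)(1/ϱ) ∂p/∂ϱ⟩ [∂_t ϱ + div(ϱ u)]`. -/
def termMass (t : ℝ) (x : Sp d) : ℝ :=
  avg V (phiMass c w t x) t x * (dt w.ρ t x + divg (fun x' => w.ρ t x' • w.u t x') x)

/-- `⟨V; (ϱ - ϱ̃)(1/ϱ) ∂p/∂S⟩ [∂_t S + div(S u)]`. -/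
def termEnt (t : ℝ) (x : Sp d) : ℝ :=
  avg V (phiEnt c w t x) t x * (dt (w.S c) t x + divg (fun x' => w.S c t x' • w.u t x') x)

/-- `⟨V; (ϱ̃/ϱ) S - S̃⟩ [∂_t ϑ + u · ∇ϑ + ∂p/∂S div u]`. -/
def termTemp (t : ℝ) (x : Sp d) : ℝ :=
  avg V (phiTemp c w t x) t x *
    (dt (w.temp c) t x + inner ℝ (w.u t x) (gradient (w.temp c t) x) + w.p_S c t x * divg (w.u t) x)

/-- `⟨V; ((ϱ̃/ϱ) S - S̃)(ũ - u)⟩ · ∇ϑ`. -/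
def termFlux (t : ℝ) (x : Sp d) : ℝ :=
  inner ℝ (avg V (phiFlux c w t x) t x) (gradient (w.temp c t) x)

/-- `⟨V; (ϱ̃ - ϱ)(1/ϱ) div S(∇u) · (u - ũ)⟩`. -/
def termVisc (H : ℝ → Sp d → Fin d → Fin d → Fin d → ℝ) (t : ℝ) (x : Sp d) : ℝ :=
  avg V (phiVisc c w H t x) t x

/-- `∫_{closure Ω} ∇u : dR(t)`. -/
def termReynolds (Ω : Set (Sp d)) (T : ℝ) (R : ℝ → Fin d → Fin d → SignedMeasure (Sp d)) (t : ℝ) : ℝ :=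
  pairing Ω (closedGrad Ω T w.u t) (R t)

/-- All terms of the remainder and the dissipation term are well defined: the averaged functions are
`V_{(t,x)}`-integrable for a.a. `(t,x)`, and the resulting functions are integrable over `Ω_T`. -/
structure TermsWellDefined (Ω : Set (Sp d)) (T : ℝ) (G : ℝ → Sp d → Mat d)
    (H : ℝ → Sp d → Fin d → Fin d → Fin d → ℝ)
    (R : ℝ → Fin d → Fin d → SignedMeasure (Sp d)) : Prop where
  conv_phase : PhaseIntegrable Ω T V (phiConv w)
  press_phase : PhaseIntegrable Ω T V (phiPress c w)
  mom_phase : PhaseIntegrable Ω T V (phiMom w)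
  mass_phase : PhaseIntegrable Ω T V (phiMass c w)
  ent_phase : PhaseIntegrable Ω T V (phiEnt c w)
  temp_phase : PhaseIntegrable Ω T V (phiTemp c w)
  flux_phase : PhaseIntegrable Ω T V (phiFlux c w)
  visc_phase : PhaseIntegrable Ω T V (phiVisc c w H)
  diss : IntegrableOn (fun q : ℝ × Sp d => termDiss c w G q.1 q.2) (slab Ω T)
  conv : IntegrableOn (fun q : ℝ × Sp d => termConv V w q.1 q.2) (slab Ω T)
  press : IntegrableOn (fun q : ℝ × Sp d => termPress c V w q.1 q.2) (slab Ω T)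
  mom : IntegrableOn (fun q : ℝ × Sp d => termMom c V w H q.1 q.2) (slab Ω T)
  mass : IntegrableOn (fun q : ℝ × Sp d => termMass c V w q.1 q.2) (slab Ω T)
  ent : IntegrableOn (fun q : ℝ × Sp d => termEnt c V w q.1 q.2) (slab Ω T)
  temp : IntegrableOn (fun q : ℝ × Sp d => termTemp c V w q.1 q.2) (slab Ω T)
  flux : IntegrableOn (fun q : ℝ × Sp d => termFlux c V w q.1 q.2) (slab Ω T)
  visc : IntegrableOn (fun q : ℝ × Sp d => termVisc c V w H q.1 q.2) (slab Ω T)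
  reynolds : IntegrableOn (termReynolds w Ω T R) (Ioo 0 T)

end Terms

end NSPT

end

open NSPT

noncomputable section

namespace NSPT

/-! ### Constitutive relations -/

/-! The integrand of the relative energy is affine in four moments of the measure: the energy, ϱ̃ũ,
ϱ̃ and ϱ̃ ln θ̃ (`relDensity_eq`). Indeed S̃ is a linear combination of ϱ̃ and ϱ̃ ln θ̃, P(ϱ̃,S̃) is
P(ϱ̃θ̃), and the Legendre identity ϱ ∂P/∂ϱ + S ∂P/∂S - P = p collects what is left into p(ϱ,S). Each
moment is governed by one balance law. The proof therefore takes the energy inequality, subtracts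
the momentum equation tested with u, adds the continuity equation tested with `densityTest`,
subtracts γ/(γ-1) times the entropy inequality tested with ϑ ≥ 0, and adds the fundamental theorem
of calculus for ∫ p dx.

The integrands obtained in this way agree pointwise with those of the claim, up to two expressions:
S(∇u):∇(u_V - u) + div S(∇u)·(u_V - u), and p div u + u·∇p. The pointwise part is algebra
(`remainder_scalar_identity`) resting on the chain rule for p and the Gibbs–Duhem relation, which
eliminates the derivatives of ∂P/∂ϱ. The two leftover expressions have zero integral because u_V(t)
and u(t) lie in W_0^{1,2}. For u this membership is proved without any regularity of ∂Ω: small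
values of u are cut off, the result has compact support in Ω and is mollified
(`exists_test_approx`).

At t = 0 the balance laws produce the energy of the data, whereas the claim involves an average over
the initial measures. Since these have prescribed mean density, momentum and total potential
temperature, and the energy is convex in those quantities, Jensen's inequality
(`ofReal_le_lintegral_relDensity`) bounds the former by the latter, which may be infinite.

Everything is integrable because θ̃ ≥ c_⋆ > 0 lets the energy dominate all moments that occur
(`exists_energy_bound`). The coefficients built from the test triple are bounded, with the exception
of div S(∇u), which is only square integrable in time with values in L^∞. It is paired with moments
that the energy inequality bounds in L^∞(0,T;L¹), and with the velocity difference, which lies in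
L². -/

lemma entropy_eq {c : Coeffs} (ha : 0 < c.a) (ρ : ℝ) {θ : ℝ} (hθ : 0 < θ) :
    entropy c ρ θ = ρ * ((Real.log c.a + c.gamma * Real.log θ) / (c.gamma - 1)) := by
  have h1 : 0 < θ ^ c.gamma := Real.rpow_pos_of_pos hθ _
  rw [entropy, Real.log_rpow (mul_pos ha h1), Real.log_mul ha.ne' h1.ne', Real.log_rpow hθ]
  ring

lemma pressureRS_of_pos (c : Coeffs) {ρ : ℝ} (hρ : 0 < ρ) (S : ℝ) :
    pressureRS c ρ S = ρ ^ c.gamma * Real.exp ((c.gamma - 1) * (S / ρ)) := if_pos hρ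

lemma pressureRS_pos (c : Coeffs) {ρ : ℝ} (hρ : 0 < ρ) (S : ℝ) : 0 < pressureRS c ρ S := by
  rw [pressureRS_of_pos c hρ]; positivity

/-- The exponential undoes the logarithm in the entropy, so in the original variables the pressure
is a pure power of ϱθ. Vacuum is included: there both sides are 0, as γ ≠ 0. -/
lemma pressureRS_entropy {c : Coeffs} (ha : 0 < c.a) (hγ : 1 < c.gamma) {ρ θ : ℝ} (hρ : 0 ≤ ρ)
    (hθ : 0 < θ) : pressureRS c ρ (entropy c ρ θ) = pressure c (ρ * θ) := by
  rcases hρ.eq_or_lt with rfl | hρ'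
  · simp [pressureRS, pressure, Real.zero_rpow (by linarith : c.gamma ≠ 0)]
  · have hg : c.gamma - 1 ≠ 0 := by linarith
    rw [pressureRS_of_pos c hρ', entropy_eq ha ρ hθ, pressure, Real.mul_rpow hρ hθ.le,
      Real.rpow_def_of_pos hθ]
    have : (c.gamma - 1) * (ρ * ((Real.log c.a + c.gamma * Real.log θ) / (c.gamma - 1)) / ρ)
        = Real.log c.a + Real.log θ * c.gamma := by field_simp
    rw [this, Real.exp_add, Real.exp_log ha]
    ring

lemma potRS_entropy {c : Coeffs} (ha : 0 < c.a) (hγ : 1 < c.gamma) {ρ θ : ℝ} (hρ : 0 ≤ ρ)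
    (hθ : 0 < θ) : potRS c ρ (entropy c ρ θ) = pot c (ρ * θ) := by
  rw [potRS, pressureRS_entropy ha hγ hρ hθ, pressure, pot]; ring

/-- The partial derivative of the pressure with respect to the density, in closed form. -/
lemma hasDerivAt_pressureRS_density (c : Coeffs) {ρ : ℝ} (hρ : 0 < ρ) (S : ℝ) :
    HasDerivAt (fun r => pressureRS c r S)
      (pressureRS c ρ S / ρ * (c.gamma - (c.gamma - 1) * (S / ρ))) ρ := by
  have h1 : HasDerivAt (fun r : ℝ => r ^ c.gamma) (c.gamma * ρ ^ (c.gamma - 1)) ρ :=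
    Real.hasDerivAt_rpow_const (Or.inl hρ.ne')
  have h2 : HasDerivAt (fun r : ℝ => Real.exp ((c.gamma - 1) * (S / r)))
      (Real.exp ((c.gamma - 1) * (S / ρ)) * ((c.gamma - 1) * (S * -(ρ ^ 2)⁻¹))) ρ := by
    have := (((hasDerivAt_inv hρ.ne').const_mul S).const_mul (c.gamma - 1)).exp
    simpa [div_eq_mul_inv] using this
  have h3 := h1.mul h2
  refine (h3.congr_of_eventuallyEq ?_).congr_deriv ?_
  · filter_upwards [lt_mem_nhds hρ] with r hr
    simp [pressureRS_of_pos c hr]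
  · rw [pressureRS_of_pos c hρ, Real.rpow_sub hρ, Real.rpow_one]
    field_simp
    ring

lemma hasDerivAt_pressureRS_entropy (c : Coeffs) {ρ : ℝ} (hρ : 0 < ρ) (S : ℝ) :
    HasDerivAt (fun s => pressureRS c ρ s) ((c.gamma - 1) * (pressureRS c ρ S / ρ)) S := by
  have h := ((((hasDerivAt_id S).div_const ρ).const_mul (c.gamma - 1)).exp).const_mul
    (ρ ^ c.gamma)
  refine (h.congr_of_eventuallyEq ?_).congr_deriv ?_
  · exact Eventually.of_forall fun r => by simp [pressureRS_of_pos c hρ]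
  · rw [pressureRS_of_pos c hρ]; simp; ring

lemma dpdρ_eq (c : Coeffs) {ρ : ℝ} (hρ : 0 < ρ) (S : ℝ) :
    dpdρ c ρ S = pressureRS c ρ S / ρ * (c.gamma - (c.gamma - 1) * (S / ρ)) :=
  (hasDerivAt_pressureRS_density c hρ S).deriv

lemma dpdS_eq (c : Coeffs) {ρ : ℝ} (hρ : 0 < ρ) (S : ℝ) :
    dpdS c ρ S = (c.gamma - 1) * (pressureRS c ρ S / ρ) :=
  (hasDerivAt_pressureRS_entropy c hρ S).deriv

lemma dPdρ_eq {c : Coeffs} (hγ : 1 < c.gamma) {ρ : ℝ} (hρ : 0 < ρ) (S : ℝ) :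
    dPdρ c ρ S = pressureRS c ρ S / ρ * (c.gamma / (c.gamma - 1) - S / ρ) := by
  have h := ((hasDerivAt_pressureRS_density c hρ S).const_mul (1 / (c.gamma - 1))).deriv
  have hg : c.gamma - 1 ≠ 0 := by linarith
  rw [dPdρ]; simp only [potRS]; rw [h]; field_simp

lemma dPdS_eq {c : Coeffs} (hγ : 1 < c.gamma) {ρ : ℝ} (hρ : 0 < ρ) (S : ℝ) :
    dPdS c ρ S = pressureRS c ρ S / ρ := by
  have h := ((hasDerivAt_pressureRS_entropy c hρ S).const_mul (1 / (c.gamma - 1))).deriv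
  have hg : c.gamma - 1 ≠ 0 := by linarith
  rw [dPdS]; simp only [potRS]; rw [h]; field_simp

/-- The pressure as a function on the open half-plane of positive densities. -/
lemma hasFDerivAt_pressureRS (c : Coeffs) {ρ : ℝ} (hρ : 0 < ρ) (S : ℝ) :
    HasFDerivAt (fun z : ℝ × ℝ => pressureRS c z.1 z.2)
      (dpdρ c ρ S • ContinuousLinearMap.fst ℝ ℝ ℝ + dpdS c ρ S • ContinuousLinearMap.snd ℝ ℝ ℝ)
      (ρ, S) := by
  have h1 : HasFDerivAt (fun z : ℝ × ℝ => z.1 ^ c.gamma)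
      ((c.gamma * ρ ^ (c.gamma - 1)) • ContinuousLinearMap.fst ℝ ℝ ℝ) (ρ, S) :=
    HasDerivAt.comp_hasFDerivAt (h₂ := fun r : ℝ => r ^ c.gamma) (ρ, S)
      (Real.hasDerivAt_rpow_const (Or.inl hρ.ne')) hasFDerivAt_fst
  have hinv : HasFDerivAt (fun z : ℝ × ℝ => z.1⁻¹)
      ((-(ρ ^ 2)⁻¹) • ContinuousLinearMap.fst ℝ ℝ ℝ) (ρ, S) :=
    HasDerivAt.comp_hasFDerivAt (h₂ := fun r : ℝ => r⁻¹) (ρ, S) (hasDerivAt_inv hρ.ne')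
      hasFDerivAt_fst
  have hsnd := hasFDerivAt_snd (𝕜 := ℝ) (E := ℝ) (F := ℝ) (p := (ρ, S))
  have h2 := ((hsnd.mul hinv).const_mul (c.gamma - 1)).exp
  have h3 := h1.mul h2
  refine (h3.congr_of_eventuallyEq ?_).congr_fderiv ?_
  · have : ∀ᶠ z : ℝ × ℝ in 𝓝 (ρ, S), 0 < z.1 :=
      continuous_fst.continuousAt.eventually (lt_mem_nhds hρ)
    filter_upwards [this] with z hz
    simp [pressureRS_of_pos c hz, div_eq_mul_inv]
  · rw [dpdρ_eq c hρ, dpdS_eq c hρ, pressureRS_of_pos c hρ, Real.rpow_sub hρ, Real.rpow_one]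
    ext <;> simp [smul_eq_mul] <;> field_simp
    ring

/-- `ϱ ∂P/∂ϱ + S ∂P/∂S - P = p`. -/
lemma legendre_pressure {c : Coeffs} (hγ : 1 < c.gamma) {ρ : ℝ} (hρ : 0 < ρ) (S : ℝ) :
    dPdρ c ρ S * ρ + dPdS c ρ S * S - potRS c ρ S = pressureRS c ρ S := by
  have hg : c.gamma - 1 ≠ 0 := by linarith
  rw [dPdρ_eq hγ hρ, dPdS_eq hγ hρ, potRS]
  field_simp
  ring

/-- The tangent plane inequality of the convex function `P(ϱ,S)`. -/
lemma potRS_tangent_nonneg {c : Coeffs} (ha : 0 < c.a) (hγ : 1 < c.gamma) {ρ : ℝ} (hρ : 0 < ρ)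
    (S : ℝ) {ρ' θ' : ℝ} (hρ' : 0 ≤ ρ') (hθ' : 0 < θ') :
    0 ≤ potRS c ρ' (entropy c ρ' θ') - dPdρ c ρ S * (ρ' - ρ)
      - dPdS c ρ S * (entropy c ρ' θ' - S) - potRS c ρ S := by
  have hL := legendre_pressure hγ hρ S
  have hp := pressureRS_pos c hρ S
  -- The Legendre identity turns all terms that do not involve the state (ρ', θ') into the pressure
  -- at (ρ, S). In vacuum this positive pressure is all that remains.
  suffices h : 0 ≤ potRS c ρ' (entropy c ρ' θ') - dPdρ c ρ S * ρ'
      - dPdS c ρ S * entropy c ρ' θ' + pressureRS c ρ S by linarith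
  rcases hρ'.eq_or_lt with rfl | h0
  · simp [potRS, pressureRS, entropy] ; simpa [pressureRS] using hp.le
  · have hg : 0 < c.gamma - 1 := by linarith
    set s' : ℝ := (Real.log c.a + c.gamma * Real.log θ') / (c.gamma - 1) with hs'
    have hS' : entropy c ρ' θ' = ρ' * s' := entropy_eq ha ρ' hθ'
    set s : ℝ := S / ρ with hs
    set x : ℝ := ρ' / ρ with hx
    have hx0 : 0 < x := div_pos h0 hρ
    have hρx : ρ' = ρ * x := by rw [hx]; field_simp
    set P := pressureRS c ρ S with hP
    have hP' : pressureRS c ρ' (ρ' * s') = P * (x ^ c.gamma * Real.exp ((c.gamma - 1) * (s' - s))) := by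
      rw [hP, pressureRS_of_pos c hρ, pressureRS_of_pos c h0, mul_div_cancel_left₀ _ h0.ne', hρx,
        Real.mul_rpow hρ.le hx0.le, mul_sub, Real.exp_sub, hs]
      field_simp
    rw [hS', potRS, hP', dPdρ_eq hγ hρ, dPdS_eq hγ hρ, ← hP, ← hs, hρx]
    have e1 : x ^ c.gamma = x * Real.exp (Real.log x * (c.gamma - 1)) := by
      rw [← Real.rpow_def_of_pos hx0, Real.rpow_sub_one hx0.ne']; field_simp
    -- With x the density ratio and s, s' the specific entropies, division by the pressure leaves
    -- this inequality. Write x^γ = x exp((γ-1) log x) and bound the exponential below by its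
    -- tangent at 0. What remains is x log x - x + 1 ≥ 0, that is log x ≥ 1 - 1/x.
    have key : 0 ≤ 1 / (c.gamma - 1) * (x ^ c.gamma * Real.exp ((c.gamma - 1) * (s' - s)))
        - (c.gamma / (c.gamma - 1) - s) * x - x * s' + 1 := by
      have h1 := Real.add_one_le_exp (Real.log x * (c.gamma - 1) + (c.gamma - 1) * (s' - s))
      have h2 : x * (Real.log x * (c.gamma - 1) + (c.gamma - 1) * (s' - s) + 1)
          ≤ x ^ c.gamma * Real.exp ((c.gamma - 1) * (s' - s)) := by
        rw [e1, mul_assoc, ← Real.exp_add]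
        exact mul_le_mul_of_nonneg_left h1 hx0.le
      have h3 : 0 ≤ x * Real.log x - x + 1 := by
        have := Real.one_sub_inv_le_log_of_pos hx0
        have := mul_le_mul_of_nonneg_left this hx0.le
        rw [mul_sub, mul_one, mul_inv_cancel₀ hx0.ne'] at this
        linarith
      have h4 : 1 / (c.gamma - 1) * (x * (Real.log x * (c.gamma - 1) + (c.gamma - 1) * (s' - s) + 1))
          ≤ 1 / (c.gamma - 1) * (x ^ c.gamma * Real.exp ((c.gamma - 1) * (s' - s))) :=
        mul_le_mul_of_nonneg_left h2 (by positivity)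
      have h5 : 1 / (c.gamma - 1) * (x * (Real.log x * (c.gamma - 1) + (c.gamma - 1) * (s' - s) + 1))
          = x * Real.log x + x * (s' - s) + x / (c.gamma - 1) := by field_simp
      have h6 : c.gamma / (c.gamma - 1) = 1 + 1 / (c.gamma - 1) := by field_simp; ring
      rw [h6]
      have h7 : (1 + 1 / (c.gamma - 1) - s) * x = x + x / (c.gamma - 1) - s * x := by ring
      rw [h7]
      rw [h5] at h4
      nlinarith
    have := mul_nonneg hp.le key
    have e2 : 1 / (c.gamma - 1) * (P * (x ^ c.gamma * Real.exp ((c.gamma - 1) * (s' - s)))) -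
        P / ρ * (c.gamma / (c.gamma - 1) - s) * (ρ * x) - P / ρ * (ρ * x * s') + P
        = P * (1 / (c.gamma - 1) * (x ^ c.gamma * Real.exp ((c.gamma - 1) * (s' - s)))
        - (c.gamma / (c.gamma - 1) - s) * x - x * s' + 1) := by
      field_simp
    rw [e2]; exact this

variable {d : ℕ}

lemma relDensity_nonneg {c : Coeffs} (ha : 0 < c.a) (hγ : 1 < c.gamma) {w : Triple d} {t : ℝ}
    {x : Sp d} (hρ : 0 < w.ρ t x) {y : Phase d} (hy1 : 0 ≤ y.1) (hy2 : 0 < y.2.1) :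
    0 ≤ relDensity c w t x y := by
  have h := potRS_tangent_nonneg ha hγ hρ (w.S c t x) hy1 hy2
  have h2 : 0 ≤ 1 / 2 * y.1 * ‖y.2.2 - w.u t x‖ ^ 2 := by positivity
  rw [relDensity]; linarith

/-- The relative energy density is affine in the averaged quantities that occur in the balance
laws. -/
lemma relDensity_eq {c : Coeffs} (ha : 0 < c.a) (hγ : 1 < c.gamma) {w : Triple d} {t : ℝ}
    {x : Sp d} (hρ : 0 < w.ρ t x) {y : Phase d} (hy1 : 0 ≤ y.1) (hy2 : 0 < y.2.1) :
    relDensity c w t x y = energyDensity c y - inner ℝ (y.1 • y.2.2) (w.u t x)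
      + y.1 * (1 / 2 * ‖w.u t x‖ ^ 2 - dPdρ c (w.ρ t x) (w.S c t x)
        - w.temp c t x * (Real.log c.a / (c.gamma - 1)))
      - (c.gamma / (c.gamma - 1)) * (y.1 * Real.log y.2.1) * w.temp c t x + w.p c t x := by
  have hL := legendre_pressure hγ hρ (w.S c t x)
  have hg : c.gamma - 1 ≠ 0 := by linarith
  have ht : dPdS c (w.ρ t x) (w.S c t x) = w.temp c t x := by
    rw [Triple.temp, Triple.p_S, dPdS_eq hγ hρ, dpdS_eq c hρ]; field_simp
  have hS : entropy c y.1 y.2.1 = y.1 * (Real.log c.a / (c.gamma - 1))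
      + (c.gamma / (c.gamma - 1)) * (y.1 * Real.log y.2.1) := by
    rw [entropy_eq ha _ hy2]; ring
  have hn := norm_sub_sq_real y.2.2 (w.u t x)
  rw [relDensity, potRS_entropy ha hγ hy1 hy2, hn, energyDensity, inner_smul_left]
  simp only [conj_trivial]
  rw [ht] at hL ⊢
  rw [hS, Triple.p]
  linear_combination hL

/-! ### Functions of class `C¹` on the closed space-time cylinder -/

lemma slab_subset_closedSlab {d : ℕ} (Ω : Set (Sp d)) (T : ℝ) : slab Ω T ⊆ closedSlab Ω T :=
  prod_mono Ioo_subset_Icc_self subset_closure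

lemma slab_mono {d : ℕ} (Ω : Set (Sp d)) {τ T : ℝ} (h : τ ≤ T) : slab Ω τ ⊆ slab Ω T :=
  prod_mono (Ioo_subset_Ioo_right h) Subset.rfl

lemma isOpen_slab {d : ℕ} {Ω : Set (Sp d)} (hΩ : IsOpen Ω) (T : ℝ) : IsOpen (slab Ω T) :=
  isOpen_Ioo.prod hΩ

lemma isCompact_closedSlab {d : ℕ} {Ω : Set (Sp d)} (hΩ : Bornology.IsBounded Ω) (T : ℝ) :
    IsCompact (closedSlab Ω T) := isCompact_Icc.prod hΩ.isCompact_closure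

lemma volume_slab_lt_top {d : ℕ} {Ω : Set (Sp d)} (hΩ : Bornology.IsBounded Ω) (T : ℝ) :
    volume (slab Ω T) < ⊤ :=
  (measure_mono (slab_subset_closedSlab Ω T)).trans_lt (isCompact_closedSlab hΩ T).measure_lt_top

lemma volume_restrict_slab {d : ℕ} (Ω : Set (Sp d)) (T : ℝ) :
    (volume : Measure (ℝ × Sp d)).restrict (slab Ω T)
      = (volume.restrict (Ioo 0 T)).prod (volume.restrict Ω) := by
  rw [Measure.prod_restrict]; rfl

instance {d : ℕ} : (volume : Measure (ℝ × Sp d)).IsAddHaarMeasure :=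
  inferInstanceAs (((volume : Measure ℝ).prod (volume : Measure (Sp d))).IsAddHaarMeasure)

lemma integrableOn_of_continuousOn_of_norm_le {X F : Type*} [TopologicalSpace X]
    [MeasurableSpace X] [OpensMeasurableSpace X] [SecondCountableTopology X]
    [NormedAddCommGroup F] {μ : Measure X} {s : Set X} (hs : MeasurableSet s) (hμ : μ s < ⊤)
    {f : X → F} (hf : ContinuousOn f s) {C : ℝ} (hC : ∀ x ∈ s, ‖f x‖ ≤ C) :
    IntegrableOn f s μ := by
  have : IsFiniteMeasure (μ.restrict s) := ⟨by simpa using hμ⟩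
  exact Integrable.of_bound (hf.aestronglyMeasurable hs) C (ae_restrict_of_forall_mem hs hC)

/-- The space-time derivative of a function of `t` and `x`. -/
def stDeriv {d : ℕ} {F : Type*} [NormedAddCommGroup F] [NormedSpace ℝ F]
    (f : ℝ → Sp d → F) (q : ℝ × Sp d) : ℝ × Sp d →L[ℝ] F :=
  fderiv ℝ (fun q : ℝ × Sp d => f q.1 q.2) q

namespace IsC1Closed

variable {d : ℕ} {F F' : Type*} [NormedAddCommGroup F] [NormedSpace ℝ F]
  [NormedAddCommGroup F'] [NormedSpace ℝ F'] {Ω : Set (Sp d)} {T : ℝ}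

lemma hasFDerivAt {f : ℝ → Sp d → F} (h : IsC1Closed Ω T f) {q : ℝ × Sp d} (hq : q ∈ slab Ω T) :
    HasFDerivAt (fun q : ℝ × Sp d => f q.1 q.2) (stDeriv f q) q := by
  obtain ⟨-, Df, -, hD⟩ := h
  exact (hD q hq).differentiableAt.hasFDerivAt

lemma continuousOn_stDeriv {f : ℝ → Sp d → F} (h : IsC1Closed Ω T f) :
    ContinuousOn (stDeriv f) (slab Ω T) := by
  obtain ⟨-, Df, hc, hD⟩ := h
  exact (hc.mono (slab_subset_closedSlab Ω T)).congr fun q hq => (hD q hq).fderiv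

lemma hasFDerivAt_space {f : ℝ → Sp d → F} (h : IsC1Closed Ω T f) {q : ℝ × Sp d}
    (hq : q ∈ slab Ω T) :
    HasFDerivAt (f q.1) ((stDeriv f q).comp (ContinuousLinearMap.inr ℝ ℝ (Sp d))) q.2 := by
  have h2 : HasFDerivAt (fun x : Sp d => (q.1, x)) (ContinuousLinearMap.inr ℝ ℝ (Sp d)) q.2 :=
    hasFDerivAt_prodMk_right q.1 q.2
  exact HasFDerivAt.comp (g := fun q : ℝ × Sp d => f q.1 q.2) q.2 (h.hasFDerivAt hq) h2

lemma hasDerivAt_time {f : ℝ → Sp d → F} (h : IsC1Closed Ω T f) {q : ℝ × Sp d}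
    (hq : q ∈ slab Ω T) : HasDerivAt (fun s => f s q.2) (stDeriv f q (1, 0)) q.1 := by
  have h2 : HasFDerivAt (fun s : ℝ => (s, q.2)) (ContinuousLinearMap.inl ℝ ℝ (Sp d)) q.1 :=
    hasFDerivAt_prodMk_left q.1 q.2
  have := HasFDerivAt.comp (g := fun q : ℝ × Sp d => f q.1 q.2) q.1 (h.hasFDerivAt hq) h2
  exact this.hasDerivAt.congr_deriv (by simp)

lemma dt_eq {f : ℝ → Sp d → F} (h : IsC1Closed Ω T f) {q : ℝ × Sp d} (hq : q ∈ slab Ω T) :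
    dt f q.1 q.2 = stDeriv f q (1, 0) := (h.hasDerivAt_time hq).deriv

lemma fderiv_apply {f : ℝ → Sp d → F} (h : IsC1Closed Ω T f) {q : ℝ × Sp d}
    (hq : q ∈ slab Ω T) (v : Sp d) : fderiv ℝ (f q.1) q.2 v = stDeriv f q (0, v) := by
  rw [(h.hasFDerivAt_space hq).fderiv]; simp

lemma inner_gradient {f : ℝ → Sp d → ℝ} (h : IsC1Closed Ω T f) {q : ℝ × Sp d}
    (hq : q ∈ slab Ω T) (v : Sp d) : inner ℝ (gradient (f q.1) q.2) v = stDeriv f q (0, v) := by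
  rw [← h.fderiv_apply hq, ← toDual_gradient]; simp

lemma inner_gradient' {f : ℝ → Sp d → ℝ} (h : IsC1Closed Ω T f) {q : ℝ × Sp d}
    (hq : q ∈ slab Ω T) (v : Sp d) : inner ℝ v (gradient (f q.1) q.2) = stDeriv f q (0, v) := by
  rw [real_inner_comm, h.inner_gradient hq]

lemma exists_bound {f : ℝ → Sp d → F} (hΩ : Bornology.IsBounded Ω) (h : IsC1Closed Ω T f) :
    ∃ C, ∀ q ∈ closedSlab Ω T, ‖f q.1 q.2‖ ≤ C :=
  (isCompact_closedSlab hΩ T).exists_bound_of_continuousOn h.1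

lemma exists_bound_stDeriv {f : ℝ → Sp d → F} (hΩ : Bornology.IsBounded Ω)
    (h : IsC1Closed Ω T f) : ∃ C, 0 ≤ C ∧ ∀ q ∈ slab Ω T, ‖stDeriv f q‖ ≤ C := by
  obtain ⟨-, Df, hc, hD⟩ := h
  obtain ⟨C, hC⟩ := (isCompact_closedSlab hΩ T).exists_bound_of_continuousOn hc
  refine ⟨max C 0, le_max_right _ _, fun q hq => ?_⟩
  rw [stDeriv, (hD q hq).fderiv]
  exact (hC q (slab_subset_closedSlab Ω T hq)).trans (le_max_left _ _)

/-- Equality on the closed cylinder suffices, since derivatives are taken only at points of the open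
cylinder, and near those the two functions coincide. This lets functions defined by logarithms,
powers or `deriv` be replaced by closed forms that hold only for positive density and temperature.
-/
lemma congr {f g : ℝ → Sp d → F} (hΩ : IsOpen Ω) (h : IsC1Closed Ω T f)
    (hfg : ∀ t ∈ Icc 0 T, ∀ x ∈ closure Ω, g t x = f t x) : IsC1Closed Ω T g := by
  obtain ⟨h0, Df, hc, hD⟩ := h
  refine ⟨h0.congr fun q hq => hfg q.1 hq.1 q.2 hq.2, Df, hc, fun q hq => ?_⟩
  refine (hD q hq).congr_of_eventuallyEq ?_
  filter_upwards [(isOpen_slab hΩ T).mem_nhds hq] with z hz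
  exact hfg z.1 (slab_subset_closedSlab Ω T hz).1 z.2 (slab_subset_closedSlab Ω T hz).2

lemma prodMk {f : ℝ → Sp d → F} {g : ℝ → Sp d → F'} (hf : IsC1Closed Ω T f)
    (hg : IsC1Closed Ω T g) : IsC1Closed Ω T (fun t x => (f t x, g t x)) := by
  obtain ⟨hf0, Df, hfc, hfD⟩ := hf
  obtain ⟨hg0, Dg, hgc, hgD⟩ := hg
  refine ⟨hf0.prodMk hg0, fun q => (Df q).prod (Dg q), ?_, fun q hq =>
    (hfD q hq).prodMk (hgD q hq)⟩
  exact (ContinuousLinearMap.prodₗᵢ ℝ).continuous.comp_continuousOn (hfc.prodMk hgc)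

/-- The chain-rule derivative stays continuous up to the boundary because f sends the whole closed
cylinder into the open set where g is C¹. -/
lemma comp {f : ℝ → Sp d → F} (h : IsC1Closed Ω T f) {g : F → F'} {U : Set F} (hU : IsOpen U)
    (hg : ContDiffOn ℝ 1 g U) (hfU : ∀ t ∈ Icc 0 T, ∀ x ∈ closure Ω, f t x ∈ U) :
    IsC1Closed Ω T (fun t x => g (f t x)) := by
  obtain ⟨h0, Df, hc, hD⟩ := h
  have hm : MapsTo (fun q : ℝ × Sp d => f q.1 q.2) (closedSlab Ω T) U :=
    fun q hq => hfU q.1 hq.1 q.2 hq.2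
  refine ⟨hg.continuousOn.comp h0 hm, fun q => (fderiv ℝ g (f q.1 q.2)).comp (Df q), ?_, ?_⟩
  · exact ((hg.continuousOn_fderiv_of_isOpen hU le_rfl).comp h0 hm).clm_comp hc
  · intro q hq
    have h1 := hm (slab_subset_closedSlab Ω T hq)
    have h2 := ((hg.differentiableOn one_ne_zero).differentiableAt (hU.mem_nhds h1)).hasFDerivAt
    exact h2.comp q (hD q hq)

lemma comp_contDiff {f : ℝ → Sp d → F} (h : IsC1Closed Ω T f) {g : F → F'}
    (hg : ContDiff ℝ 1 g) : IsC1Closed Ω T (fun t x => g (f t x)) :=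
  h.comp isOpen_univ hg.contDiffOn fun _ _ _ _ => mem_univ _

lemma mul {f g : ℝ → Sp d → ℝ} (hf : IsC1Closed Ω T f) (hg : IsC1Closed Ω T g) :
    IsC1Closed Ω T (fun t x => f t x * g t x) :=
  (hf.prodMk hg).comp_contDiff (g := fun z : ℝ × ℝ => z.1 * z.2) (by fun_prop)

lemma sub {f g : ℝ → Sp d → F} (hf : IsC1Closed Ω T f) (hg : IsC1Closed Ω T g) :
    IsC1Closed Ω T (fun t x => f t x - g t x) :=
  (hf.prodMk hg).comp_contDiff (g := fun z : F × F => z.1 - z.2) (by fun_prop)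

lemma const_mul {f : ℝ → Sp d → ℝ} (hf : IsC1Closed Ω T f) (k : ℝ) :
    IsC1Closed Ω T (fun t x => k * f t x) :=
  hf.comp_contDiff (g := fun z : ℝ => k * z) (by fun_prop)

lemma div {f g : ℝ → Sp d → ℝ} (hf : IsC1Closed Ω T f) (hg : IsC1Closed Ω T g)
    (h0 : ∀ t ∈ Icc 0 T, ∀ x ∈ closure Ω, g t x ≠ 0) :
    IsC1Closed Ω T (fun t x => f t x / g t x) := by
  refine (hf.prodMk hg).comp (g := fun z : ℝ × ℝ => z.1 / z.2) (U := {z | z.2 ≠ 0})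
    (isOpen_ne.preimage continuous_snd) ?_ h0
  exact contDiffOn_fst.div contDiffOn_snd fun z hz => hz

end IsC1Closed

/-! ### Integration by parts against test functions -/

section Local

variable {E : Type*} [NormedAddCommGroup E]

/-- Outside U a point is not in the closed support of ψ, so the product vanishes in a neighbourhood,
whatever f does there. -/
lemma continuous_mul_of_tsupport_subset {U : Set E} (hU : IsOpen U) {f ψ : E → ℝ}
    (hf : ContinuousOn f U) (hψ : Continuous ψ) (hs : tsupport ψ ⊆ U) :
    Continuous fun x => f x * ψ x := by
  rw [continuous_iff_continuousAt]
  intro x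
  by_cases hx : x ∈ U
  · exact (hf.continuousAt (hU.mem_nhds hx)).mul hψ.continuousAt
  · have : (fun x => f x * ψ x) =ᶠ[𝓝 x] fun _ => 0 := by
      filter_upwards [notMem_tsupport_iff_eventuallyEq.1 fun h => hx (hs h)] with y hy
      simp [hy]
    exact continuousAt_const.congr this.symm

lemma setIntegral_mul_eq [MeasurableSpace E] {μ : Measure E} {U : Set E} {f ψ : E → ℝ}
    (hs : tsupport ψ ⊆ U) :
    ∫ x in U, f x * ψ x ∂μ = ∫ x, f x * ψ x ∂μ := by
  apply setIntegral_eq_integral_of_forall_compl_eq_zero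
  intro x hx
  rw [image_eq_zero_of_notMem_tsupport fun h => hx (hs h), mul_zero]

/-- Integration by parts for a `C¹` function on an open set and a test function supported there. -/
lemma setIntegral_mul_fderiv_eq_neg [NormedSpace ℝ E] [MeasurableSpace E] [BorelSpace E]
    [FiniteDimensional ℝ E] {μ : Measure E} [μ.IsAddHaarMeasure] {U : Set E}
    (hU : IsOpen U) {f : E → ℝ} {f' : E → E →L[ℝ] ℝ} (hf : ∀ x ∈ U, HasFDerivAt f (f' x) x)
    (hf' : ContinuousOn f' U) {ψ : E → ℝ} (hψ : ContDiff ℝ 1 ψ) (hc : HasCompactSupport ψ)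
    (hs : tsupport ψ ⊆ U) (v : E) :
    ∫ x in U, f x * fderiv ℝ ψ x v ∂μ = - ∫ x in U, f' x v * ψ x ∂μ := by
  have hfc : ContinuousOn f U := fun x hx => (hf x hx).continuousAt.continuousWithinAt
  have hψ' : Continuous fun x => fderiv ℝ ψ x v :=
    (hψ.continuous_fderiv one_ne_zero).clm_apply continuous_const
  have hc' : HasCompactSupport fun x => fderiv ℝ ψ x v := hc.fderiv_apply (𝕜 := ℝ) v
  have hs' : tsupport (fun x => fderiv ℝ ψ x v) ⊆ U :=
    (tsupport_fderiv_apply_subset ℝ v).trans hs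
  have hf'v : ContinuousOn (fun x => f' x v) U := hf'.clm_apply continuousOn_const
  rw [setIntegral_mul_eq hs', setIntegral_mul_eq hs]
  refine integral_bilinear_hasFDerivAt_right_eq_neg_left_of_integrable
    (B := ContinuousLinearMap.mul ℝ ℝ) (g' := fderiv ℝ ψ) (f' := f') (v := v) ?_ ?_ ?_ ?_ ?_
  · exact (continuous_mul_of_tsupport_subset hU hf'v hψ.continuous hs).integrable_of_hasCompactSupport
      hc.mul_left
  · exact (continuous_mul_of_tsupport_subset hU hfc hψ' hs').integrable_of_hasCompactSupport
      hc'.mul_left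
  · exact (continuous_mul_of_tsupport_subset hU hfc hψ.continuous hs).integrable_of_hasCompactSupport
      hc.mul_left
  · exact fun x hx => hf x (hs hx)
  · exact fun x _ => (hψ.differentiable one_ne_zero x).hasFDerivAt

end Local

namespace IsC1Closed

variable {d : ℕ} {Ω : Set (Sp d)} {T : ℝ}

section Measurability

variable {F : Type*} [NormedAddCommGroup F] [NormedSpace ℝ F]

lemma aestronglyMeasurable [SecondCountableTopology F] {f : ℝ → Sp d → F} (hΩ : IsOpen Ω)
    (h : IsC1Closed Ω T f) :
    AEStronglyMeasurable (fun q : ℝ × Sp d => f q.1 q.2) (volume.restrict (slab Ω T)) :=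
  (h.1.mono (slab_subset_closedSlab Ω T)).aestronglyMeasurable (isOpen_slab hΩ T).measurableSet

end Measurability

lemma continuousOn_dt {f : ℝ → Sp d → ℝ} (h : IsC1Closed Ω T f) :
    ContinuousOn (fun q : ℝ × Sp d => dt f q.1 q.2) (slab Ω T) :=
  (h.continuousOn_stDeriv.clm_apply continuousOn_const).congr fun _ hq => h.dt_eq hq

lemma norm_dt_le {f : ℝ → Sp d → ℝ} (h : IsC1Closed Ω T f) {C : ℝ}
    (hC : ∀ q ∈ slab Ω T, ‖stDeriv f q‖ ≤ C) {q : ℝ × Sp d} (hq : q ∈ slab Ω T) :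
    ‖dt f q.1 q.2‖ ≤ C := by
  rw [h.dt_eq hq]
  refine ((stDeriv f q).le_opNorm _).trans ?_
  have : ‖((1 : ℝ), (0 : Sp d))‖ = 1 := by simp [Prod.norm_def]
  rw [this, mul_one]
  exact hC q hq

lemma gradient_eq {f : ℝ → Sp d → ℝ} (h : IsC1Closed Ω T f) {q : ℝ × Sp d} (hq : q ∈ slab Ω T) :
    gradient (f q.1) q.2 = (InnerProductSpace.toDual ℝ (Sp d)).symm
      ((stDeriv f q).comp (ContinuousLinearMap.inr ℝ ℝ (Sp d))) := by
  rw [gradient, (h.hasFDerivAt_space hq).fderiv]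

lemma continuousOn_gradient {f : ℝ → Sp d → ℝ} (h : IsC1Closed Ω T f) :
    ContinuousOn (fun q : ℝ × Sp d => gradient (f q.1) q.2) (slab Ω T) := by
  refine ContinuousOn.congr ?_ fun q hq => h.gradient_eq hq
  exact (InnerProductSpace.toDual ℝ (Sp d)).symm.continuous.comp_continuousOn
    (h.continuousOn_stDeriv.clm_comp continuousOn_const)

lemma norm_gradient_le {f : ℝ → Sp d → ℝ} (h : IsC1Closed Ω T f) {C : ℝ} (hC0 : 0 ≤ C)
    (hC : ∀ q ∈ slab Ω T, ‖stDeriv f q‖ ≤ C) {q : ℝ × Sp d} (hq : q ∈ slab Ω T) :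
    ‖gradient (f q.1) q.2‖ ≤ C := by
  rw [h.gradient_eq hq, LinearIsometryEquiv.norm_map]
  refine ContinuousLinearMap.opNorm_le_bound _ hC0 fun v => ?_
  refine ((stDeriv f q).le_opNorm ((0 : ℝ), v)).trans ?_
  have : ‖((0 : ℝ), v)‖ = ‖v‖ := by simp [Prod.norm_def]
  rw [this]
  exact mul_le_mul_of_nonneg_right (hC q hq) (norm_nonneg _)

/-- Functions of class `C¹` on the closed cylinder belong to `W^{1,∞}`. -/
lemma isW1Inf {φ : ℝ → Sp d → ℝ} (hΩ : IsOpen Ω) (hb : Bornology.IsBounded Ω)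
    (h : IsC1Closed Ω T φ) :
    IsW1Inf Ω T φ (dt φ) (fun t x => gradient (φ t) x) := by
  have hm := (isOpen_slab hΩ T).measurableSet
  obtain ⟨C, hC⟩ := h.exists_bound hb
  obtain ⟨C', hC'0, hC'⟩ := h.exists_bound_stDeriv hb
  refine ⟨h.1.mono (prod_mono Subset.rfl subset_closure), ?_, ?_, ?_, ?_, ?_⟩
  · exact memLp_top_of_bound (h.aestronglyMeasurable hΩ) C
      (ae_restrict_of_forall_mem hm fun q hq => hC q (slab_subset_closedSlab Ω T hq))
  · exact memLp_top_of_bound (h.continuousOn_dt.aestronglyMeasurable hm) C'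
      (ae_restrict_of_forall_mem hm fun q hq => h.norm_dt_le hC' hq)
  · exact memLp_top_of_bound (h.continuousOn_gradient.aestronglyMeasurable hm) C'
      (ae_restrict_of_forall_mem hm fun q hq => h.norm_gradient_le hC'0 hC' hq)
  · intro ψ hψ hc hs
    rw [setIntegral_mul_fderiv_eq_neg (isOpen_slab hΩ T) (fun q hq => h.hasFDerivAt hq)
      h.continuousOn_stDeriv (hψ.of_le (by norm_cast)) hc hs]
    congr 1
    exact setIntegral_congr_fun hm fun q hq => by simp only [h.dt_eq hq]
  · intro ψ hψ hc hs i
    rw [setIntegral_mul_fderiv_eq_neg (isOpen_slab hΩ T) (fun q hq => h.hasFDerivAt hq)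
      h.continuousOn_stDeriv (hψ.of_le (by norm_cast)) hc hs]
    congr 1
    refine setIntegral_congr_fun hm fun q hq => ?_
    have := h.inner_gradient' hq (basisVec i)
    simp only [← this, EuclideanSpace.inner_single_left]
    simp

/-- The fundamental theorem of calculus in time, integrated over space. -/
lemma integral_sub_eq {f : ℝ → Sp d → ℝ} (hΩ : IsOpen Ω) (hb : Bornology.IsBounded Ω)
    (h : IsC1Closed Ω T f) {τ : ℝ} (hτ : τ ∈ Ioo 0 T) :
    (∫ x in Ω, f τ x) - (∫ x in Ω, f 0 x) = ∫ q in slab Ω τ, dt f q.1 q.2 := by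
  have hm := (isOpen_slab hΩ τ).measurableSet
  obtain ⟨C, hC⟩ := h.exists_bound hb
  obtain ⟨C', hC'0, hC'⟩ := h.exists_bound_stDeriv hb
  have hΩfin : volume Ω < ⊤ := hb.measure_lt_top
  have hsub := slab_mono Ω hτ.2.le
  have hint : ∀ t ∈ Icc 0 T, IntegrableOn (f t) Ω := by
    intro t ht
    have : ContinuousOn (f t) Ω :=
      h.1.comp (f := fun x => (t, x)) (by fun_prop) fun x hx => ⟨ht, subset_closure hx⟩
    exact integrableOn_of_continuousOn_of_norm_le hΩ.measurableSet hΩfin this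
      fun x hx => hC (t, x) ⟨ht, subset_closure hx⟩
  have hdt : IntegrableOn (fun q : ℝ × Sp d => dt f q.1 q.2) (slab Ω τ) :=
    integrableOn_of_continuousOn_of_norm_le hm (volume_slab_lt_top hb τ)
      (h.continuousOn_dt.mono hsub) fun q hq => h.norm_dt_le hC' (hsub hq)
  -- In this order of integration time is innermost. For each fixed x the claim is then the
  -- fundamental theorem on [0,τ], which needs continuity at the endpoints and differentiability
  -- only inside.
  rw [← integral_sub (hint τ ⟨hτ.1.le, hτ.2.le⟩) (hint 0 ⟨le_rfl, hτ.1.le.trans hτ.2.le⟩),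
    volume_restrict_slab, integral_prod_symm _ (by rw [← volume_restrict_slab]; exact hdt)]
  refine setIntegral_congr_fun hΩ.measurableSet fun x hx => ?_
  have hcont : ContinuousOn (fun s => f s x) (Icc 0 τ) :=
    h.1.comp (f := fun s => (s, x)) (by fun_prop)
      fun s hs => ⟨⟨hs.1, hs.2.trans hτ.2.le⟩, subset_closure hx⟩
  have hder : ∀ s ∈ Ioo 0 τ, HasDerivAt (fun s => f s x) (dt f s x) s := by
    intro s hs
    have hq : (s, x) ∈ slab Ω T := ⟨⟨hs.1, hs.2.trans hτ.2⟩, hx⟩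
    rw [h.dt_eq hq]; exact h.hasDerivAt_time hq
  have hii : IntervalIntegrable (fun s => dt f s x) volume 0 τ := by
    rw [intervalIntegrable_iff_integrableOn_Ioo_of_le hτ.1.le]
    have : ContinuousOn (fun s => dt f s x) (Ioo 0 τ) :=
      h.continuousOn_dt.comp (f := fun s => (s, x)) (by fun_prop)
        fun s hs => ⟨⟨hs.1, hs.2.trans hτ.2⟩, hx⟩
    exact integrableOn_of_continuousOn_of_norm_le measurableSet_Ioo (by simp) this fun s hs =>
      h.norm_dt_le hC' (q := (s, x)) ⟨⟨hs.1, hs.2.trans hτ.2⟩, hx⟩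
  have := intervalIntegral.integral_eq_sub_of_hasDerivAt_of_le hτ.1.le hcont hder hii
  rw [intervalIntegral.integral_of_le hτ.1.le, integral_Ioc_eq_integral_Ioo] at this
  exact this.symm

end IsC1Closed

/-! ### Smooth approximation of functions vanishing on the boundary -/

section Mollify

variable {E : Type*} [NormedAddCommGroup E] [InnerProductSpace ℝ E] [FiniteDimensional ℝ E]
  [MeasurableSpace E] [BorelSpace E]

open scoped Convolution in
/-- Mollification: a compactly supported `C¹` function is a uniform `C¹` limit of test functions. -/
lemma exists_contDiff_dist_le {U : Set E} (hU : IsOpen U) {g : E → ℝ} (hg : ContDiff ℝ 1 g)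
    (hc : HasCompactSupport g) (hs : tsupport g ⊆ U) {ε : ℝ} (hε : 0 < ε) :
    ∃ ψ : E → ℝ, ContDiff ℝ ∞ ψ ∧ HasCompactSupport ψ ∧ tsupport ψ ⊆ U ∧
      (∀ x, ‖ψ x - g x‖ ≤ ε) ∧ ∀ x, ‖fderiv ℝ ψ x - fderiv ℝ g x‖ ≤ ε := by
  let μ : Measure E := volume
  obtain ⟨δ₀, hδ₀, hcth⟩ := hc.isCompact.exists_cthickening_subset_open hU hs
  have hu := hc.uniformContinuous_of_continuous hg.continuous
  have hu' := (hc.fderiv ℝ).uniformContinuous_of_continuous (hg.continuous_fderiv one_ne_zero)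
  obtain ⟨δ₁, hδ₁, h1⟩ := Metric.uniformContinuous_iff.1 hu ε hε
  obtain ⟨δ₂, hδ₂, h2⟩ := Metric.uniformContinuous_iff.1 hu' ε hε
  -- δ₀ keeps the support inside U, while δ₁ and δ₂ bound the oscillation of g and of its derivative
  -- by ε. The mollifier has radius δ/2.
  set δ := min δ₀ (min δ₁ δ₂) with hδ
  have hδ0 : 0 < δ := lt_min hδ₀ (lt_min hδ₁ hδ₂)
  let φ : ContDiffBump (0 : E) := ⟨δ / 4, δ / 2, by positivity, by linarith⟩
  have hφ : φ.rOut = δ / 2 := rfl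
  let ψ : E → ℝ := φ.normed μ ⋆[ContinuousLinearMap.lsmul ℝ ℝ, μ] g
  have hli : LocallyIntegrable (φ.normed μ) μ :=
    (φ.continuous_normed (μ := μ)).locallyIntegrable
  -- The derivative is placed on g, so that the derivative of ψ is itself a mollification and the
  -- same oscillation estimate applies to it.
  have hder : ∀ x, HasFDerivAt ψ ((φ.normed μ ⋆[ContinuousLinearMap.lsmul ℝ ℝ, μ] fderiv ℝ g) x) x := by
    intro x
    exact hc.hasFDerivAt_convolution_right (ContinuousLinearMap.lsmul ℝ ℝ) hli hg x
  have hsupp : Function.support ψ ⊆ Metric.cthickening δ₀ (tsupport g) := by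
    intro x hx
    by_contra hcon
    apply hx
    have hz : ∀ y ∈ Metric.ball x φ.rOut, g y = 0 := by
      intro y hy
      by_contra hgy
      apply hcon
      refine Metric.mem_cthickening_of_dist_le x y δ₀ _ (subset_tsupport g hgy) ?_
      rw [Metric.mem_ball, dist_comm, hφ] at hy
      have := min_le_left δ₀ (min δ₁ δ₂)
      linarith
    have hx0 := hz x (Metric.mem_ball_self φ.rOut_pos)
    have := φ.normed_convolution_eq_right (μ := μ) (g := g) (x₀ := x)
      fun y hy => by rw [hz y hy, hx0]
    exact this.trans hx0
  have hts : tsupport ψ ⊆ Metric.cthickening δ₀ (tsupport g) :=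
    closure_minimal hsupp Metric.isClosed_cthickening
  refine ⟨ψ, ?_, ?_, hts.trans hcth, ?_, ?_⟩
  · exact φ.hasCompactSupport_normed.contDiff_convolution_left _ (φ.contDiff_normed (n := (⊤ : ℕ∞)))
      hg.continuous.locallyIntegrable
  · exact IsCompact.of_isClosed_subset (hc.isCompact.cthickening) (isClosed_tsupport ψ) hts
  · intro x
    rw [← dist_eq_norm]
    refine φ.dist_normed_convolution_le hg.continuous.aestronglyMeasurable fun y hy => ?_
    refine (h1 ?_).le
    rw [Metric.mem_ball, hφ] at hy
    have := (min_le_right δ₀ (min δ₁ δ₂)).trans (min_le_left _ _)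
    linarith
  · intro x
    rw [(hder x).fderiv, ← dist_eq_norm]
    refine φ.dist_normed_convolution_le
      (hg.continuous_fderiv one_ne_zero).aestronglyMeasurable fun y hy => ?_
    refine (h2 ?_).le
    rw [Metric.mem_ball, hφ] at hy
    have := (min_le_right δ₀ (min δ₁ δ₂)).trans (min_le_right _ _)
    linarith

/-- The derivative of a differentiable function vanishes almost everywhere on its zero set. -/
lemma ae_fderiv_eq_zero_of_eq_zero {U : Set E} (hU : IsOpen U) {f : E → ℝ}
    (hf : DifferentiableOn ℝ f U) :
    ∀ᵐ x ∂(volume.restrict U), f x = 0 → fderiv ℝ f x = 0 := by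
  rcases subsingleton_or_nontrivial E with hE | hE
  · exact Eventually.of_forall fun x _ => by ext v; simp [Subsingleton.elim v 0]
  obtain ⟨e, he⟩ := exists_ne (0 : E)
  set Z : Set E := U ∩ {x | f x = 0} with hZ
  have hZm : MeasurableSet Z := by
    have h1 : MeasurableSet (U ∩ {x | f x ≠ 0}) :=
      (hf.continuousOn.isOpen_inter_preimage hU isOpen_ne).measurableSet
    have : Z = U \ (U ∩ {x | f x ≠ 0}) := by
      ext x; simp only [hZ, mem_inter_iff, mem_ofPred_eq, Set.mem_sdiff]; tauto
    rw [this]; exact hU.measurableSet.diff h1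
  -- On the zero set f·e coincides with the zero map, so it is approximated linearly with constant
  -- 0; the density-point argument behind `norm_fderiv_sub_le` then forces its derivative to vanish
  -- a.e. there. The nonzero vector e makes f a map from E to itself, the form in which that result
  -- is available.
  have happ : ApproximatesLinearOn (fun x => f x • e) (0 : E →L[ℝ] E) Z 0 := by
    intro x hx y hy
    simp [show f x = 0 from hx.2, show f y = 0 from hy.2]
  have := happ.norm_fderiv_sub_le (μ := volume) hZm (fun x => (fderiv ℝ f x).smulRight e)
    fun x hx => (((hf x hx.1).differentiableAt (hU.mem_nhds hx.1)).hasFDerivAt.smul_const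
      e).hasFDerivWithinAt
  rw [ae_restrict_iff' hZm] at this
  rw [ae_restrict_iff' hU.measurableSet]
  filter_upwards [this] with x hx hxU hx0
  have h0 := hx ⟨hxU, hx0⟩
  simpa [he] using h0

/-- A smooth cut-off of the identity near zero. -/
lemma exists_cutoff : ∃ η : ℝ → ℝ, ContDiff ℝ 1 η ∧ (∀ s, |s| ≤ 1 → η s = 0) ∧
    (∃ C, ∀ s, |η s - s| ≤ C) ∧ (∃ C, ∀ s, |deriv η s - 1| ≤ C) ∧
    ∀ s, 2 < |s| → deriv η s = 1 := by
  -- The cut-off is s(1 - χ(s)), where χ is 1 on [-1,1] and 0 outside (-2,2). Its distance to the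
  -- identity is |s χ(s)| ≤ 2.
  let χ : ContDiffBump (0 : ℝ) := ⟨1, 2, one_pos, one_lt_two⟩
  have hχ : ContDiff ℝ 1 χ := χ.contDiff
  have hz : ∀ s, 2 ≤ |s| → χ s = 0 := fun s hs => χ.zero_of_le_dist (by simpa using hs)
  have hη : ContDiff ℝ 1 fun s => s - s * χ s := contDiff_id.sub (contDiff_id.mul hχ)
  have hκ : ContDiff ℝ 1 fun s => s * χ s := contDiff_id.mul hχ
  have hd : ∀ s, deriv (fun s => s - s * χ s) s = 1 - deriv (fun s => s * χ s) s := by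
    intro s
    have := (hasDerivAt_id s).sub (hκ.differentiable one_ne_zero s).hasDerivAt
    exact this.deriv
  have hκc : HasCompactSupport fun s => s * χ s := χ.hasCompactSupport.mul_left
  refine ⟨fun s => s - s * χ s, hη, ?_, ⟨2, ?_⟩, ?_, ?_⟩
  · intro s hs
    have : χ s = 1 := χ.one_of_mem_closedBall (by simpa using hs)
    simp [this]
  · intro s
    have e : s - s * χ s - s = -(s * χ s) := by ring
    rw [e, abs_neg, abs_mul, abs_of_nonneg χ.nonneg]
    rcases le_total 2 |s| with h | h
    · simp [hz s h]
    · have := χ.le_one (x := s)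
      have := χ.nonneg (x := s)
      nlinarith [abs_nonneg s]
  · obtain ⟨C, hC⟩ := (hκ.continuous_deriv le_rfl).bounded_above_of_compact_support hκc.deriv
    refine ⟨C, fun s => ?_⟩
    rw [hd]
    simpa using hC s
  · intro s hs
    rw [hd]
    have : (fun s => s * χ s) =ᶠ[𝓝 s] fun _ => 0 := by
      filter_upwards [(isOpen_lt continuous_const continuous_abs).mem_nhds hs] with r hr
      simp [hz r (le_of_lt hr)]
    rw [this.deriv_eq]; simp

/-- A `C¹` function with bounded gradient that vanishes on the boundary of a bounded open set is a
limit of test functions in `W^{1,2}`. -/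
lemma exists_test_approx {U : Set E} (hU : IsOpen U) (hb : Bornology.IsBounded U) {f : E → ℝ}
    (hfc : ContinuousOn f (closure U)) (hf0 : ∀ x ∈ frontier U, f x = 0)
    (hf : ContDiffOn ℝ 1 f U) {C : ℝ} (hC : ∀ x ∈ U, ‖fderiv ℝ f x‖ ≤ C) {ε : ℝ} (hε : 0 < ε) :
    ∃ ψ : E → ℝ, ContDiff ℝ ∞ ψ ∧ HasCompactSupport ψ ∧ tsupport ψ ⊆ U ∧
      (∫ x in U, ‖ψ x - f x‖ ^ 2) < ε ∧ (∫ x in U, ‖fderiv ℝ ψ x - fderiv ℝ f x‖ ^ 2) < ε := by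
  classical
  obtain ⟨η, hη, hη0, ⟨C₁, hC₁⟩, ⟨C₂, hC₂⟩, hη1⟩ := exists_cutoff
  have hUm := hU.measurableSet
  have hfin : volume U < ⊤ := hb.measure_lt_top
  have : IsFiniteMeasure (volume.restrict U) := ⟨by simpa using hfin⟩
  have hη' := hη.continuous_deriv le_rfl
  have hfd := hf.continuousOn_fderiv_of_isOpen hU le_rfl
  let N : ℕ → ℝ := fun n => n + 1
  have hN : ∀ n, 0 < N n := fun n => by positivity
  -- The truncation N⁻¹ η(N f) removes the values |f| ≤ 1/N, hence a neighbourhood of the boundary,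
  -- while moving f by at most C₁/N. Its gradient η'(N f)∇f is dominated by a constant.
  let g : ℕ → E → ℝ := fun n x => if x ∈ U then (N n)⁻¹ * η (N n * f x) else 0
  have hgloc : ∀ n, ∀ x ∈ U, g n =ᶠ[𝓝 x] fun y => (N n)⁻¹ * η (N n * f y) := by
    intro n x hx
    filter_upwards [hU.mem_nhds hx] with y hy
    exact if_pos hy
  have hder : ∀ n, ∀ x ∈ U, fderiv ℝ (g n) x = deriv η (N n * f x) • fderiv ℝ f x := by
    intro n x hx
    have h1 : HasFDerivAt f (fderiv ℝ f x) x :=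
      ((hf.differentiableOn one_ne_zero x hx).differentiableAt (hU.mem_nhds hx)).hasFDerivAt
    have h2 : HasDerivAt η (deriv η (N n * f x)) (N n * f x) :=
      (hη.differentiable one_ne_zero _).hasDerivAt
    have h3 := (HasDerivAt.comp_hasFDerivAt x h2 (h1.const_mul (N n))).const_mul (N n)⁻¹
    rw [(hgloc n x hx).fderiv_eq]
    refine h3.fderiv.trans ?_
    rw [smul_smul, smul_smul]
    congr 1
    field_simp [(hN n).ne']
  have hts : ∀ n, tsupport (g n) ⊆ closure U ∩ {x | (N n)⁻¹ ≤ |f x|} := by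
    intro n
    have hcl : IsClosed (closure U ∩ {x | (N n)⁻¹ ≤ |f x|}) :=
      hfc.abs.preimage_isClosed_of_isClosed isClosed_closure isClosed_Ici
    refine closure_minimal (fun x hx => ?_) hcl
    have hxU : x ∈ U := by
      by_contra h
      exact hx (if_neg h)
    refine ⟨subset_closure hxU, ?_⟩
    by_contra h
    apply hx
    have h' : |f x| < (N n)⁻¹ := not_le.1 h
    have : η (N n * f x) = 0 := by
      apply hη0
      rw [abs_mul, abs_of_pos (hN n)]
      calc N n * |f x| ≤ N n * (N n)⁻¹ := mul_le_mul_of_nonneg_left h'.le (hN n).le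
        _ = 1 := mul_inv_cancel₀ (hN n).ne'
    simp [g, this]
  -- The closed support lies where |f| ≥ 1/N, by continuity of f on the closure, and f = 0 on the
  -- boundary excludes boundary points.
  have htsU : ∀ n, tsupport (g n) ⊆ U := by
    intro n x hx
    obtain ⟨h1, h2⟩ := hts n hx
    by_contra h
    have h3 : x ∈ frontier U := ⟨h1, by rwa [hU.interior_eq]⟩
    have h4 : (N n)⁻¹ ≤ |f x| := h2
    rw [hf0 x h3, abs_zero] at h4
    exact absurd h4 (not_le.2 (inv_pos.2 (hN n)))
  have hgc : ∀ n, HasCompactSupport (g n) := fun n =>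
    IsCompact.of_isClosed_subset hb.isCompact_closure (isClosed_tsupport _)
      ((htsU n).trans subset_closure)
  have hg : ∀ n, ContDiff ℝ 1 (g n) := by
    intro n
    rw [contDiff_iff_contDiffAt]
    intro x
    by_cases hx : x ∈ U
    · have h1 : ContDiffAt ℝ 1 f x := hf.contDiffAt (hU.mem_nhds hx)
      refine ContDiffAt.congr_of_eventuallyEq ?_ (hgloc n x hx)
      exact contDiffAt_const.mul (hη.contDiffAt.comp x (contDiffAt_const.mul h1))
    · refine contDiffAt_const (c := (0 : ℝ)) |>.congr_of_eventuallyEq ?_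
      exact notMem_tsupport_iff_eventuallyEq.1 fun h => hx (htsU n h)
  have hNlim : Tendsto (fun n => (N n)⁻¹) atTop (𝓝 0) :=
    tendsto_inv_atTop_zero.comp (tendsto_atTop_add_const_right _ _ tendsto_natCast_atTop_atTop)
  have hlim1 : Tendsto (fun n => ∫ x in U, ‖g n x - f x‖ ^ 2) atTop (𝓝 0) := by
    have hbd : ∀ n, ∀ x ∈ U, ‖g n x - f x‖ ≤ (N n)⁻¹ * C₁ := by
      intro n x hx
      have e : g n x - f x = (N n)⁻¹ * (η (N n * f x) - N n * f x) := by
        simp only [g, if_pos hx]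
        field_simp [(hN n).ne']
      rw [e, norm_mul, Real.norm_of_nonneg (inv_pos.2 (hN n)).le]
      exact mul_le_mul_of_nonneg_left (hC₁ _) (inv_pos.2 (hN n)).le
    have hup : Tendsto (fun n => ((N n)⁻¹ * C₁) ^ 2 * volume.real U) atTop (𝓝 0) := by
      have := (((hNlim.mul_const C₁).pow 2).mul_const (volume.real U))
      simpa using this
    refine squeeze_zero (fun n => integral_nonneg fun x => by positivity) (fun n => ?_) hup
    have := setIntegral_mono_on (μ := volume) (s := U) (f := fun x => ‖g n x - f x‖ ^ 2)
      (g := fun _ => ((N n)⁻¹ * C₁) ^ 2) ?_ (integrable_const _) hUm fun x hx =>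
        pow_le_pow_left₀ (norm_nonneg _) (hbd n x hx) 2
    · refine this.trans (le_of_eq ?_)
      simp [mul_comm]
    · refine integrableOn_of_continuousOn_of_norm_le (C := ((N n)⁻¹ * C₁) ^ 2) hUm hfin ?_ ?_
      · exact ((((hg n).continuous.continuousOn).sub (hfc.mono subset_closure)).norm.pow 2)
      · intro x hx
        rw [norm_pow, norm_norm]
        exact pow_le_pow_left₀ (norm_nonneg _) (hbd n x hx) 2
  have hdcont : ∀ n, ContinuousOn (fun x => ‖fderiv ℝ (g n) x - fderiv ℝ f x‖ ^ 2) U := fun n =>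
    ((((hg n).continuous_fderiv one_ne_zero).continuousOn).sub hfd).norm.pow 2
  have hlim2 : Tendsto (fun n => ∫ x in U, ‖fderiv ℝ (g n) x - fderiv ℝ f x‖ ^ 2) atTop (𝓝 0) := by
    have hz : ∫ x in U, (0 : ℝ) = 0 := by simp
    rw [← hz]
    refine tendsto_integral_of_dominated_convergence (fun _ => (C₂ * C) ^ 2)
      (fun n => (hdcont n).aestronglyMeasurable hUm) (integrable_const _) (fun n => ?_) ?_
    · refine ae_restrict_of_forall_mem hUm fun x hx => ?_
      rw [norm_pow, norm_norm, hder n x hx]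
      have e : deriv η (N n * f x) • fderiv ℝ f x - fderiv ℝ f x
          = (deriv η (N n * f x) - 1) • fderiv ℝ f x := by rw [sub_smul, one_smul]
      rw [e, norm_smul]
      refine pow_le_pow_left₀ (by positivity) ?_ 2
      exact mul_le_mul (hC₂ _) (hC x hx) (norm_nonneg _) ((abs_nonneg _).trans (hC₂ 0))
    · filter_upwards [ae_fderiv_eq_zero_of_eq_zero hU (hf.differentiableOn one_ne_zero),
        ae_restrict_mem hUm] with x hx hxU
      -- The difference of gradients is eventually exactly 0: where f ≠ 0 because N|f| > 2 for large
      -- N, and where f = 0 because ∇f = 0 almost everywhere on that set.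
      refine tendsto_const_nhds.congr' ?_
      by_cases h0 : f x = 0
      · exact Eventually.of_forall fun n => by simp [hder n x hxU, hx h0]
      · have hN' : Tendsto (fun n => N n * |f x|) atTop atTop :=
          (tendsto_atTop_add_const_right _ _ tendsto_natCast_atTop_atTop).atTop_mul_const
            (abs_pos.2 h0)
        filter_upwards [hN'.eventually_gt_atTop 2] with n hn
        have : deriv η (N n * f x) = 1 := by
          apply hη1
          rwa [abs_mul, abs_of_pos (hN n)]
        simp [hder n x hxU, this]
  obtain ⟨n, hn1, hn2⟩ := ((hlim1.eventually_lt_const (u := ε / 4) (by positivity)).and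
    (hlim2.eventually_lt_const (u := ε / 4) (by positivity))).exists
  -- The choice gives κ²|U| ≤ ε/8. With (a+b)² ≤ 2a² + 2b² the total error is below 2·ε/8 + 2·ε/4 <
  -- ε.
  set κ : ℝ := Real.sqrt (ε / (8 * (volume.real U + 1))) with hκ
  have hvol : 0 ≤ volume.real U := measureReal_nonneg
  have hκ0 : 0 < κ := Real.sqrt_pos.2 (by positivity)
  have hκ2 : κ ^ 2 = ε / (8 * (volume.real U + 1)) := Real.sq_sqrt (by positivity)
  have hκv : κ ^ 2 * volume.real U ≤ ε / 8 := by
    rw [hκ2, div_mul_eq_mul_div, div_le_div_iff₀ (by positivity) (by positivity)]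
    nlinarith
  obtain ⟨ψ, hψ, hψc, hψs, h1, h2⟩ := exists_contDiff_dist_le hU (hg n) (hgc n) (htsU n) hκ0
  refine ⟨ψ, hψ, hψc, hψs, ?_, ?_⟩
  · have hi : IntegrableOn (fun x => ‖g n x - f x‖ ^ 2) U := by
      obtain ⟨K, hK⟩ := hb.isCompact_closure.exists_bound_of_continuousOn
        (f := fun x => ‖g n x - f x‖ ^ 2)
        ((((hg n).continuous.continuousOn).sub hfc).norm.pow 2)
      exact integrableOn_of_continuousOn_of_norm_le hUm hfin
        ((((hg n).continuous.continuousOn).sub (hfc.mono subset_closure)).norm.pow 2)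
        fun x hx => hK x (subset_closure hx)
    have hle : ∫ x in U, ‖ψ x - f x‖ ^ 2 ≤ ∫ x in U, (2 * κ ^ 2 + 2 * ‖g n x - f x‖ ^ 2) := by
      refine integral_mono_of_nonneg (Eventually.of_forall fun x => by positivity)
        ((integrable_const _).add (hi.const_mul 2)) (Eventually.of_forall fun x => ?_)
      have a1 : ‖ψ x - f x‖ ≤ κ + ‖g n x - f x‖ :=
        (norm_sub_le_norm_sub_add_norm_sub _ (g n x) _).trans (by gcongr; exact h1 x)
      have := pow_le_pow_left₀ (norm_nonneg _) a1 2
      change ‖ψ x - f x‖ ^ 2 ≤ 2 * κ ^ 2 + 2 * ‖g n x - f x‖ ^ 2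
      nlinarith [sq_nonneg (κ - ‖g n x - f x‖)]
    rw [integral_add (integrable_const _) (hi.const_mul 2)] at hle
    simp only [integral_const_mul, integral_const, measureReal_restrict_apply_univ, smul_eq_mul] at hle
    nlinarith
  · have hi : IntegrableOn (fun x => ‖fderiv ℝ (g n) x - fderiv ℝ f x‖ ^ 2) U := by
      obtain ⟨K, hK⟩ := ((hg n).continuous_fderiv one_ne_zero).bounded_above_of_compact_support
        ((hgc n).fderiv ℝ)
      refine integrableOn_of_continuousOn_of_norm_le (C := (K + C) ^ 2) hUm hfin (hdcont n)
        fun x hx => ?_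
      rw [norm_pow, norm_norm]
      exact pow_le_pow_left₀ (norm_nonneg _)
        ((norm_sub_le _ _).trans (add_le_add (hK x) (hC x hx))) 2
    have hle : ∫ x in U, ‖fderiv ℝ ψ x - fderiv ℝ f x‖ ^ 2
        ≤ ∫ x in U, (2 * κ ^ 2 + 2 * ‖fderiv ℝ (g n) x - fderiv ℝ f x‖ ^ 2) := by
      refine integral_mono_of_nonneg (Eventually.of_forall fun x => by positivity)
        ((integrable_const _).add (hi.const_mul 2)) (Eventually.of_forall fun x => ?_)
      have a1 : ‖fderiv ℝ ψ x - fderiv ℝ f x‖ ≤ κ + ‖fderiv ℝ (g n) x - fderiv ℝ f x‖ :=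
        (norm_sub_le_norm_sub_add_norm_sub _ (fderiv ℝ (g n) x) _).trans (by gcongr; exact h2 x)
      have := pow_le_pow_left₀ (norm_nonneg _) a1 2
      change ‖fderiv ℝ ψ x - fderiv ℝ f x‖ ^ 2 ≤ 2 * κ ^ 2 + 2 * ‖fderiv ℝ (g n) x - fderiv ℝ f x‖ ^ 2
      nlinarith [sq_nonneg (κ - ‖fderiv ℝ (g n) x - fderiv ℝ f x‖)]
    rw [integral_add (integrable_const _) (hi.const_mul 2)] at hle
    simp only [integral_const_mul, integral_const, measureReal_restrict_apply_univ, smul_eq_mul] at hle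
    nlinarith

end Mollify

/-! ### The space `W_0^{1,2}` -/

section Sobolev

variable {d : ℕ}

lemma gradMat_apply {v : Sp d → Sp d} {x : Sp d} (hv : DifferentiableAt ℝ v x) (i j : Fin d) :
    gradMat v x i j = fderiv ℝ (fun y => v y i) x (basisVec j) := by
  have h := (EuclideanSpace.proj (𝕜 := ℝ) i).hasFDerivAt.comp x hv.hasFDerivAt
  have h2 : HasFDerivAt (fun y => v y i) ((EuclideanSpace.proj (𝕜 := ℝ) i).comp (fderiv ℝ v x)) x := h
  rw [h2.fderiv]; rfl

lemma abs_apply_le_norm (a : Sp d) (i : Fin d) : |a i| ≤ ‖a‖ := by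
  simpa using PiLp.norm_apply_le a i

lemma _root_.MeasureTheory.MemLp.coord {X : Type*} [MeasurableSpace X] {ν : Measure X} {p : ℝ≥0∞}
    {f : X → Sp d} (hf : MemLp f p ν) (i : Fin d) : MemLp (fun x => f x i) p ν :=
  (EuclideanSpace.proj i : Sp d →L[ℝ] ℝ).comp_memLp' hf

lemma norm_fderiv_apply_le {v : Sp d → Sp d} {x : Sp d} (hv : DifferentiableAt ℝ v x) (i : Fin d) :
    ‖fderiv ℝ (fun y => v y i) x‖ ≤ ‖fderiv ℝ v x‖ := by
  have h := (EuclideanSpace.proj (𝕜 := ℝ) i).hasFDerivAt.comp x hv.hasFDerivAt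
  have h2 : HasFDerivAt (fun y => v y i) ((EuclideanSpace.proj (𝕜 := ℝ) i).comp (fderiv ℝ v x)) x := h
  rw [h2.fderiv]
  refine ContinuousLinearMap.opNorm_le_bound _ (norm_nonneg _) fun z => ?_
  exact (abs_apply_le_norm _ i).trans ((fderiv ℝ v x).le_opNorm z)

lemma frob_self (A : Mat d) : frob A A = ∑ i, ∑ j, A i j ^ 2 := by
  simp [frob, sq]

lemma sq_entry_le_frob (A : Mat d) (i j : Fin d) : A i j ^ 2 ≤ frob A A := by
  rw [frob_self]
  calc A i j ^ 2 ≤ ∑ j', A i j' ^ 2 :=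
        Finset.single_le_sum (f := fun j' => A i j' ^ 2) (fun _ _ => sq_nonneg _) (Finset.mem_univ j)
    _ ≤ ∑ i', ∑ j', A i' j' ^ 2 :=
        Finset.single_le_sum (f := fun i' => ∑ j', A i' j' ^ 2)
          (fun _ _ => Finset.sum_nonneg fun _ _ => sq_nonneg _) (Finset.mem_univ i)

/-- A `C¹` vector field with bounded gradient that vanishes on the boundary belongs to
`W_0^{1,2}`. -/
lemma isW012_of_contDiffOn {Ω : Set (Sp d)} (hΩ : IsOpen Ω) (hb : Bornology.IsBounded Ω)
    {v : Sp d → Sp d} (hvc : ContinuousOn v (closure Ω)) (hv0 : ∀ x ∈ frontier Ω, v x = 0)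
    (hv : ContDiffOn ℝ 1 v Ω) {C : ℝ} (hC : ∀ x ∈ Ω, ‖fderiv ℝ v x‖ ≤ C) :
    IsW012 Ω v (gradMat v) := by
  have hm := hΩ.measurableSet
  have hfin : volume Ω < ⊤ := hb.measure_lt_top
  have : IsFiniteMeasure (volume.restrict Ω) := ⟨by simpa using hfin⟩
  have hdiff : ∀ x ∈ Ω, DifferentiableAt ℝ v x := fun x hx =>
    (hv.differentiableOn one_ne_zero x hx).differentiableAt (hΩ.mem_nhds hx)
  have hfd : ContinuousOn (fderiv ℝ v) Ω := hv.continuousOn_fderiv_of_isOpen hΩ le_rfl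
  have hgc : ∀ i j, ContinuousOn (fun x => gradMat v x i j) Ω := by
    intro i j
    have : ContinuousOn (fun x => fderiv ℝ v x (basisVec j)) Ω := hfd.clm_apply continuousOn_const
    exact (EuclideanSpace.proj (𝕜 := ℝ) i).continuous.comp_continuousOn this
  have hgb : ∀ i j, ∀ x ∈ Ω, ‖gradMat v x i j‖ ≤ C := by
    intro i j x hx
    refine (abs_apply_le_norm (fderiv ℝ v x (basisVec j)) i).trans ?_
    refine ((fderiv ℝ v x).le_opNorm _).trans ?_
    simpa using hC x hx
  obtain ⟨K, hK⟩ := hb.isCompact_closure.exists_bound_of_continuousOn hvc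
  have hvi : ∀ i, ContDiffOn ℝ 1 (fun x => v x i) Ω := fun i => contDiffOn_euclidean.1 hv i
  refine ⟨?_, ?_, ?_⟩
  · exact MemLp.of_bound ((hvc.mono subset_closure).aestronglyMeasurable hm) K
      (ae_restrict_of_forall_mem hm fun x hx => hK x (subset_closure hx))
  · exact fun i j => MemLp.of_bound ((hgc i j).aestronglyMeasurable hm) C
      (ae_restrict_of_forall_mem hm fun x hx => hgb i j x hx)
  · intro ε hε
    have hd1 : (0 : ℝ) < (d : ℝ) * d + d + 1 := by positivity
    -- The d components cost dδ in the function and d·dδ in the gradient, whose rows have d entries.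
    -- The summand 1 makes both estimates strict.
    set δ : ℝ := ε / ((d : ℝ) * d + d + 1) with hδ
    have hδ0 : 0 < δ := by positivity
    have key : ∀ i, ∃ ψ : Sp d → ℝ, ContDiff ℝ ∞ ψ ∧ HasCompactSupport ψ ∧ tsupport ψ ⊆ Ω ∧
        (∫ x in Ω, ‖ψ x - v x i‖ ^ 2) < δ ∧
        (∫ x in Ω, ‖fderiv ℝ ψ x - fderiv ℝ (fun y => v y i) x‖ ^ 2) < δ := by
      intro i
      refine exists_test_approx hΩ hb (f := fun x => v x i) ?_ ?_ (hvi i) (C := C) ?_ hδ0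
      · exact (EuclideanSpace.proj (𝕜 := ℝ) i).continuous.comp_continuousOn hvc
      · intro x hx; simp [hv0 x hx]
      · exact fun x hx => (norm_fderiv_apply_le (hdiff x hx) i).trans (hC x hx)
    choose ψ hψ hψc hψs h1 h2 using key
    let φ : Sp d → Sp d := fun x => WithLp.toLp 2 fun i => ψ i x
    have hφ : ContDiff ℝ ∞ φ := contDiff_euclidean.2 fun i => hψ i
    have hts : tsupport φ ⊆ ⋃ i, tsupport (ψ i) := by
      refine closure_minimal (fun x hx => ?_) (isClosed_iUnion_of_finite fun i => isClosed_tsupport _)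
      by_contra hcon
      apply hx
      ext i
      exact image_eq_zero_of_notMem_tsupport (f := ψ i) fun h => hcon (mem_iUnion.2 ⟨i, h⟩)
    have htsΩ : tsupport φ ⊆ Ω := hts.trans (iUnion_subset hψs)
    have hφd : ∀ x, DifferentiableAt ℝ φ x := hφ.differentiable (by simp)
    have hi1 : ∀ i, Integrable (fun x => (ψ i x - v x i) ^ 2) (volume.restrict Ω) := by
      intro i
      obtain ⟨L, hL⟩ := (hψ i).continuous.bounded_above_of_compact_support (hψc i)
      refine integrableOn_of_continuousOn_of_norm_le (C := (L + K) ^ 2) hm hfin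
        (((hψ i).continuous.continuousOn.sub (hvi i).continuousOn).pow 2) fun x hx => ?_
      rw [norm_pow]
      refine pow_le_pow_left₀ (norm_nonneg _) ((norm_sub_le _ _).trans (add_le_add (hL x) ?_)) 2
      exact (abs_apply_le_norm (v x) i).trans (hK x (subset_closure hx))
    have hψd : ∀ i, Continuous (fderiv ℝ (ψ i)) := fun i => (hψ i).continuous_fderiv (by simp)
    have hi2 : ∀ i, Integrable (fun x => ‖fderiv ℝ (ψ i) x - fderiv ℝ (fun y => v y i) x‖ ^ 2)
        (volume.restrict Ω) := by
      intro i
      obtain ⟨L, hL⟩ := (hψd i).bounded_above_of_compact_support ((hψc i).fderiv ℝ)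
      refine integrableOn_of_continuousOn_of_norm_le (C := (L + C) ^ 2) hm hfin
        (((hψd i).continuousOn.sub ((hvi i).continuousOn_fderiv_of_isOpen hΩ le_rfl)).norm.pow 2)
        fun x hx => ?_
      rw [norm_pow, norm_norm]
      exact pow_le_pow_left₀ (norm_nonneg _) ((norm_sub_le _ _).trans (add_le_add (hL x)
        ((norm_fderiv_apply_le (hdiff x hx) i).trans (hC x hx)))) 2
    refine ⟨φ, hφ, IsCompact.of_isClosed_subset hb.isCompact_closure (isClosed_tsupport _)
      (htsΩ.trans subset_closure), htsΩ, ?_, ?_⟩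
    · have e : ∀ x, ‖φ x - v x‖ ^ 2 = ∑ i, (ψ i x - v x i) ^ 2 := by
        intro x
        rw [EuclideanSpace.norm_sq_eq]
        simp [φ]
      simp only [e]
      rw [integral_finsetSum _ fun i _ => hi1 i]
      have h3 : ∀ i ∈ Finset.univ, ∫ x in Ω, (ψ i x - v x i) ^ 2 ≤ δ := by
        intro i _
        have := (h1 i).le
        simpa using this
      refine (Finset.sum_le_card_nsmul _ _ _ h3).trans_lt ?_
      rw [Finset.card_univ, Fintype.card_fin, nsmul_eq_mul, hδ, mul_div_assoc', div_lt_iff₀ hd1]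
      nlinarith [mul_nonneg (Nat.cast_nonneg (α := ℝ) d) (Nat.cast_nonneg (α := ℝ) d)]
    · have hle : ∀ x ∈ Ω, frob (gradMat φ x - gradMat v x) (gradMat φ x - gradMat v x)
          ≤ ∑ i, (d : ℝ) * ‖fderiv ℝ (ψ i) x - fderiv ℝ (fun y => v y i) x‖ ^ 2 := by
        intro x hx
        rw [frob_self]
        refine Finset.sum_le_sum fun i _ => ?_
        have h3 : ∀ j ∈ Finset.univ, (gradMat φ x - gradMat v x) i j ^ 2
            ≤ ‖fderiv ℝ (ψ i) x - fderiv ℝ (fun y => v y i) x‖ ^ 2 := by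
          intro j _
          have e : (gradMat φ x - gradMat v x) i j
              = (fderiv ℝ (ψ i) x - fderiv ℝ (fun y => v y i) x) (basisVec j) := by
            rw [Matrix.sub_apply, gradMat_apply (hφd x), gradMat_apply (hdiff x hx)]
            rfl
          rw [e, ← sq_abs, ← Real.norm_eq_abs]
          refine pow_le_pow_left₀ (norm_nonneg _) ?_ 2
          refine (ContinuousLinearMap.le_opNorm _ _).trans ?_
          simp
        refine (Finset.sum_le_card_nsmul _ _ _ h3).trans ?_
        simp
      have hsum : Integrable (fun x => ∑ i, (d : ℝ) * ‖fderiv ℝ (ψ i) x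
          - fderiv ℝ (fun y => v y i) x‖ ^ 2) (volume.restrict Ω) :=
        integrable_finsetSum _ fun i _ => (hi2 i).const_mul _
      have h4 : ∫ x in Ω, frob (gradMat φ x - gradMat v x) (gradMat φ x - gradMat v x)
          ≤ ∫ x in Ω, ∑ i, (d : ℝ) * ‖fderiv ℝ (ψ i) x - fderiv ℝ (fun y => v y i) x‖ ^ 2 := by
        refine integral_mono_of_nonneg (Eventually.of_forall fun x => ?_) hsum
          (ae_restrict_of_forall_mem hm hle)
        simp only [Pi.zero_apply, frob_self]
        positivity
      refine h4.trans_lt ?_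
      rw [integral_finsetSum _ fun i _ => (hi2 i).const_mul _]
      simp only [integral_const_mul]
      have h3 : ∀ i ∈ Finset.univ, (d : ℝ) * ∫ x in Ω, ‖fderiv ℝ (ψ i) x
          - fderiv ℝ (fun y => v y i) x‖ ^ 2 ≤ d * δ :=
        fun i _ => mul_le_mul_of_nonneg_left (h2 i).le (Nat.cast_nonneg d)
      refine (Finset.sum_le_card_nsmul _ _ _ h3).trans_lt ?_
      rw [Finset.card_univ, Fintype.card_fin, nsmul_eq_mul, hδ, ← mul_assoc, mul_div_assoc',
        div_lt_iff₀ hd1]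
      nlinarith [Nat.cast_nonneg (α := ℝ) d]

/-- If `g = ∂_k f` weakly, then `∫ f ∂_k w_l = - ∫ g w_l` for `w ∈ W_0^{1,2}`. -/
lemma IsW012.integral_mul_eq_neg {Ω : Set (Sp d)} {w : Sp d → Sp d} {W : Sp d → Mat d}
    (hw : IsW012 Ω w W) {f g : Sp d → ℝ} (hf : MemLp f 2 (volume.restrict Ω))
    (hg : MemLp g 2 (volume.restrict Ω)) {k : Fin d}
    (hfg : ∀ ψ : Sp d → ℝ, ContDiff ℝ ∞ ψ → HasCompactSupport ψ → tsupport ψ ⊆ Ω →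
      ∫ x in Ω, f x * fderiv ℝ ψ x (basisVec k) = - ∫ x in Ω, g x * ψ x) (l : Fin d) :
    ∫ x in Ω, f x * W x l k = - ∫ x in Ω, g x * w x l := by
  obtain ⟨hw2, hW2, happ⟩ := hw
  have hwl : MemLp (fun x => w x l) 2 (volume.restrict Ω) :=
    hw2.coord l
  have hF := hf.integrable_sq
  have hG := hg.integrable_sq
  set A : ℝ := (∫ x in Ω, f x ^ 2) + ∫ x in Ω, g x ^ 2 with hA
  have hA0 : 0 ≤ A := add_nonneg (integral_nonneg fun _ => sq_nonneg _)
    (integral_nonneg fun _ => sq_nonneg _)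
  -- Weighted Young inequality. The weight is kept free so that the factor known to be small can
  -- absorb δ⁻¹.
  have young : ∀ (a b : Sp d → ℝ), MemLp a 2 (volume.restrict Ω) → MemLp b 2 (volume.restrict Ω) →
      ∀ δ > 0, |∫ x in Ω, a x * b x| ≤ δ * (∫ x in Ω, a x ^ 2) + δ⁻¹ * ∫ x in Ω, b x ^ 2 := by
    intro a b ha hb δ hδ
    have hi := (ha.integrable_sq.const_mul δ).add (hb.integrable_sq.const_mul δ⁻¹)
    rw [← integral_const_mul, ← integral_const_mul,
      ← integral_add (ha.integrable_sq.const_mul _) (hb.integrable_sq.const_mul _),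
      ← Real.norm_eq_abs]
    refine norm_integral_le_of_norm_le hi (Eventually.of_forall fun x => ?_)
    rw [Real.norm_eq_abs, abs_mul, ← sq_abs (a x), ← sq_abs (b x)]
    have h1 : 0 ≤ (δ * |a x| - |b x|) ^ 2 := sq_nonneg _
    have h2 : δ * |a x| ^ 2 + δ⁻¹ * |b x| ^ 2 - |a x| * |b x|
        = δ⁻¹ * ((δ * |a x| - |b x|) ^ 2 + δ * |a x| * |b x|) := by
      field_simp; ring
    have h3 : 0 ≤ δ⁻¹ * ((δ * |a x| - |b x|) ^ 2 + δ * |a x| * |b x|) := by positivity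
    change |a x| * |b x| ≤ δ * |a x| ^ 2 + δ⁻¹ * |b x| ^ 2
    linarith
  -- The test field is chosen with squared error δ². In each of the two error terms the weight δ⁻¹
  -- turns this into δ, while the fixed functions f and g contribute δA together.
  have main : ∀ δ > 0, |(∫ x in Ω, f x * W x l k) + ∫ x in Ω, g x * w x l| ≤ δ * A + 2 * δ := by
    intro δ hδ
    obtain ⟨φ, hφ, hφc, hφs, h1, h2⟩ := happ (δ ^ 2) (by positivity)
    have hφd : ∀ x, DifferentiableAt ℝ φ x := hφ.differentiable (by simp)
    let ψ : Sp d → ℝ := fun x => φ x l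
    have hψ : ContDiff ℝ ∞ ψ := contDiff_euclidean.1 hφ l
    have hsub : Function.support ψ ⊆ Function.support φ := by
      intro x hx h0
      exact hx (by simp [ψ, h0])
    have hψs : tsupport ψ ⊆ tsupport φ := closure_mono hsub
    have hψc : HasCompactSupport ψ := IsCompact.of_isClosed_subset hφc (isClosed_tsupport _) hψs
    have hφ2 : MemLp φ 2 (volume.restrict Ω) :=
      (hφ.continuous.memLp_of_hasCompactSupport hφc).restrict Ω
    have hψ2 : MemLp ψ 2 (volume.restrict Ω) :=
      (hψ.continuous.memLp_of_hasCompactSupport hψc).restrict Ω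
    have hD2 : ∀ i j, MemLp (fun x => gradMat φ x i j) 2 (volume.restrict Ω) := by
      intro i j
      have hc : Continuous fun x => fderiv ℝ φ x (basisVec j) :=
        (hφ.continuous_fderiv (by simp)).clm_apply continuous_const
      have := (hc.memLp_of_hasCompactSupport (p := 2) (μ := volume)
        (hφc.fderiv_apply (𝕜 := ℝ) _)).restrict Ω
      exact this.coord i
    have hid := hfg ψ hψ hψc (hψs.trans hφs)
    have hgr : ∀ x, fderiv ℝ ψ x (basisVec k) = gradMat φ x l k := fun x =>
      (gradMat_apply (hφd x) l k).symm
    simp only [hgr] at hid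
    have e1 : ∫ x in Ω, f x * (W x l k - gradMat φ x l k)
        = (∫ x in Ω, f x * W x l k) - ∫ x in Ω, f x * gradMat φ x l k := by
      simp only [mul_sub]
      exact integral_sub (hf.integrable_mul (hW2 l k)) (hf.integrable_mul (hD2 l k))
    have e2 : ∫ x in Ω, g x * (w x l - ψ x)
        = (∫ x in Ω, g x * w x l) - ∫ x in Ω, g x * ψ x := by
      simp only [mul_sub]
      exact integral_sub (hg.integrable_mul hwl) (hg.integrable_mul hψ2)
    have e3 : (∫ x in Ω, f x * W x l k) + ∫ x in Ω, g x * w x l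
        = (∫ x in Ω, f x * (W x l k - gradMat φ x l k)) + ∫ x in Ω, g x * (w x l - ψ x) := by
      rw [e1, e2, hid]; ring
    have b1 : ∫ x in Ω, (W x l k - gradMat φ x l k) ^ 2 ≤ δ ^ 2 := by
      refine (integral_mono_of_nonneg (Eventually.of_forall fun x => sq_nonneg _) ?_
        (Eventually.of_forall fun x => ?_)).trans h2.le
      · simp only [frob_self]
        exact integrable_finsetSum _ fun i _ => integrable_finsetSum _ fun j _ =>
          ((hD2 i j).sub (hW2 i j)).integrable_sq
      · have := sq_entry_le_frob (gradMat φ x - W x) l k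
        rw [Matrix.sub_apply] at this
        change (W x l k - gradMat φ x l k) ^ 2 ≤ _
        rw [sub_sq_comm]; exact this
    have b2 : ∫ x in Ω, (w x l - ψ x) ^ 2 ≤ δ ^ 2 := by
      refine (integral_mono_of_nonneg (Eventually.of_forall fun x => sq_nonneg _)
        (hφ2.sub hw2).norm.integrable_sq (Eventually.of_forall fun x => ?_)).trans h1.le
      have := abs_apply_le_norm (φ x - w x) l
      have := pow_le_pow_left₀ (abs_nonneg _) this 2
      rw [sq_abs] at this
      change (w x l - ψ x) ^ 2 ≤ _
      rw [sub_sq_comm]; exact this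
    have y1 := young f _ hf ((hW2 l k).sub (hD2 l k)) δ hδ
    have y2 := young g _ hg (hwl.sub hψ2) δ hδ
    have c1 := mul_le_mul_of_nonneg_left b1 (inv_pos.2 hδ).le
    have c2 := mul_le_mul_of_nonneg_left b2 (inv_pos.2 hδ).le
    have c3 : δ⁻¹ * δ ^ 2 = δ := by field_simp
    rw [e3]
    refine (abs_add_le _ _).trans ?_
    simp only [Pi.sub_apply] at y1 y2
    rw [hA]
    linarith
  have hzero : (∫ x in Ω, f x * W x l k) + ∫ x in Ω, g x * w x l = 0 := by
    rw [← abs_nonpos_iff]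
    refine le_of_forall_pos_le_add fun ε hε => ?_
    refine (main (ε / (A + 2)) (by positivity)).trans (le_of_eq ?_)
    field_simp
    ring
  linarith

end Sobolev

/-! ### The Reynolds defect term -/

section Reynolds

variable {d : ℕ} {Ω : Set (Sp d)} {T : ℝ}

lemma closure_slab (Ω : Set (Sp d)) (hT : 0 < T) : closure (slab Ω T) = closedSlab Ω T := by
  rw [slab, closure_prod_eq, closure_Ioo hT.ne, closedSlab]

/-- The extension of the gradient to the closed cylinder is continuous. -/
lemma IsC1Closed.exists_continuousMap_closedGrad {u : ℝ → Sp d → Sp d} (hT : 0 < T)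
    (hb : Bornology.IsBounded Ω) (h : IsC1Closed Ω T u) (i j : Fin d) :
    ∃ g : C(ℝ × Sp d, ℝ), ∀ q ∈ closedSlab Ω T, closedGrad Ω T u q.1 q.2 i j = g q := by
  have h' := h
  obtain ⟨-, Df, hc, hD⟩ := h'
  let A : ℝ × Sp d → Mat d := fun q => Matrix.of fun i j => (Df q (0, basisVec j)) i
  have hAc : ContinuousOn A (closedSlab Ω T) := by
    refine continuousOn_pi.2 fun i => continuousOn_pi.2 fun j => ?_
    exact (EuclideanSpace.proj (𝕜 := ℝ) i).continuous.comp_continuousOn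
      (hc.clm_apply continuousOn_const)
  have hgrad : ∀ q ∈ slab Ω T, gradMat (u q.1) q.2 = A q := by
    intro q hq
    ext i j
    have e : stDeriv u q = Df q := (hD q hq).fderiv
    simp only [gradMat, A, Matrix.of_apply]
    rw [h.fderiv_apply hq, e]
  have hext : ∀ q ∈ closedSlab Ω T, closedGrad Ω T u q.1 q.2 = A q := by
    intro q hq
    refine extendFrom_eq (by rw [closure_slab Ω hT]; exact hq) ?_
    have h1 : Tendsto A (𝓝[slab Ω T] q) (𝓝 (A q)) :=
      (hAc q hq).mono_left (nhdsWithin_mono _ (slab_subset_closedSlab Ω T))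
    refine h1.congr' ?_
    filter_upwards [self_mem_nhdsWithin] with z hz
    exact (hgrad z hz).symm
  have hAij : ContinuousOn (fun q => A q i j) (closedSlab Ω T) :=
    (continuous_apply_apply i j).comp_continuousOn hAc
  -- Tietze extension: the defects are tested with functions continuous on all of space, whereas the
  -- gradient is controlled only on the closed cylinder.
  obtain ⟨g, hg⟩ := ContinuousMap.exists_restrict_eq (isCompact_closedSlab hb T).isClosed
    ⟨(closedSlab Ω T).domRestrict fun q => A q i j, hAij.domRestrict⟩
  refine ⟨g, fun q hq => ?_⟩
  rw [hext q hq]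
  exact (congrArg (fun k : C(closedSlab Ω T, ℝ) => k ⟨q, hq⟩) hg).symm

/-- The variation of the restricted measure is the restricted variation, so it does not charge the
complement of K. -/
lemma ae_restrict_variation {μ : SignedMeasure (Sp d)} {K : Set (Sp d)} (hK : MeasurableSet K)
    {P : Sp d → Prop} (h : ∀ x ∈ K, P x) : ∀ᵐ x ∂((μ.restrict K).variation), P x := by
  rw [VectorMeasure.variation_restrict hK]
  exact ae_restrict_of_forall_mem hK h

/-- Pairing a weakly-star measurable bounded family of signed measures with a continuous function of
time and space gives an integrable function of time. -/
lemma integrableOn_integral_signedMeasure {M : ℝ → SignedMeasure (Sp d)} {K : Set (Sp d)}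
    (hK : IsCompact K) {C : ℝ}
    (hbd : ∀ᵐ t ∂(volume.restrict (Ioo 0 T)), (M t).variation univ ≤ ENNReal.ofReal C)
    (hmeas : ∀ φ : C(Sp d, ℝ),
      AEMeasurable (fun t => ∫ᵛ x in K, φ x ∂•(M t)) (volume.restrict (Ioo 0 T)))
    (g : C(ℝ × Sp d, ℝ)) :
    IntegrableOn (fun t => ∫ᵛ x in K, g (t, x) ∂•(M t)) (Ioo 0 T) := by
  have hKm := hK.measurableSet
  have hfin : ∀ t, (M t).variation univ ≤ ENNReal.ofReal C →
      IsFiniteMeasure ((M t).restrict K).variation := by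
    intro t ht
    rw [VectorMeasure.variation_restrict hKm]
    have : IsFiniteMeasure (M t).variation := ⟨ht.trans_lt ENNReal.ofReal_lt_top⟩
    infer_instance
  -- Measurability is assumed only for test functions of x. Rounding t down to a grid of mesh
  -- 1/(n+1) leaves countably many such functions, indexed by an integer depending measurably on t;
  -- the mesh then tends to 0.
  let s : ℕ → ℝ → ℝ := fun n t => (⌊((n : ℝ) + 1) * t⌋ : ℝ) / ((n : ℝ) + 1)
  have hs : ∀ t, Tendsto (fun n => s n t) atTop (𝓝 t) := by
    intro t
    have h1 : Tendsto (fun n : ℕ => ((n : ℝ) + 1)⁻¹) atTop (𝓝 0) :=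
      tendsto_inv_atTop_zero.comp (tendsto_atTop_add_const_right _ _ tendsto_natCast_atTop_atTop)
    rw [tendsto_iff_dist_tendsto_zero]
    refine squeeze_zero (fun _ => dist_nonneg) (fun n => ?_) h1
    have hn : (0 : ℝ) < (n : ℝ) + 1 := by positivity
    have f1 := Int.floor_le (((n : ℝ) + 1) * t)
    have f2 := Int.lt_floor_add_one (((n : ℝ) + 1) * t)
    have e : s n t - t = (⌊((n : ℝ) + 1) * t⌋ - ((n : ℝ) + 1) * t) / ((n : ℝ) + 1) := by
      simp only [s]; field_simp
    rw [Real.dist_eq, e, abs_div, abs_of_pos hn, div_eq_mul_inv]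
    refine mul_le_of_le_one_left (inv_pos.2 hn).le ?_
    rw [abs_le]; constructor <;> linarith
  have hFn : ∀ n, AEMeasurable (fun t => ∫ᵛ x in K, g (s n t, x) ∂•(M t))
      (volume.restrict (Ioo 0 T)) := by
    intro n
    have hk : ∀ k : ℤ, AEMeasurable (fun t => ∫ᵛ x in K, g ((k : ℝ) / ((n : ℝ) + 1), x) ∂•(M t))
        (volume.restrict (Ioo 0 T)) := fun k =>
      hmeas ⟨fun x => g ((k : ℝ) / ((n : ℝ) + 1), x), by fun_prop⟩
    choose G hGm hGe using hk
    have hG : Measurable fun z : ℝ × ℤ => G z.2 z.1 :=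
      measurable_from_prod_countable_left fun k => hGm k
    have hκ : Measurable fun t : ℝ => (t, ⌊((n : ℝ) + 1) * t⌋) :=
      measurable_id.prodMk (Int.measurable_floor.comp (measurable_const_mul _))
    refine ⟨_, hG.comp hκ, ?_⟩
    filter_upwards [ae_all_iff.2 hGe] with t ht
    exact ht ⌊((n : ℝ) + 1) * t⌋
  have hbound : ∀ a b : ℝ, ∃ L, 0 ≤ L ∧ ∀ t ∈ Icc a b, ∀ x ∈ K, ‖g (t, x)‖ ≤ L := by
    intro a b
    obtain ⟨L, hL⟩ := ((isCompact_Icc (a := a) (b := b)).prod hK).exists_bound_of_continuousOn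
      g.continuous.continuousOn
    exact ⟨max L 0, le_max_right _ _, fun t ht x hx => (hL (t, x) ⟨ht, hx⟩).trans (le_max_left _ _)⟩
  have hlim : ∀ᵐ t ∂(volume.restrict (Ioo 0 T)),
      Tendsto (fun n => ∫ᵛ x in K, g (s n t, x) ∂•(M t)) atTop
        (𝓝 (∫ᵛ x in K, g (t, x) ∂•(M t))) := by
    filter_upwards [hbd] with t ht
    have := hfin t ht
    obtain ⟨L, -, hL⟩ := hbound (t - 1) (t + 1)
    -- Here the measure is frozen at time t and only the time argument of g moves, so no continuity
    -- of the family M is involved.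
    have hca : ContinuousAt (fun r => ∫ᵛ x in K, g (r, x) ∂•(M t)) t := by
      refine VectorMeasure.continuousAt_of_dominated (bound := fun _ => L) ?_ ?_
        (integrable_const _) ?_
      · exact Eventually.of_forall fun r =>
          (show Continuous fun x => g (r, x) by fun_prop).aestronglyMeasurable
      · filter_upwards [Icc_mem_nhds (show t - 1 < t by linarith) (show t < t + 1 by linarith)]
          with r hr
        exact ae_restrict_variation hKm fun x hx => hL r hr x hx
      · exact Eventually.of_forall fun x =>
          (show Continuous fun r => g (r, x) by fun_prop).continuousAt
    exact hca.tendsto.comp (hs t)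
  have hae : AEMeasurable (fun t => ∫ᵛ x in K, g (t, x) ∂•(M t)) (volume.restrict (Ioo 0 T)) :=
    aemeasurable_of_tendsto_metrizable_ae atTop hFn hlim
  obtain ⟨L, hL0, hL⟩ := hbound 0 T
  refine Integrable.of_bound hae.aestronglyMeasurable
    (‖ContinuousLinearMap.lsmul ℝ ℝ (E := ℝ)‖ * (L * max C 0)) ?_
  filter_upwards [hbd, ae_restrict_mem measurableSet_Ioo] with t ht htT
  have := hfin t ht
  refine VectorMeasure.norm_integral_le_integral_norm.trans ?_
  gcongr
  have h1 : ∫ x, ‖g (t, x)‖ ∂((M t).restrict K).variation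
      ≤ ∫ _, L ∂((M t).restrict K).variation :=
    integral_mono_of_nonneg (Eventually.of_forall fun _ => norm_nonneg _) (integrable_const _)
      (ae_restrict_variation hKm fun x hx => hL t ⟨htT.1.le, htT.2.le⟩ x hx)
  refine h1.trans ?_
  rw [integral_const, smul_eq_mul, mul_comm]
  gcongr
  rw [Measure.real, VectorMeasure.variation_restrict hKm, Measure.restrict_apply_univ]
  refine ENNReal.toReal_le_of_le_ofReal (le_max_right _ _) ?_
  exact ((measure_mono (subset_univ K)).trans ht).trans
    (ENNReal.ofReal_le_ofReal (le_max_left _ _))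

/-- On [0,T] × closure Ω the entries of `closedGrad` agree with globally continuous functions, and
the pairing sees no other values. The defect is weakly-star measurable and bounded in variation, so
each entry pairs to an integrable function of time. -/
lemma integrableOn_termReynolds (hT : 0 < T) (hb : Bornology.IsBounded Ω)
    {R : ℝ → Fin d → Fin d → SignedMeasure (Sp d)} (hR : IsReynoldsDefect Ω T R) {w : Triple d}
    (hu : IsC1Closed Ω T w.u) : IntegrableOn (termReynolds w Ω T R) (Ioo 0 T) := by
  have hK := hb.isCompact_closure
  obtain ⟨C, hC⟩ := hR.bounded
  choose g hg using hu.exists_continuousMap_closedGrad hT hb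
  have hint : IntegrableOn (fun t => ∑ i, ∑ j, ∫ᵛ x in closure Ω, g i j (t, x) ∂•(R t i j))
      (Ioo 0 T) :=
    integrable_finsetSum _ fun i _ => integrable_finsetSum _ fun j _ =>
      integrableOn_integral_signedMeasure hK (hC.mono fun t ht => ht i j)
        (fun φ => hR.meas φ i j) (g i j)
  refine IntegrableOn.congr_fun hint (fun t ht => ?_) measurableSet_Ioo
  simp only [termReynolds, pairing]
  refine Finset.sum_congr rfl fun i _ => Finset.sum_congr rfl fun j _ => ?_
  refine VectorMeasure.integral_congr_ae (ae_restrict_variation hK.measurableSet fun x hx => ?_)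
  exact (hg i j (t, x) ⟨⟨ht.1.le, ht.2.le⟩, hx⟩).symm

end Reynolds

/-! ### Averages with respect to parametrized measures -/

/-- `g` is integrable with mean value `I`. -/
structure HasMean {Y F : Type*} [MeasurableSpace Y] [NormedAddCommGroup F] [NormedSpace ℝ F]
    (μ : Measure Y) (g : Y → F) (I : F) : Prop where
  integrable : Integrable g μ
  eq : ∫ y, g y ∂μ = I

namespace HasMean

variable {Y F : Type*} [MeasurableSpace Y] [NormedAddCommGroup F] [NormedSpace ℝ F]
  {μ : Measure Y}

lemma of_integrable {g : Y → F} (h : Integrable g μ) : HasMean μ g (∫ y, g y ∂μ) := ⟨h, rfl⟩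

lemma add {f g : Y → F} {I J : F} (hf : HasMean μ f I) (hg : HasMean μ g J) :
    HasMean μ (fun y => f y + g y) (I + J) :=
  ⟨hf.1.add hg.1, by rw [integral_add hf.1 hg.1, hf.2, hg.2]⟩

lemma sub {f g : Y → F} {I J : F} (hf : HasMean μ f I) (hg : HasMean μ g J) :
    HasMean μ (fun y => f y - g y) (I - J) :=
  ⟨hf.1.sub hg.1, by rw [integral_sub hf.1 hg.1, hf.2, hg.2]⟩

lemma const_smul {f : Y → F} {I : F} (hf : HasMean μ f I) (k : ℝ) :
    HasMean μ (fun y => k • f y) (k • I) :=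
  ⟨hf.1.smul k, by rw [integral_smul, hf.2]⟩

lemma const_mul {f : Y → ℝ} {I : ℝ} (hf : HasMean μ f I) (k : ℝ) :
    HasMean μ (fun y => k * f y) (k * I) := hf.const_smul k

lemma smul_const [CompleteSpace F] {f : Y → ℝ} {I : ℝ} (hf : HasMean μ f I) (v : F) :
    HasMean μ (fun y => f y • v) (I • v) :=
  ⟨hf.1.smul_const v, by rw [integral_smul_const, hf.2]⟩

lemma const [IsProbabilityMeasure μ] [CompleteSpace F] (v : F) : HasMean μ (fun _ : Y => v) v :=
  ⟨integrable_const v, by simp⟩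

lemma sum {ι : Type*} {s : Finset ι} {f : ι → Y → F} {I : ι → F}
    (h : ∀ i ∈ s, HasMean μ (f i) (I i)) : HasMean μ (fun y => ∑ i ∈ s, f i y) (∑ i ∈ s, I i) :=
  ⟨integrable_finsetSum _ fun i hi => (h i hi).1, by
    rw [integral_finsetSum _ fun i hi => (h i hi).1]
    exact Finset.sum_congr rfl fun i hi => (h i hi).2⟩

lemma inner_const {H : Type*} [NormedAddCommGroup H] [InnerProductSpace ℝ H] [CompleteSpace H]
    {f : Y → H} {I : H} (hf : HasMean μ f I) (v : H) :
    HasMean μ (fun y => inner ℝ v (f y)) (inner ℝ v I) :=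
  ⟨hf.1.const_inner v, by rw [integral_inner hf.1, hf.2]⟩

lemma congr {f g : Y → F} {I J : F} (hf : HasMean μ f I) (h : ∀ᵐ y ∂μ, g y = f y) (hIJ : I = J) :
    HasMean μ g J :=
  ⟨hf.1.congr (h.mono fun _ hy => hy.symm), by rw [integral_congr_ae h, hf.2, hIJ]⟩

end HasMean

section Kernel

variable {X Y F : Type*} [MeasurableSpace X] [MeasurableSpace Y] [Nonempty Y]
  [NormedAddCommGroup F] [NormedSpace ℝ F] {ν : Measure X}

/-- After modification on a null set the family is a Markov kernel, and integrals against kernels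
depend measurably on the parameter. The Dirac mass shows that the class of admissible replacement
values is nonempty. -/
lemma aestronglyMeasurable_integral_probabilityMeasure {m : X → ProbabilityMeasure Y}
    (hm : AEMeasurable (fun x => (m x : Measure Y)) ν) {g : Y → F} (hg : StronglyMeasurable g) :
    AEStronglyMeasurable (fun x => ∫ y, g y ∂(m x : Measure Y)) ν := by
  obtain ⟨y₀⟩ := ‹Nonempty Y›
  obtain ⟨κ, hκ, hr, he⟩ := hm.exists_ae_eq_range_subset (t := {μ | IsProbabilityMeasure μ})
    (Eventually.of_forall fun x => (m x).2) ⟨Measure.dirac y₀, Measure.dirac.isProbabilityMeasure⟩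
  let K : ProbabilityTheory.Kernel X Y := ⟨κ, hκ⟩
  have : ProbabilityTheory.IsMarkovKernel K := ⟨fun x => hr (mem_range_self x)⟩
  refine ⟨fun x => ∫ y, g y ∂(K x), hg.integral_kernel, ?_⟩
  filter_upwards [he] with x hx
  rw [hx]; rfl

end Kernel

/-! ### Products of integrable and bounded functions -/

section Bounded

variable {X : Type*} [MeasurableSpace X] {ν : Measure X} {d : ℕ}

lemma _root_.MeasureTheory.Integrable.mul_memLp_top {f g : X → ℝ} (hf : Integrable f ν)
    (hg : MemLp g ⊤ ν) : Integrable (fun x => f x * g x) ν := hf.mul_of_top_left hg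

lemma _root_.MeasureTheory.Integrable.inner_memLp_top {f g : X → Sp d} (hf : Integrable f ν)
    (hg : MemLp g ⊤ ν) : Integrable (fun x => inner ℝ (f x) (g x)) ν := by
  have h1 := hf.norm.mul_memLp_top hg.norm
  refine h1.mono (hf.aestronglyMeasurable.inner hg.aestronglyMeasurable)
    (Eventually.of_forall fun x => ?_)
  rw [norm_mul, norm_norm, norm_norm]
  exact norm_inner_le_norm _ _

lemma _root_.MeasureTheory.Integrable.smul_memLp_top {f : X → ℝ} {g : X → Sp d}
    (hf : Integrable f ν) (hg : MemLp g ⊤ ν) : Integrable (fun x => f x • g x) ν := by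
  have h1 := hf.norm.mul_memLp_top hg.norm
  refine h1.mono (hf.aestronglyMeasurable.smul hg.aestronglyMeasurable)
    (Eventually.of_forall fun x => ?_)
  rw [norm_mul, norm_norm, norm_norm, norm_smul]

lemma _root_.MeasureTheory.Integrable.memLp_top_smul {f : X → Sp d} {g : X → ℝ}
    (hf : Integrable f ν) (hg : MemLp g ⊤ ν) : Integrable (fun x => g x • f x) ν := by
  have h1 := hf.norm.mul_memLp_top hg.norm
  refine h1.mono (hg.aestronglyMeasurable.smul hf.aestronglyMeasurable)
    (Eventually.of_forall fun x => ?_)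
  rw [norm_mul, norm_norm, norm_norm, norm_smul, mul_comm]

lemma _root_.MeasureTheory.Integrable.coord {f : X → Sp d} (hf : Integrable f ν) (i : Fin d) :
    Integrable (fun x => f x i) ν :=
  (EuclideanSpace.proj i : Sp d →L[ℝ] ℝ).integrable_comp hf

/-- A function that is bounded in time with values in `L¹` may be multiplied with a function that is
square integrable in time and bounded in space. -/
lemma integrable_mul_of_time_bound {Y : Type*} [MeasurableSpace Y] {α : Measure X} {β : Measure Y}
    [IsFiniteMeasure α] [SFinite β] {f g : X × Y → ℝ} {C : ℝ≥0∞} (hC : C ≠ ⊤)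
    (hf : AEStronglyMeasurable f (α.prod β)) (hfC : ∀ᵐ t ∂α, ∫⁻ x, ‖f (t, x)‖ₑ ∂β ≤ C)
    (hg : AEStronglyMeasurable g (α.prod β)) {h : X → ℝ} (hh : MemLp h 2 α)
    (hgh : ∀ᵐ t ∂α, ∀ᵐ x ∂β, ‖g (t, x)‖ ≤ h t) :
    Integrable (fun z => f z * g z) (α.prod β) := by
  have hh1 : Integrable h α := hh.integrable (by norm_num)
  refine ⟨hf.mul hg, ?_⟩
  rw [hasFiniteIntegral_iff_enorm, lintegral_prod (fun z => ‖f z * g z‖ₑ) (hf.mul hg).enorm]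
  have hle : ∀ᵐ t ∂α, ∫⁻ x, ‖f (t, x) * g (t, x)‖ₑ ∂β ≤ C * ‖h t‖ₑ := by
    filter_upwards [hfC, hgh] with t h1 h2
    have h3 : ∫⁻ x, ‖f (t, x) * g (t, x)‖ₑ ∂β ≤ ∫⁻ x, ‖f (t, x)‖ₑ * ‖h t‖ₑ ∂β := by
      refine lintegral_mono_ae ?_
      filter_upwards [h2] with x hx
      rw [enorm_mul]
      gcongr
      exact enorm_le_iff_norm_le.2 (hx.trans (le_abs_self _))
    refine h3.trans ?_
    rw [lintegral_mul_const' _ _ enorm_ne_top]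
    gcongr
  refine (lintegral_mono_ae hle).trans_lt ?_
  rw [lintegral_const_mul' _ _ hC]
  exact ENNReal.mul_lt_top hC.lt_top hh1.2

end Bounded

/-! ### Bounds by the energy -/

section EnergyBound

variable {d : ℕ}

/-- For θ ≥ 1, log θ = 2 log √θ ≤ 2√θ gives the factor 4. For c_⋆ ≤ θ ≤ 1 the square is at most log²
c_⋆, and θ/c_⋆ ≥ 1. -/
lemma log_sq_le {cs θ : ℝ} (hcs : 0 < cs) (hθ : cs ≤ θ) :
    Real.log θ ^ 2 ≤ (4 + Real.log cs ^ 2 / cs) * θ := by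
  have hθ0 : 0 < θ := hcs.trans_le hθ
  have hk : 0 ≤ Real.log cs ^ 2 / cs := by positivity
  rcases le_total 1 θ with h | h
  · have h1 : Real.log θ ≤ 2 * Real.sqrt θ := by
      have := Real.log_le_self (Real.sqrt_nonneg θ)
      rw [Real.log_sqrt hθ0.le] at this
      linarith
    have h2 := pow_le_pow_left₀ (Real.log_nonneg h) h1 2
    rw [mul_pow, Real.sq_sqrt hθ0.le] at h2
    nlinarith
  · have h1 : Real.log cs ≤ Real.log θ := Real.log_le_log hcs hθ
    have h2 : Real.log θ ≤ 0 := Real.log_nonpos hθ0.le h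
    have h3 : Real.log θ ^ 2 ≤ Real.log cs ^ 2 := by nlinarith
    have h4 : Real.log cs ^ 2 ≤ Real.log cs ^ 2 / cs * θ := by
      rw [div_mul_eq_mul_div, le_div_iff₀ hcs]
      exact mul_le_mul_of_nonneg_left hθ (sq_nonneg _)
    nlinarith

lemma energyDensity_nonneg {c : Coeffs} (ha : 0 < c.a) (hγ : 1 < c.gamma) {y : Phase d}
    (h1 : 0 ≤ y.1) (h2 : 0 < y.2.1) : 0 ≤ energyDensity c y := by
  have hg : 0 < c.gamma - 1 := by linarith
  have : 0 ≤ (y.1 * y.2.1) ^ c.gamma := Real.rpow_nonneg (mul_nonneg h1 h2.le) _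
  rw [energyDensity, pot]; positivity

/-- The quantities that are averaged in the weak formulation are controlled by the energy. -/
lemma exists_energy_bound (d : ℕ) {c : Coeffs} (ha : 0 < c.a) (hγ : 1 < c.gamma) {cs : ℝ}
    (hcs : 0 < cs) :
    ∃ K, 0 ≤ K ∧ ∀ y : Phase d, 0 ≤ y.1 → cs ≤ y.2.1 →
      y.1 * (1 + ‖y.2.2‖ ^ 2 + Real.log y.2.1 ^ 2) + y.1 * y.2.1 + pressure c (y.1 * y.2.1)
        ≤ K * (1 + energyDensity c y) := by
  have hg : 0 < c.gamma - 1 := by linarith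
  set k : ℝ := 4 + Real.log cs ^ 2 / cs with hk
  have hk0 : 0 ≤ k := by positivity
  -- With z = ϱ̃θ̃, the three summands of b bound ϱ̃ ≤ z/c_⋆, ϱ̃ log² θ̃ ≤ kz and z itself. Then z ≤
  -- 1 + z^γ, and z^γ is at most (γ-1)/a times the energy.
  set b : ℝ := cs⁻¹ + k + 1 with hb
  have hb0 : 0 ≤ b := by positivity
  refine ⟨b + 2 + (c.gamma - 1) + b * ((c.gamma - 1) / c.a), by positivity, fun y h1 h2 => ?_⟩
  have h20 : 0 < y.2.1 := hcs.trans_le h2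
  set z : ℝ := y.1 * y.2.1 with hz
  have hz0 : 0 ≤ z := mul_nonneg h1 h20.le
  set Z : ℝ := z ^ c.gamma with hZ
  have hZ0 : 0 ≤ Z := Real.rpow_nonneg hz0 _
  have hzZ : z ≤ 1 + Z := by
    rcases le_total z 1 with h | h
    · linarith
    · have := Real.self_le_rpow_of_one_le h hγ.le
      linarith
  have e1 : y.1 ≤ cs⁻¹ * z := by
    rw [hz, ← div_eq_inv_mul, le_div_iff₀ hcs]
    exact mul_le_mul_of_nonneg_left h2 h1
  have e2 : y.1 * Real.log y.2.1 ^ 2 ≤ k * z := by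
    have := mul_le_mul_of_nonneg_left (log_sq_le hcs h2) h1
    rw [hz, hk]; linarith
  have e3 : y.1 * ‖y.2.2‖ ^ 2 + 2 * (c.a / (c.gamma - 1) * Z) = 2 * energyDensity c y := by
    rw [energyDensity, pot]; ring
  have hkin : 0 ≤ y.1 * ‖y.2.2‖ ^ 2 := by positivity
  have hpot : 0 ≤ c.a / (c.gamma - 1) * Z := by positivity
  set e : ℝ := energyDensity c y with he
  have he0 : 0 ≤ e := by linarith
  have e4 : pressure c z ≤ (c.gamma - 1) * e := by
    have : pressure c z = (c.gamma - 1) * (c.a / (c.gamma - 1) * Z) := by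
      rw [pressure, ← hZ]; field_simp
    rw [this]
    exact mul_le_mul_of_nonneg_left (by linarith) hg.le
  have e5 : Z ≤ (c.gamma - 1) / c.a * e := by
    have : Z = (c.gamma - 1) / c.a * (c.a / (c.gamma - 1) * Z) := by field_simp
    rw [this]
    exact mul_le_mul_of_nonneg_left (by linarith) (by positivity)
  have e6 : b * z ≤ b * (1 + (c.gamma - 1) / c.a * e) :=
    mul_le_mul_of_nonneg_left (by linarith) hb0
  have e7 : (cs⁻¹ + k + 1) * z = cs⁻¹ * z + k * z + z := by ring
  have e8 : 0 ≤ b * e := mul_nonneg hb0 he0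
  have e9 : 0 ≤ b * ((c.gamma - 1) / c.a) := by positivity
  have e10 : y.1 * (1 + ‖y.2.2‖ ^ 2 + Real.log y.2.1 ^ 2)
      = y.1 + y.1 * ‖y.2.2‖ ^ 2 + y.1 * Real.log y.2.1 ^ 2 := by ring
  rw [e10]
  rw [← hb] at e7
  have e11 : (b + 2 + (c.gamma - 1) + b * ((c.gamma - 1) / c.a)) * (1 + e)
    = b + 2 + (c.gamma - 1) + b * ((c.gamma - 1) / c.a) + b * e + 2 * e + (c.gamma - 1) * e
      + b * ((c.gamma - 1) / c.a * e) := by ring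
  rw [e11]
  have e12 : b * (1 + (c.gamma - 1) / c.a * e) = b + b * ((c.gamma - 1) / c.a * e) := by ring
  linarith

end EnergyBound

/-! ### Moments of a dissipative measure-valued solution -/

/-! ### The viscous stress as a bilinear form -/

section Stress

variable {d : ℕ}

/-- In this form the viscous pairing is a sum of products of single entries, so integrability and
integration by parts can be carried out entry by entry. -/
lemma frob_stress (c : Coeffs) (A B : Mat d) :
    frob (stress c A) B = c.mu * ((∑ i, ∑ j, A i j * B i j) + ∑ i, ∑ j, A j i * B i j)
      + (c.lam - c.mu * (2 / (d : ℝ))) * ((∑ i, A i i) * ∑ j, B j j) := by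
  have h1 : ∀ i j, stress c A i j * B i j = c.mu * (A i j * B i j) + c.mu * (A j i * B i j)
      + (c.lam - c.mu * (2 / (d : ℝ))) * A.trace * ((1 : Mat d) i j * B i j) := by
    intro i j
    simp only [stress, Matrix.add_apply, Matrix.smul_apply, Matrix.sub_apply,
      Matrix.transpose_apply, smul_eq_mul]
    ring
  have h2 : ∑ i, ∑ j, (1 : Mat d) i j * B i j = ∑ j, B j j := by
    refine Finset.sum_congr rfl fun i _ => ?_
    simp [Matrix.one_apply]
  simp only [frob, h1, Finset.sum_add_distrib, ← Finset.mul_sum, h2]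
  simp only [Matrix.trace, Matrix.diag_apply]
  ring

lemma stress_sub (c : Coeffs) (A B : Mat d) : stress c (A - B) = stress c A - stress c B := by
  ext i j
  simp only [stress, Matrix.add_apply, Matrix.smul_apply, Matrix.sub_apply,
      Matrix.transpose_apply, smul_eq_mul, Matrix.trace_sub]
  ring

lemma frob_sub_left (A B C : Mat d) : frob (A - B) C = frob A C - frob B C := by
  simp [frob, sub_mul, Finset.sum_sub_distrib]

lemma frob_sub_right (A B C : Mat d) : frob A (B - C) = frob A B - frob A C := by
  simp [frob, mul_sub, Finset.sum_sub_distrib]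

lemma integrable_frob_stress {X : Type*} [MeasurableSpace X] {ν : Measure X} (c : Coeffs)
    {A B : X → Mat d} (hA : ∀ i j, MemLp (fun x => A x i j) 2 ν)
    (hB : ∀ i j, MemLp (fun x => B x i j) 2 ν) :
    Integrable (fun x => frob (stress c (A x)) (B x)) ν := by
  simp only [frob_stress, Finset.sum_mul_sum]
  refine Integrable.add (Integrable.const_mul (Integrable.add ?_ ?_) _) (Integrable.const_mul ?_ _)
  all_goals
    refine integrable_finsetSum _ fun i _ => integrable_finsetSum _ fun j _ => ?_
    exact (hA _ _).integrable_mul (hB _ _)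

end Stress

/-! ### Moments controlled by the energy -/

section Moments

variable {d : ℕ} {c : Coeffs} {Ω : Set (Sp d)} {T : ℝ}
  {V : ℝ → Sp d → ProbabilityMeasure (Phase d)}

/-- Integrability of the moments that occur in the balance laws, and boundedness in time of the
spatial `L¹` norms of mean density and momentum. -/
structure MomentBounds (c : Coeffs) (Ω : Set (Sp d)) (T : ℝ)
    (V : ℝ → Sp d → ProbabilityMeasure (Phase d)) : Prop where
  supp : ∀ᵐ q ∂(volume.restrict (slab Ω T)),
    ∀ᵐ y ∂(V q.1 q.2 : Measure (Phase d)), 0 ≤ y.1 ∧ 0 < y.2.1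
  phase_density : PhaseIntegrable Ω T V fun _ _ y => y.1
  phase_momentum : PhaseIntegrable Ω T V fun _ _ y => y.1 • y.2.2
  phase_log : PhaseIntegrable Ω T V fun _ _ y => y.1 * Real.log y.2.1
  phase_logFlux : PhaseIntegrable Ω T V fun _ _ y => (y.1 * Real.log y.2.1) • y.2.2
  phase_momFlux : ∀ i j, PhaseIntegrable Ω T V fun _ _ y => momFlux c i j y
  phase_pressure : PhaseIntegrable Ω T V fun _ _ y => pressure c (y.1 * y.2.1)
  density : IntegrableOn (fun q : ℝ × Sp d => avg V (fun y => y.1) q.1 q.2) (slab Ω T)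
  momentum : IntegrableOn (fun q : ℝ × Sp d => avg V (fun y => y.1 • y.2.2) q.1 q.2) (slab Ω T)
  log : IntegrableOn (fun q : ℝ × Sp d => avg V (fun y => y.1 * Real.log y.2.1) q.1 q.2) (slab Ω T)
  logFlux : IntegrableOn
    (fun q : ℝ × Sp d => avg V (fun y => (y.1 * Real.log y.2.1) • y.2.2) q.1 q.2) (slab Ω T)
  momFlux : ∀ i j, IntegrableOn (fun q : ℝ × Sp d => avg V (momFlux c i j) q.1 q.2) (slab Ω T)
  pressure : IntegrableOn
    (fun q : ℝ × Sp d => avg V (fun y => pressure c (y.1 * y.2.1)) q.1 q.2) (slab Ω T)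
  density_time : ∃ C : ℝ≥0∞, C ≠ ⊤ ∧ ∀ᵐ t ∂(volume.restrict (Ioo 0 T)),
    ∫⁻ x in Ω, ‖avg V (fun y => y.1) t x‖ₑ ≤ C
  momentum_time : ∃ C : ℝ≥0∞, C ≠ ⊤ ∧ ∀ᵐ t ∂(volume.restrict (Ioo 0 T)),
    ∫⁻ x in Ω, ‖avg V (fun y => y.1 • y.2.2) t x‖ₑ ≤ C

lemma volume_Ω_finite (hb : Bornology.IsBounded Ω) : IsFiniteMeasure (volume.restrict Ω) :=
  ⟨by simpa using hb.measure_lt_top⟩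

lemma volume_slab_finite (hb : Bornology.IsBounded Ω) (T : ℝ) :
    IsFiniteMeasure ((volume : Measure (ℝ × Sp d)).restrict (slab Ω T)) :=
  ⟨by simpa using volume_slab_lt_top hb T⟩

/-- Functions on the phase space that are controlled by the energy have integrable moments. -/
lemma moment_of_le {F : Type*} [NormedAddCommGroup F] [NormedSpace ℝ F]
    (hb : Bornology.IsBounded Ω)
    (hmeas : AEMeasurable (fun q : ℝ × Sp d => (V q.1 q.2 : Measure (Phase d)))
      (volume.restrict (slab Ω T))) {cs : ℝ}
    (hsupp : ∀ᵐ q ∂(volume.restrict (slab Ω T)), ∀ᵐ y ∂(V q.1 q.2 : Measure (Phase d)),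
      0 ≤ y.1 ∧ cs ≤ y.2.1)
    (hphase : PhaseIntegrable Ω T V fun _ _ y => energyDensity c y)
    (hint : IntegrableOn (fun q : ℝ × Sp d => avg V (energyDensity c) q.1 q.2) (slab Ω T))
    {C : ℝ≥0∞} (hC : C ≠ ⊤) (htime : ∀ᵐ t ∂(volume.restrict (Ioo 0 T)),
      ∫⁻ x in Ω, ‖avg V (energyDensity c) t x‖ₑ ≤ C)
    {K : ℝ} (hK : 0 ≤ K) {g : Phase d → F} (hg : StronglyMeasurable g)
    (hle : ∀ y, 0 ≤ y.1 → cs ≤ y.2.1 → ‖g y‖ ≤ K * (1 + energyDensity c y)) :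
    PhaseIntegrable Ω T V (fun _ _ y => g y) ∧
    IntegrableOn (fun q : ℝ × Sp d => avg V g q.1 q.2) (slab Ω T) ∧
    ∃ C' : ℝ≥0∞, C' ≠ ⊤ ∧ ∀ᵐ t ∂(volume.restrict (Ioo 0 T)), ∫⁻ x in Ω, ‖avg V g t x‖ₑ ≤ C' := by
  have := volume_slab_finite hb T
  have := volume_Ω_finite hb
  have hpt : ∀ᵐ q ∂(volume.restrict (slab Ω T)), Integrable g (V q.1 q.2 : Measure (Phase d)) ∧
      ‖avg V g q.1 q.2‖ ≤ K * (1 + avg V (energyDensity c) q.1 q.2) := by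
    filter_upwards [hsupp, hphase] with q h1 h2
    have hdom : Integrable (fun y => K * (1 + energyDensity c y)) (V q.1 q.2 : Measure (Phase d)) :=
      ((integrable_const _).add h2).const_mul K
    have hae : ∀ᵐ y ∂(V q.1 q.2 : Measure (Phase d)), ‖g y‖ ≤ K * (1 + energyDensity c y) :=
      h1.mono fun y hy => hle y hy.1 hy.2
    refine ⟨hdom.mono' hg.aestronglyMeasurable hae, ?_⟩
    refine (norm_integral_le_of_norm_le hdom hae).trans (le_of_eq ?_)
    rw [integral_const_mul, integral_add (integrable_const _) h2]
    simp [avg]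
  refine ⟨hpt.mono fun q hq => hq.1, ?_, ?_⟩
  · refine (((integrable_const (1 : ℝ)).add hint).const_mul K).mono'
      (aestronglyMeasurable_integral_probabilityMeasure hmeas hg) (hpt.mono fun q hq => hq.2)
  · refine ⟨ENNReal.ofReal K * (volume Ω + C), ?_, ?_⟩
    · exact ENNReal.mul_ne_top ENNReal.ofReal_ne_top
        (ENNReal.add_ne_top.2 ⟨hb.measure_lt_top.ne, hC⟩)
    · rw [volume_restrict_slab] at hpt
      filter_upwards [Measure.ae_ae_of_ae_prod hpt, htime] with t h1 h2
      calc ∫⁻ x in Ω, ‖avg V g t x‖ₑ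
          ≤ ∫⁻ x in Ω, ENNReal.ofReal K * (1 + ‖avg V (energyDensity c) t x‖ₑ) := by
            refine lintegral_mono_ae ?_
            filter_upwards [h1] with x hx
            have h3 : ‖avg V g t x‖ ≤ K * (1 + ‖avg V (energyDensity c) t x‖) :=
              hx.2.trans (mul_le_mul_of_nonneg_left (by gcongr; exact Real.le_norm_self _) hK)
            rw [← ofReal_norm, ← ofReal_norm, ← ENNReal.ofReal_one,
              ← ENNReal.ofReal_add zero_le_one (norm_nonneg _), ← ENNReal.ofReal_mul hK]
            exact ENNReal.ofReal_le_ofReal h3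
        _ = ENNReal.ofReal K * (volume Ω + ∫⁻ x in Ω, ‖avg V (energyDensity c) t x‖ₑ) := by
            rw [lintegral_const_mul' _ _ ENNReal.ofReal_ne_top,
              lintegral_add_left measurable_const]
            simp
        _ ≤ ENNReal.ofReal K * (volume Ω + C) := by gcongr

/-- In the energy inequality the defects are nonnegative and can be dropped. The viscous integral up
to time t is bounded by the integral of its absolute value over the whole cylinder, so its sign
plays no role. -/
lemma IsDMVSolution.energy_time {ρ₀ θ₀ : Sp d → ℝ} {u₀ : Sp d → Sp d} {G : ℝ → Sp d → Mat d}
    {E : ℝ → Measure (Sp d)} {D : Measure (ℝ × Sp d)}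
    {R : ℝ → Fin d → Fin d → SignedMeasure (Sp d)} (ha : 0 < c.a) (hγ : 1 < c.gamma)
    (hV : IsDMVSolution c Ω T ρ₀ θ₀ u₀ V G E D R) :
    ∃ C : ℝ≥0∞, C ≠ ⊤ ∧ ∀ᵐ t ∂(volume.restrict (Ioo 0 T)),
      ∫⁻ x in Ω, ‖avg V (energyDensity c) t x‖ₑ ≤ C := by
  obtain ⟨cs, hcs, hsupp, -⟩ := hV.support
  have hS := integrable_frob_stress c hV.vel_mem.2.1 hV.vel_mem.2.1
  have hnn : ∀ᵐ q ∂(volume.restrict (slab Ω T)), 0 ≤ avg V (energyDensity c) q.1 q.2 := by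
    filter_upwards [hsupp] with q hq
    exact integral_nonneg_of_ae (hq.mono fun y hy =>
      energyDensity_nonneg ha hγ hy.1 (hcs.trans_le hy.2))
  have hint := hV.energy_integrable
  rw [IntegrableOn, volume_restrict_slab] at hint
  rw [volume_restrict_slab] at hnn
  set E₀ : ℝ := ∫ x in Ω, energyDensity c (ρ₀ x, θ₀ x, u₀ x)
  set S₀ : ℝ := ∫ q in slab Ω T, |frob (stress c (G q.1 q.2)) (G q.1 q.2)|
  refine ⟨ENNReal.ofReal (E₀ + S₀), ENNReal.ofReal_ne_top, ?_⟩
  filter_upwards [hV.energy_ineq, hint.prod_right_ae, Measure.ae_ae_of_ae_prod hnn,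
    ae_restrict_mem measurableSet_Ioo] with t h1 h2 h3 h4
  have hSt : |∫ q in slab Ω t, frob (stress c (G q.1 q.2)) (G q.1 q.2)| ≤ S₀ := by
    refine (abs_integral_le_integral_abs).trans ?_
    exact setIntegral_mono_set hS.abs (Eventually.of_forall fun _ => abs_nonneg _)
      (slab_mono Ω h4.2.le).eventuallyLE
  have h5 : ∫ x in Ω, avg V (energyDensity c) t x ≤ E₀ + S₀ := by
    have := neg_le_of_abs_le hSt
    have e1 : 0 ≤ (E t).real (closure Ω) := measureReal_nonneg
    have e2 : 0 ≤ D.real (closedSlab Ω t) := measureReal_nonneg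
    linarith
  have h6 : ∫⁻ x in Ω, ‖avg V (energyDensity c) t x‖ₑ
      = ENNReal.ofReal (∫ x in Ω, avg V (energyDensity c) t x) := by
    rw [ofReal_integral_eq_lintegral_ofReal h2 h3]
    refine lintegral_congr_ae ?_
    filter_upwards [h3] with x hx
    exact Real.enorm_of_nonneg hx
  rw [h6]
  exact ENNReal.ofReal_le_ofReal h5

/-- Because θ̃ ≥ c_⋆, the energy controls ϱ̃, ϱ̃|ũ|², ϱ̃ log² θ̃ and the pressure; every other
moment listed is a product estimated by two of these. -/
lemma IsDMVSolution.momentBounds {ρ₀ θ₀ : Sp d → ℝ} {u₀ : Sp d → Sp d} {G : ℝ → Sp d → Mat d}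
    {E : ℝ → Measure (Sp d)} {D : Measure (ℝ × Sp d)}
    {R : ℝ → Fin d → Fin d → SignedMeasure (Sp d)} (ha : 0 < c.a) (hγ : 1 < c.gamma)
    (hb : Bornology.IsBounded Ω)
    (hV : IsDMVSolution c Ω T ρ₀ θ₀ u₀ V G E D R) : MomentBounds c Ω T V := by
  obtain ⟨cs, hcs, hsupp, -⟩ := hV.support
  obtain ⟨C, hC, htime⟩ := hV.energy_time ha hγ
  obtain ⟨K, hK, hKle⟩ := exists_energy_bound d ha hγ hcs
  have hp : ∀ y : Phase d, 0 ≤ y.1 → cs ≤ y.2.1 → 0 ≤ pressure c (y.1 * y.2.1) := by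
    intro y h1 h2
    exact mul_nonneg ha.le (Real.rpow_nonneg (mul_nonneg h1 (hcs.le.trans h2)) _)
  have hbd : ∀ y : Phase d, 0 ≤ y.1 → cs ≤ y.2.1 →
      y.1 ≤ K * (1 + energyDensity c y) ∧ y.1 * ‖y.2.2‖ ≤ K * (1 + energyDensity c y) ∧
      y.1 * |Real.log y.2.1| ≤ K * (1 + energyDensity c y) ∧
      y.1 * |Real.log y.2.1| * ‖y.2.2‖ ≤ K * (1 + energyDensity c y) ∧
      y.1 * ‖y.2.2‖ ^ 2 + pressure c (y.1 * y.2.1) ≤ K * (1 + energyDensity c y) := by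
    intro y h1 h2
    have h := hKle y h1 h2
    have hpr := hp y h1 h2
    have hz : 0 ≤ y.1 * y.2.1 := mul_nonneg h1 (hcs.le.trans h2)
    rw [← sq_abs (Real.log y.2.1)] at h
    have n1 := norm_nonneg y.2.2
    have n2 := abs_nonneg (Real.log y.2.1)
    have a1 : 0 ≤ y.1 * ‖y.2.2‖ ^ 2 := by positivity
    have a2 : 0 ≤ y.1 * |Real.log y.2.1| ^ 2 := by positivity
    -- Expanding these squares gives the bounds for the mixed moments ϱ̃|ũ|, ϱ̃|log θ̃| and ϱ̃|log
    -- θ̃||ũ|.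
    have a3 : 0 ≤ y.1 * (‖y.2.2‖ - 1) ^ 2 := by positivity
    have a4 : 0 ≤ y.1 * (|Real.log y.2.1| - 1) ^ 2 := by positivity
    have a5 : 0 ≤ y.1 * (|Real.log y.2.1| - ‖y.2.2‖) ^ 2 := by positivity
    have a6 : 0 ≤ y.1 * ‖y.2.2‖ := by positivity
    have a7 : 0 ≤ y.1 * |Real.log y.2.1| := by positivity
    have a8 : 0 ≤ y.1 * |Real.log y.2.1| * ‖y.2.2‖ := by positivity
    refine ⟨?_, ?_, ?_, ?_, ?_⟩ <;> nlinarith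
  have key := fun {F : Type} [NormedAddCommGroup F] [NormedSpace ℝ F] {g : Phase d → F}
    (hg : StronglyMeasurable g)
    (hle : ∀ y, 0 ≤ y.1 → cs ≤ y.2.1 → ‖g y‖ ≤ K * (1 + energyDensity c y)) =>
    moment_of_le hb hV.meas hsupp hV.energy_phase hV.energy_integrable hC htime hK hg hle
  have k1 := key (g := fun y : Phase d => y.1) (by fun_prop) fun y h1 h2 => by
    rw [Real.norm_of_nonneg h1]; exact (hbd y h1 h2).1
  have k2 := key (g := fun y : Phase d => y.1 • y.2.2) (by fun_prop) fun y h1 h2 => by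
    rw [norm_smul, Real.norm_of_nonneg h1]; exact (hbd y h1 h2).2.1
  have k3 := key (g := fun y : Phase d => y.1 * Real.log y.2.1)
    (Measurable.stronglyMeasurable (by fun_prop)) fun y h1 h2 => by
    rw [norm_mul, Real.norm_of_nonneg h1]; exact (hbd y h1 h2).2.2.1
  have k4 := key (g := fun y : Phase d => (y.1 * Real.log y.2.1) • y.2.2)
    (Measurable.stronglyMeasurable (by fun_prop)) fun y h1 h2 => by
    rw [norm_smul, norm_mul, Real.norm_of_nonneg h1]; exact (hbd y h1 h2).2.2.2.1
  have k5 : ∀ i j, _ := fun i j => key (g := fun y : Phase d => NSPT.momFlux c i j y)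
    (Measurable.stronglyMeasurable (by unfold NSPT.momFlux NSPT.pressure; fun_prop))
      fun y h1 h2 => by
    have hpr := hp y h1 h2
    refine le_trans ?_ (hbd y h1 h2).2.2.2.2
    rw [NSPT.momFlux]
    refine (norm_add_le _ _).trans (add_le_add ?_ ?_)
    · rw [norm_mul, norm_mul, Real.norm_of_nonneg h1, mul_assoc, sq]
      refine mul_le_mul_of_nonneg_left ?_ h1
      exact mul_le_mul (abs_apply_le_norm _ _) (abs_apply_le_norm _ _) (norm_nonneg _)
        (norm_nonneg _)
    · rw [norm_mul, Real.norm_of_nonneg hpr]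
      refine mul_le_of_le_one_right hpr ?_
      rcases eq_or_ne i j with rfl | hij <;> simp [*]
  have k6 := key (g := fun y : Phase d => NSPT.pressure c (y.1 * y.2.1))
    (Measurable.stronglyMeasurable (by unfold NSPT.pressure; fun_prop)) fun y h1 h2 => by
    rw [Real.norm_of_nonneg (hp y h1 h2)]
    have := (hbd y h1 h2).2.2.2.2
    have : 0 ≤ y.1 * ‖y.2.2‖ ^ 2 := by positivity
    linarith
  exact
    { supp := hsupp.mono fun q hq => hq.mono fun y hy => ⟨hy.1, hcs.trans_le hy.2⟩
      phase_density := k1.1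
      phase_momentum := k2.1
      phase_log := k3.1
      phase_logFlux := k4.1
      phase_momFlux := fun i j => (k5 i j).1
      phase_pressure := k6.1
      density := k1.2.1
      momentum := k2.2.1
      log := k3.2.1
      logFlux := k4.2.1
      momFlux := fun i j => (k5 i j).2.1
      pressure := k6.2.1
      density_time := k1.2.2
      momentum_time := k2.2.2 }

end Moments

/-! ### Calculus for test triples -/

namespace IsC1Closed

variable {d : ℕ} {Ω : Set (Sp d)} {T : ℝ} {F : Type*} [NormedAddCommGroup F] [NormedSpace ℝ F]

lemma memLp_top [SecondCountableTopology F] (hΩ : IsOpen Ω) (hb : Bornology.IsBounded Ω)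
    {f : ℝ → Sp d → F} (h : IsC1Closed Ω T f) :
    MemLp (fun q : ℝ × Sp d => f q.1 q.2) ⊤ (volume.restrict (slab Ω T)) := by
  obtain ⟨C, hC⟩ := h.exists_bound hb
  exact memLp_top_of_bound (h.aestronglyMeasurable hΩ) C
    (ae_restrict_of_forall_mem (isOpen_slab hΩ T).measurableSet
      fun q hq => hC q (slab_subset_closedSlab Ω T hq))

/-- The direction v may vary with the point, so that time derivatives, coordinate derivatives and
derivatives along u are all covered. -/
lemma memLp_top_stDeriv_apply [SecondCountableTopology F] (hΩ : IsOpen Ω)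
    (hb : Bornology.IsBounded Ω) {f : ℝ → Sp d → F} (h : IsC1Closed Ω T f)
    {v : ℝ × Sp d → ℝ × Sp d} (hv : ContinuousOn v (slab Ω T)) {B : ℝ}
    (hB : ∀ q ∈ slab Ω T, ‖v q‖ ≤ B) :
    MemLp (fun q : ℝ × Sp d => stDeriv f q (v q)) ⊤ (volume.restrict (slab Ω T)) := by
  have hm := (isOpen_slab hΩ T).measurableSet
  obtain ⟨C, hC0, hC⟩ := h.exists_bound_stDeriv hb
  refine memLp_top_of_bound ((h.continuousOn_stDeriv.clm_apply hv).aestronglyMeasurable hm) (C * B)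
    (ae_restrict_of_forall_mem hm fun q hq => ?_)
  exact ((stDeriv f q).le_opNorm _).trans
    (mul_le_mul (hC q hq) (hB q hq) (norm_nonneg _) hC0)

lemma memLp_top_dt [SecondCountableTopology F] (hΩ : IsOpen Ω) (hb : Bornology.IsBounded Ω)
    {f : ℝ → Sp d → F} (h : IsC1Closed Ω T f) :
    MemLp (fun q : ℝ × Sp d => dt f q.1 q.2) ⊤ (volume.restrict (slab Ω T)) := by
  refine (h.memLp_top_stDeriv_apply hΩ hb (v := fun _ => (1, 0)) continuousOn_const
    fun _ _ => le_rfl).ae_eq ?_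
  exact ae_restrict_of_forall_mem (isOpen_slab hΩ T).measurableSet fun q hq => (h.dt_eq hq).symm

lemma memLp_top_gradient (hΩ : IsOpen Ω) (hb : Bornology.IsBounded Ω)
    {f : ℝ → Sp d → ℝ} (h : IsC1Closed Ω T f) :
    MemLp (fun q : ℝ × Sp d => gradient (f q.1) q.2) ⊤ (volume.restrict (slab Ω T)) := by
  have hm := (isOpen_slab hΩ T).measurableSet
  obtain ⟨C, hC0, hC⟩ := h.exists_bound_stDeriv hb
  exact memLp_top_of_bound (h.continuousOn_gradient.aestronglyMeasurable hm) C
    (ae_restrict_of_forall_mem hm fun q hq => h.norm_gradient_le hC0 hC hq)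

lemma memLp_top_fderiv_apply [SecondCountableTopology F] (hΩ : IsOpen Ω)
    (hb : Bornology.IsBounded Ω) {f : ℝ → Sp d → F} (h : IsC1Closed Ω T f) {u : ℝ → Sp d → Sp d}
    (hu : IsC1Closed Ω T u) :
    MemLp (fun q : ℝ × Sp d => fderiv ℝ (f q.1) q.2 (u q.1 q.2)) ⊤
      (volume.restrict (slab Ω T)) := by
  obtain ⟨C, hC⟩ := hu.exists_bound hb
  have hu0 := hu.1.mono (slab_subset_closedSlab Ω T)
  refine (h.memLp_top_stDeriv_apply hΩ hb (v := fun q => (0, u q.1 q.2)) (B := C)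
    (continuousOn_const.prodMk hu0) fun q hq => ?_).ae_eq ?_
  · simpa [Prod.norm_def] using hC q (slab_subset_closedSlab Ω T hq)
  · exact ae_restrict_of_forall_mem (isOpen_slab hΩ T).measurableSet
      fun q hq => (h.fderiv_apply hq _).symm

lemma memLp_top_gradMat (hΩ : IsOpen Ω) (hb : Bornology.IsBounded Ω)
    {u : ℝ → Sp d → Sp d} (hu : IsC1Closed Ω T u) (i j : Fin d) :
    MemLp (fun q : ℝ × Sp d => gradMat (u q.1) q.2 i j) ⊤ (volume.restrict (slab Ω T)) := by
  have h := (hu.memLp_top_stDeriv_apply hΩ hb (v := fun _ => (0, basisVec j)) continuousOn_const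
    fun _ _ => le_rfl).coord i
  refine h.ae_eq (ae_restrict_of_forall_mem (isOpen_slab hΩ T).measurableSet fun q hq => ?_)
  simp only [gradMat, Matrix.of_apply, hu.fderiv_apply hq]

lemma memLp_top_divg (hΩ : IsOpen Ω) (hb : Bornology.IsBounded Ω)
    {u : ℝ → Sp d → Sp d} (hu : IsC1Closed Ω T u) :
    MemLp (fun q : ℝ × Sp d => divg (u q.1) q.2) ⊤ (volume.restrict (slab Ω T)) :=
  memLp_finsetSum Finset.univ fun i _ => hu.memLp_top_gradMat hΩ hb i i

lemma smul {f : ℝ → Sp d → ℝ} {u : ℝ → Sp d → F} (hf : IsC1Closed Ω T f)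
    (hu : IsC1Closed Ω T u) : IsC1Closed Ω T (fun t x => f t x • u t x) :=
  (hf.prodMk hu).comp_contDiff (g := fun z : ℝ × F => z.1 • z.2) (by fun_prop)

end IsC1Closed

/-! ### Coordinate formulas -/

section Coordinates

variable {d : ℕ}

lemma sum_smul_basisVec (a : Sp d) : ∑ j, a j • basisVec j = a := by
  have := (EuclideanSpace.basisFun (Fin d) ℝ).sum_repr a
  simpa using this

lemma clm_apply_eq_sum {F : Type*} [NormedAddCommGroup F] [NormedSpace ℝ F] (L : Sp d →L[ℝ] F)
    (a : Sp d) : L a = ∑ j, a j • L (basisVec j) := by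
  conv_lhs => rw [← sum_smul_basisVec a]
  simp only [map_sum, map_smul]

lemma inner_eq_sum (a b : Sp d) : inner ℝ a b = ∑ i, a i * b i := by
  simp [PiLp.inner_apply, mul_comm]

lemma divg_smul {f : Sp d → ℝ} {u : Sp d → Sp d} {x : Sp d} (hf : DifferentiableAt ℝ f x)
    (hu : DifferentiableAt ℝ u x) :
    divg (fun y => f y • u y) x = fderiv ℝ f x (u x) + f x * divg u x := by
  have h := (hf.hasFDerivAt.smul hu.hasFDerivAt).fderiv
  simp only [divg]
  have h' : fderiv ℝ (fun y => f y • u y) x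
      = f x • fderiv ℝ u x + (fderiv ℝ f x).smulRight (u x) := h
  rw [h', clm_apply_eq_sum (fderiv ℝ f x) (u x), Finset.mul_sum, ← Finset.sum_add_distrib]
  refine Finset.sum_congr rfl fun i _ => ?_
  simp
  ring

end Coordinates

namespace IsTestTriple

variable {d : ℕ} {c : Coeffs} {Ω : Set (Sp d)} {T : ℝ} {w : Triple d}
  {H : ℝ → Sp d → Fin d → Fin d → Fin d → ℝ}

lemma S_C1 (hw : IsTestTriple Ω T w H) (ha : 0 < c.a) (hΩ : IsOpen Ω) :
    IsC1Closed Ω T (w.S c) := by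
  have h : IsC1Closed Ω T (fun t x => w.ρ t x *
      ((Real.log c.a + c.gamma * Real.log (w.θ t x)) / (c.gamma - 1))) := by
    refine hw.ρ_C1.mul (hw.θ_C1.comp (U := {z : ℝ | z ≠ 0}) isOpen_ne
      (g := fun z => (Real.log c.a + c.gamma * Real.log z) / (c.gamma - 1)) ?_
      fun t ht x hx => (hw.θ_pos t ht x hx).ne')
    exact (contDiffOn_const.add (contDiffOn_const.mul
      (contDiffOn_id.log fun z hz => hz))).div_const _
  exact h.congr hΩ fun t ht x hx => entropy_eq ha _ (hw.θ_pos t ht x hx)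

/-- In the variables ϱ and θ the pressure is a(ϱθ)^γ, a smooth function of a product that stays away
from 0. -/
lemma p_C1 (hw : IsTestTriple Ω T w H) (ha : 0 < c.a) (hγ : 1 < c.gamma) (hΩ : IsOpen Ω) :
    IsC1Closed Ω T (w.p c) := by
  have h : IsC1Closed Ω T (fun t x => pressure c (w.ρ t x * w.θ t x)) := by
    refine (hw.ρ_C1.mul hw.θ_C1).comp (U := {z : ℝ | z ≠ 0}) isOpen_ne ?_
      fun t ht x hx => (mul_pos (hw.ρ_pos t ht x hx) (hw.θ_pos t ht x hx)).ne'
    exact contDiffOn_const.mul (contDiffOn_id.rpow_const_of_ne fun z hz => hz)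
  exact h.congr hΩ fun t ht x hx =>
    pressureRS_entropy ha hγ (hw.ρ_pos t ht x hx).le (hw.θ_pos t ht x hx)

lemma temp_eq (hγ : 1 < c.gamma) {t : ℝ} {x : Sp d} (hρ : 0 < w.ρ t x) :
    w.temp c t x = w.p c t x / w.ρ t x := by
  have hg : c.gamma - 1 ≠ 0 := by linarith
  rw [Triple.temp, Triple.p_S, dpdS_eq c hρ, Triple.p]; field_simp

lemma temp_C1 (hw : IsTestTriple Ω T w H) (ha : 0 < c.a) (hγ : 1 < c.gamma) (hΩ : IsOpen Ω) :
    IsC1Closed Ω T (w.temp c) :=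
  ((hw.p_C1 ha hγ hΩ).div hw.ρ_C1 fun t ht x hx => (hw.ρ_pos t ht x hx).ne').congr hΩ
    fun t ht x hx => temp_eq hγ (hw.ρ_pos t ht x hx)

/-- This is the sign that allows ϑ as a test function in the entropy inequality. -/
lemma temp_nonneg (hw : IsTestTriple Ω T w H) (hγ : 1 < c.gamma) {t : ℝ} (ht : t ∈ Icc 0 T)
    {x : Sp d} (hx : x ∈ closure Ω) : 0 ≤ w.temp c t x := by
  have hρ := hw.ρ_pos t ht x hx
  rw [temp_eq hγ hρ]
  exact div_nonneg (pressureRS_pos c hρ _).le hρ.le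

/-- Follows from the factorisation ∂P/∂ϱ = ϑ(γ/(γ-1) - S/ϱ). -/
lemma dPdρ_C1 (hw : IsTestTriple Ω T w H) (ha : 0 < c.a) (hγ : 1 < c.gamma) (hΩ : IsOpen Ω) :
    IsC1Closed Ω T (fun t x => dPdρ c (w.ρ t x) (w.S c t x)) := by
  have h1 := (hw.S_C1 ha hΩ).div hw.ρ_C1 fun t ht x hx => (hw.ρ_pos t ht x hx).ne'
  have h2 := h1.comp_contDiff (g := fun z : ℝ => c.gamma / (c.gamma - 1) - z) (by fun_prop)
  refine ((hw.temp_C1 ha hγ hΩ).mul h2).congr hΩ fun t ht x hx => ?_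
  have hρ := hw.ρ_pos t ht x hx
  rw [dPdρ_eq hγ hρ, temp_eq hγ hρ, Triple.p]

lemma p_ρ_C1 (hw : IsTestTriple Ω T w H) (ha : 0 < c.a) (hγ : 1 < c.gamma) (hΩ : IsOpen Ω) :
    IsC1Closed Ω T (w.p_ρ c) := by
  refine ((hw.dPdρ_C1 ha hγ hΩ).const_mul (c.gamma - 1)).congr hΩ fun t ht x hx => ?_
  have hρ := hw.ρ_pos t ht x hx
  have hg : c.gamma - 1 ≠ 0 := by linarith
  rw [Triple.p_ρ, dpdρ_eq c hρ, dPdρ_eq hγ hρ]; field_simp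

lemma p_S_C1 (hw : IsTestTriple Ω T w H) (ha : 0 < c.a) (hγ : 1 < c.gamma) (hΩ : IsOpen Ω) :
    IsC1Closed Ω T (w.p_S c) := by
  refine ((hw.temp_C1 ha hγ hΩ).const_mul (c.gamma - 1)).congr hΩ fun t ht x hx => ?_
  have hg : c.gamma - 1 ≠ 0 := by linarith
  rw [Triple.temp]; field_simp

/-- The chain rule for `p(ϱ,S)`. -/
lemma stDeriv_p (hw : IsTestTriple Ω T w H) (ha : 0 < c.a) (hΩ : IsOpen Ω) {q : ℝ × Sp d}
    (hq : q ∈ slab Ω T) :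
    stDeriv (w.p c) q = w.p_ρ c q.1 q.2 • stDeriv w.ρ q + w.p_S c q.1 q.2 • stDeriv (w.S c) q := by
  have hq' := slab_subset_closedSlab Ω T hq
  have hρ := hw.ρ_pos q.1 hq'.1 q.2 hq'.2
  have h1 := (hw.ρ_C1.hasFDerivAt hq).prodMk ((hw.S_C1 ha hΩ).hasFDerivAt hq)
  have h2 := HasFDerivAt.comp (g := fun z : ℝ × ℝ => pressureRS c z.1 z.2) q
    (hasFDerivAt_pressureRS c hρ (w.S c q.1 q.2)) h1
  refine h2.fderiv.trans ?_
  ext <;> simp [Triple.p_ρ, Triple.p_S]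

/-- The Gibbs–Duhem relation `ϱ d(∂P/∂ϱ) + S dϑ = dp`. -/
lemma gibbs_duhem (hw : IsTestTriple Ω T w H) (ha : 0 < c.a) (hγ : 1 < c.gamma) (hΩ : IsOpen Ω)
    {q : ℝ × Sp d} (hq : q ∈ slab Ω T) (v : ℝ × Sp d) :
    w.ρ q.1 q.2 * stDeriv (fun t x => dPdρ c (w.ρ t x) (w.S c t x)) q v
      + w.S c q.1 q.2 * stDeriv (w.temp c) q v = stDeriv (w.p c) q v := by
  have hg : c.gamma - 1 ≠ 0 := by linarith
  have hq' := slab_subset_closedSlab Ω T hq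
  have hρ := hw.ρ_pos q.1 hq'.1 q.2 hq'.2
  have hP := (hw.dPdρ_C1 ha hγ hΩ).hasFDerivAt hq
  have ht := (hw.temp_C1 ha hγ hΩ).hasFDerivAt hq
  have hp := (hw.p_C1 ha hγ hΩ).hasFDerivAt hq
  have hr := hw.ρ_C1.hasFDerivAt hq
  have hS := (hw.S_C1 ha hΩ).hasFDerivAt hq
  have h1 := (hr.mul hP).add (hS.mul ht)
  have h2 := hp.const_mul (c.gamma / (c.gamma - 1))
  -- The Legendre identity with P = p/(γ-1) reads ϱ ∂P/∂ϱ + Sϑ = γ/(γ-1) p. Differentiating by the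
  -- product rule and subtracting dP = ∂P/∂ϱ dϱ + ϑ dS leaves the claim.
  have heq : (fun q : ℝ × Sp d => c.gamma / (c.gamma - 1) * w.p c q.1 q.2) =ᶠ[𝓝 q]
      ((fun q : ℝ × Sp d => w.ρ q.1 q.2) * (fun q => dPdρ c (w.ρ q.1 q.2) (w.S c q.1 q.2))
        + (fun q : ℝ × Sp d => w.S c q.1 q.2) * fun q => w.temp c q.1 q.2) := by
    filter_upwards [(isOpen_slab hΩ T).mem_nhds hq] with z hz
    have hz' := slab_subset_closedSlab Ω T hz
    have hρz := hw.ρ_pos z.1 hz'.1 z.2 hz'.2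
    simp only [Pi.add_apply, Pi.mul_apply]
    rw [dPdρ_eq hγ hρz, temp_eq hγ hρz, Triple.p]
    field_simp
    ring
  have h3 := congrArg (fun L : ℝ × Sp d →L[ℝ] ℝ => L v) ((h1.congr_of_eventuallyEq heq).unique h2)
  have h4 := congrArg (fun L : ℝ × Sp d →L[ℝ] ℝ => L v) (hw.stDeriv_p ha hΩ hq)
  simp only [add_apply, smul_apply, smul_eq_mul] at h3 h4
  have e1 : w.p_ρ c q.1 q.2 = (c.gamma - 1) * dPdρ c (w.ρ q.1 q.2) (w.S c q.1 q.2) := by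
    rw [Triple.p_ρ, dpdρ_eq c hρ, dPdρ_eq hγ hρ]; field_simp
  have e2 : w.p_S c q.1 q.2 = (c.gamma - 1) * w.temp c q.1 q.2 := by
    rw [Triple.temp]; field_simp
  rw [e1, e2] at h4
  have e3 : c.gamma / (c.gamma - 1) * stDeriv (w.p c) q v
      = stDeriv (w.p c) q v + 1 / (c.gamma - 1) * stDeriv (w.p c) q v := by
    field_simp; ring
  have e4 : 1 / (c.gamma - 1) * stDeriv (w.p c) q v
      = dPdρ c (w.ρ q.1 q.2) (w.S c q.1 q.2) * stDeriv w.ρ q v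
        + w.temp c q.1 q.2 * stDeriv (w.S c) q v := by
    rw [h4]; field_simp
  rw [e3, e4] at h3
  linarith

end IsTestTriple

/-- The test function `½|u|² - ∂P/∂ϱ - (ln a/(γ-1)) ϑ` for the continuity equation. -/
def densityTest {d : ℕ} (c : Coeffs) (w : Triple d) (t : ℝ) (x : Sp d) : ℝ :=
  1 / 2 * ‖w.u t x‖ ^ 2 - dPdρ c (w.ρ t x) (w.S c t x)
    - w.temp c t x * (Real.log c.a / (c.gamma - 1))

namespace IsTestTriple

variable {d : ℕ} {c : Coeffs} {Ω : Set (Sp d)} {T : ℝ} {w : Triple d}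
  {H : ℝ → Sp d → Fin d → Fin d → Fin d → ℝ}

lemma densityTest_C1 (hw : IsTestTriple Ω T w H) (ha : 0 < c.a) (hγ : 1 < c.gamma)
    (hΩ : IsOpen Ω) : IsC1Closed Ω T (densityTest c w) := by
  have h1 := hw.u_C1.comp_contDiff (g := fun z : Sp d => 1 / 2 * ‖z‖ ^ 2)
    (contDiff_const.mul (contDiff_norm_sq ℝ))
  have h2 := (hw.temp_C1 ha hγ hΩ).comp_contDiff
    (g := fun z : ℝ => z * (Real.log c.a / (c.gamma - 1))) (by fun_prop)
  exact (h1.sub (hw.dPdρ_C1 ha hγ hΩ)).sub h2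

lemma stDeriv_densityTest (hw : IsTestTriple Ω T w H) (ha : 0 < c.a) (hγ : 1 < c.gamma)
    (hΩ : IsOpen Ω) {q : ℝ × Sp d} (hq : q ∈ slab Ω T) (v : ℝ × Sp d) :
    stDeriv (densityTest c w) q v = inner ℝ (w.u q.1 q.2) (stDeriv w.u q v)
      - stDeriv (fun t x => dPdρ c (w.ρ t x) (w.S c t x)) q v
      - stDeriv (w.temp c) q v * (Real.log c.a / (c.gamma - 1)) := by
  have hu := hw.u_C1.hasFDerivAt hq
  have hP := (hw.dPdρ_C1 ha hγ hΩ).hasFDerivAt hq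
  have ht := (hw.temp_C1 ha hγ hΩ).hasFDerivAt hq
  have h := (((hu.norm_sq).const_mul (1 / 2)).sub hP).sub
    (ht.mul_const (Real.log c.a / (c.gamma - 1)))
  have h' : stDeriv (densityTest c w) q = _ := h.fderiv
  rw [h']
  simp
  ring

end IsTestTriple

/-! ### The averaged remainder terms in terms of the moments -/

/-- The mean values, with respect to a measure on the phase space that charges only states with
nonnegative density and positive potential temperature, of density, momentum, `ϱ̃ ln θ̃`,
`ϱ̃ ln(θ̃) ũ`, momentum flux, pressure, velocity and energy. -/
structure StateMeans {d : ℕ} (c : Coeffs) (μ : Measure (Phase d)) (r : ℝ) (m : Sp d) (L : ℝ)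
    (F : Sp d) (K : Mat d) (P : ℝ) (v : Sp d) (e : ℝ) : Prop where
  supp : ∀ᵐ y ∂μ, 0 ≤ y.1 ∧ 0 < y.2.1
  density : HasMean μ (fun y => y.1) r
  momentum : HasMean μ (fun y => y.1 • y.2.2) m
  log : HasMean μ (fun y => y.1 * Real.log y.2.1) L
  logFlux : HasMean μ (fun y => (y.1 * Real.log y.2.1) • y.2.2) F
  momFlux : ∀ i j, HasMean μ (NSPT.momFlux c i j) (K i j)
  pressure : HasMean μ (fun y => NSPT.pressure c (y.1 * y.2.1)) P
  velocity : HasMean μ (fun y => y.2.2) v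
  energy : HasMean μ (energyDensity c) e

lemma HasMean.clm {Y F F' : Type*} [MeasurableSpace Y] [NormedAddCommGroup F] [NormedSpace ℝ F]
    [CompleteSpace F] [NormedAddCommGroup F'] [NormedSpace ℝ F'] [CompleteSpace F'] {μ : Measure Y}
    {f : Y → F} {I : F} (hf : HasMean μ f I) (A : F →L[ℝ] F') :
    HasMean μ (fun y => A (f y)) (A I) :=
  ⟨A.integrable_comp hf.1, by rw [A.integral_comp_comm hf.1, hf.2]⟩

lemma gradMat_eq_frob {d : ℕ} (v : Sp d → Sp d) (x a b : Sp d) :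
    inner ℝ a (fderiv ℝ v x b) = ∑ i, ∑ j, a i * b j * gradMat v x i j := by
  rw [inner_eq_sum]
  refine Finset.sum_congr rfl fun i _ => ?_
  rw [clm_apply_eq_sum (fderiv ℝ v x) b]
  simp only [WithLp.ofLp_sum, Finset.sum_apply, PiLp.smul_apply, smul_eq_mul, Finset.mul_sum, gradMat,
    Matrix.of_apply]
  exact Finset.sum_congr rfl fun j _ => by ring

namespace StateMeans

variable {d : ℕ} {c : Coeffs} {t : ℝ} {x : Sp d} {w : Triple d} {μ : Measure (Phase d)}
  {r : ℝ} {m : Sp d} {L : ℝ} {F : Sp d} {K : Mat d} {P : ℝ} {v : Sp d}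
  {e : ℝ}

lemma entropy_mean (ha : 0 < c.a) (h : StateMeans c μ r m L F K P v e) :
    HasMean μ (fun y => entropy c y.1 y.2.1)
      (Real.log c.a / (c.gamma - 1) * r + c.gamma / (c.gamma - 1) * L) := by
  refine ((h.density.const_mul (Real.log c.a / (c.gamma - 1))).add
    (h.log.const_mul (c.gamma / (c.gamma - 1)))).congr (h.supp.mono fun y hy => ?_) rfl
  rw [entropy_eq ha _ hy.2]; ring

/-- Expanding the quadratic form in ũ - u gives the full momentum flux paired with ∇u. Since
`momFlux` contains the pressure on its diagonal, P div u is subtracted; the other terms are linear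
in momentum and density. -/
lemma conv (h : StateMeans c μ r m L F K P v e) :
    HasMean μ (phiConv w t x) (frob K (gradMat (w.u t) x) - P * divg (w.u t) x
      - inner ℝ m (fderiv ℝ (w.u t) x (w.u t x)) - inner ℝ (w.u t x) (fderiv ℝ (w.u t) x m)
      + r * inner ℝ (w.u t x) (fderiv ℝ (w.u t) x (w.u t x))) := by
  set A := fderiv ℝ (w.u t) x with hA
  have h1 : HasMean μ (fun y => ∑ i, ∑ j, NSPT.momFlux c i j y * gradMat (w.u t) x i j)
      (frob K (gradMat (w.u t) x)) :=
    HasMean.sum fun i _ => HasMean.sum fun j _ =>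
      (h.momFlux i j).smul_const (gradMat (w.u t) x i j)
  have h2 := h.pressure.smul_const (divg (w.u t) x)
  have h3 := h.momentum.inner_const (A (w.u t x))
  have h4 := (h.momentum.clm A).inner_const (w.u t x)
  have h5 := h.density.smul_const (inner ℝ (w.u t x) (A (w.u t x)))
  refine ((((h1.sub h2).sub h3).sub h4).add h5).congr (Eventually.of_forall fun y => ?_) ?_
  · have e1 : ∑ i, ∑ j, NSPT.momFlux c i j y * gradMat (w.u t) x i j
        = y.1 * inner ℝ y.2.2 (A y.2.2)
          + NSPT.pressure c (y.1 * y.2.1) * divg (w.u t) x := by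
      have e2 : ∀ i j, NSPT.momFlux c i j y * gradMat (w.u t) x i j
          = y.1 * (y.2.2 i * y.2.2 j * gradMat (w.u t) x i j)
            + NSPT.pressure c (y.1 * y.2.1) * ((1 : Mat d) i j * gradMat (w.u t) x i j) := by
        intro i j; rw [NSPT.momFlux]; ring
      have e3 : ∑ i, ∑ j, (1 : Mat d) i j * gradMat (w.u t) x i j = divg (w.u t) x := by
        refine Finset.sum_congr rfl fun i _ => ?_
        simp [Matrix.one_apply, gradMat]
      simp only [e2, Finset.sum_add_distrib, ← Finset.mul_sum, e3]
      rw [hA, gradMat_eq_frob]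
    rw [phiConv, e1]
    simp only [map_sub, inner_sub_left, inner_sub_right, map_smul, real_inner_smul_right,
      smul_eq_mul, ← hA]
    rw [real_inner_comm (A (w.u t x)) y.2.2]
    ring
  · rw [real_inner_comm m]; simp only [smul_eq_mul]

lemma press [IsProbabilityMeasure μ] (ha : 0 < c.a) (hγ : 1 < c.gamma)
    (h : StateMeans c μ r m L F K P v e) :
    HasMean μ (phiPress c w t x) (P - w.p_ρ c t x * (r - w.ρ t x)
      - w.p_S c t x * (Real.log c.a / (c.gamma - 1) * r + c.gamma / (c.gamma - 1) * L - w.S c t x)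
      - w.p c t x) := by
  have h1 := (h.density.sub (HasMean.const (w.ρ t x))).const_mul (w.p_ρ c t x)
  have h2 := ((h.entropy_mean ha).sub (HasMean.const (w.S c t x))).const_mul (w.p_S c t x)
  refine (((h.pressure.sub h1).sub h2).sub (HasMean.const (w.p c t x))).congr
    (h.supp.mono fun y hy => ?_) rfl
  rw [phiPress, pressureRS_entropy ha hγ hy.1 hy.2]

lemma mom (h : StateMeans c μ r m L F K P v e) :
    HasMean μ (phiMom w t x) ((1 / w.ρ t x) • (r • w.u t x - m)) := by
  refine (((h.density.smul_const (w.u t x)).sub h.momentum).const_smul (1 / w.ρ t x)).congr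
    (Eventually.of_forall fun y => ?_) rfl
  rw [phiMom, ← smul_sub, smul_smul]; congr 1; ring

lemma mass [IsProbabilityMeasure μ] (h : StateMeans c μ r m L F K P v e) :
    HasMean μ (phiMass c w t x) ((w.ρ t x - r) * (1 / w.ρ t x) * w.p_ρ c t x) :=
  (((HasMean.const (w.ρ t x)).sub h.density).const_mul (1 / w.ρ t x * w.p_ρ c t x)).congr
    (Eventually.of_forall fun y => by rw [phiMass]; ring) (by ring)

lemma ent [IsProbabilityMeasure μ] (h : StateMeans c μ r m L F K P v e) :
    HasMean μ (phiEnt c w t x) ((w.ρ t x - r) * (1 / w.ρ t x) * w.p_S c t x) :=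
  (((HasMean.const (w.ρ t x)).sub h.density).const_mul (1 / w.ρ t x * w.p_S c t x)).congr
    (Eventually.of_forall fun y => by rw [phiEnt]; ring) (by ring)

lemma temp (ha : 0 < c.a) (h : StateMeans c μ r m L F K P v e) :
    HasMean μ (phiTemp c w t x) (r / w.ρ t x * w.S c t x
      - (Real.log c.a / (c.gamma - 1) * r + c.gamma / (c.gamma - 1) * L)) :=
  ((h.density.const_mul (1 / w.ρ t x * w.S c t x)).sub (h.entropy_mean ha)).congr
    (Eventually.of_forall fun y => by rw [phiTemp]; ring) (by ring)

/-- The entropy is affine in log θ̃ after division by ϱ̃, so the product with ũ - u involves no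
moments beyond ϱ̃ũ, ϱ̃ ln(θ̃) ũ, ϱ̃ and ϱ̃ ln θ̃. -/
lemma flux (ha : 0 < c.a) (h : StateMeans c μ r m L F K P v e) :
    HasMean μ (phiFlux c w t x)
      ((w.S c t x / w.ρ t x - Real.log c.a / (c.gamma - 1)) • (m - r • w.u t x)
        - (c.gamma / (c.gamma - 1)) • (F - L • w.u t x)) := by
  refine (((h.momentum.sub (h.density.smul_const (w.u t x))).const_smul
    (w.S c t x / w.ρ t x - Real.log c.a / (c.gamma - 1))).sub
    ((h.logFlux.sub (h.log.smul_const (w.u t x))).const_smul (c.gamma / (c.gamma - 1)))).congr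
    (h.supp.mono fun y hy => ?_) rfl
  rw [phiFlux, phiTemp, entropy_eq ha _ hy.2, ← smul_sub, ← smul_sub, smul_smul, smul_smul,
    ← sub_smul]
  congr 1; ring

/-- The factor ϱ̃/ϱ - 1 splits the average into a part weighted by the density and a part in the
bare velocity; the latter is where the mean velocity u_V itself enters. -/
lemma visc [IsProbabilityMeasure μ] {H : ℝ → Sp d → Fin d → Fin d → Fin d → ℝ}
    (h : StateMeans c μ r m L F K P v e)
    (hρ : w.ρ t x ≠ 0) :
    HasMean μ (phiVisc c w H t x)
      (1 / w.ρ t x * inner ℝ (divStress c (H t x)) (r • w.u t x - m)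
        - inner ℝ (divStress c (H t x)) (w.u t x - v)) := by
  have h1 := (((h.density.smul_const (w.u t x)).sub h.momentum).inner_const
    (divStress c (H t x))).const_mul (1 / w.ρ t x)
  have h2 := ((HasMean.const (w.u t x)).sub h.velocity).inner_const (divStress c (H t x))
  refine (h1.sub h2).congr (Eventually.of_forall fun y => ?_) rfl
  rw [phiVisc, ← smul_sub, real_inner_smul_right]
  field_simp

lemma rel [IsProbabilityMeasure μ] (ha : 0 < c.a) (hγ : 1 < c.gamma)
    (h : StateMeans c μ r m L F K P v e)
    (hρ : 0 < w.ρ t x) :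
    HasMean μ (relDensity c w t x)
      (e - inner ℝ m (w.u t x) + r * densityTest c w t x
        - c.gamma / (c.gamma - 1) * (L * w.temp c t x) + w.p c t x) := by
  have h1 := h.momentum.inner_const (w.u t x)
  have h2 := h.density.smul_const (densityTest c w t x)
  have h3 := (h.log.smul_const (w.temp c t x)).const_mul (c.gamma / (c.gamma - 1))
  refine ((((h.energy.sub h1).add h2).sub h3).add (HasMean.const (w.p c t x))).congr
    (h.supp.mono fun y hy => ?_) (by rw [real_inner_comm m]; rfl)
  rw [relDensity_eq ha hγ hρ hy.1 hy.2, densityTest]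
  rw [real_inner_comm (w.u t x)]
  simp only [smul_eq_mul]
  ring

end StateMeans

/-! ### The divergence of the viscous stress and its integrability -/

section DivStress

variable {d : ℕ}

/-- The index pattern mirrors `frob_stress`: each first derivative there corresponds to one second
derivative here, which makes the integration by parts termwise. -/
lemma divStress_apply (c : Coeffs) (H : Fin d → Fin d → Fin d → ℝ) (i : Fin d) :
    divStress c H i = c.mu * ((∑ j, H i j j) + ∑ j, H j i j)
      + (c.lam - c.mu * (2 / (d : ℝ))) * ∑ k, H k k i := by
  have h1 : ∀ j, stress c (Matrix.of fun k l => H k l j) i j = c.mu * H i j j + c.mu * H j i j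
      + (c.lam - c.mu * (2 / (d : ℝ))) * ((∑ k, H k k j) * (1 : Mat d) i j) := by
    intro j
    simp only [stress, Matrix.add_apply, Matrix.smul_apply, Matrix.sub_apply,
      Matrix.transpose_apply, smul_eq_mul, Matrix.trace, Matrix.diag_apply, Matrix.of_apply]
    ring
  have h2 : ∑ j, (∑ k, H k k j) * (1 : Mat d) i j = ∑ k, H k k i := by
    simp [Matrix.one_apply]
  simp only [divStress, h1, Finset.sum_add_distrib, ← Finset.mul_sum, h2]
  ring

lemma isLinearMap_divStress (c : Coeffs) :
    IsLinearMap ℝ (divStress c : (Fin d → Fin d → Fin d → ℝ) → Sp d) where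
  map_add A B := by
    ext i
    simp only [divStress_apply, PiLp.add_apply, Pi.add_apply, Finset.sum_add_distrib]
    ring
  map_smul k A := by
    ext i
    simp only [divStress_apply, PiLp.smul_apply, Pi.smul_apply, smul_eq_mul, ← Finset.mul_sum]
    ring

/-- `divStress` as a continuous linear map. -/
def divStressL (d : ℕ) (c : Coeffs) : (Fin d → Fin d → Fin d → ℝ) →L[ℝ] Sp d :=
  LinearMap.toContinuousLinearMap ((isLinearMap_divStress c).mk' _)

end DivStress

namespace IsTestTriple

variable {d : ℕ} {c : Coeffs} {Ω : Set (Sp d)} {T : ℝ} {w : Triple d}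
  {H : ℝ → Sp d → Fin d → Fin d → Fin d → ℝ}

lemma aestronglyMeasurable_divStress (hw : IsTestTriple Ω T w H) (c : Coeffs) :
    AEStronglyMeasurable (fun q : ℝ × Sp d => divStress c (H q.1 q.2))
      (volume.restrict (slab Ω T)) :=
  (divStressL d c).continuous.comp_aestronglyMeasurable hw.H_meas

lemma exists_divStress_bound (hw : IsTestTriple Ω T w H) (c : Coeffs) :
    ∃ h : ℝ → ℝ, MemLp h 2 (volume.restrict (Ioo 0 T)) ∧
      ∀ᵐ t ∂(volume.restrict (Ioo 0 T)), ∀ᵐ x ∂(volume.restrict Ω),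
        ‖divStress c (H t x)‖ ≤ h t := by
  obtain ⟨h, hh, hle⟩ := hw.H_bound
  refine ⟨fun t => ‖divStressL d c‖ * h t, hh.const_mul _, ?_⟩
  filter_upwards [hle] with t ht
  filter_upwards [ht] with x hx
  exact ((divStressL d c).le_opNorm _).trans (mul_le_mul_of_nonneg_left hx (norm_nonneg _))

lemma memLp_divStress (hw : IsTestTriple Ω T w H) (hb : Bornology.IsBounded Ω) (c : Coeffs) :
    MemLp (fun q : ℝ × Sp d => divStress c (H q.1 q.2)) 2 (volume.restrict (slab Ω T)) := by
  have := volume_Ω_finite hb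
  obtain ⟨h, hh, hle⟩ := hw.exists_divStress_bound c
  have hm := hw.aestronglyMeasurable_divStress c
  rw [volume_restrict_slab] at hm ⊢
  rw [memLp_two_iff_integrable_sq_norm hm]
  refine ⟨hm.norm.pow 2, ?_⟩
  have hm2 : AEMeasurable (fun q : ℝ × Sp d => ‖‖divStress c (H q.1 q.2)‖ ^ 2‖ₑ)
      ((volume.restrict (Ioo 0 T)).prod (volume.restrict Ω)) := (hm.norm.pow 2).enorm
  rw [hasFiniteIntegral_iff_enorm, lintegral_prod _ hm2]
  have hle' : ∀ᵐ t ∂(volume.restrict (Ioo 0 T)),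
      ∫⁻ x in Ω, ‖‖divStress c (H t x)‖ ^ 2‖ₑ ≤ volume Ω * ‖h t ^ 2‖ₑ := by
    filter_upwards [hle] with t ht
    calc ∫⁻ x in Ω, ‖‖divStress c (H t x)‖ ^ 2‖ₑ ≤ ∫⁻ x in Ω, ‖h t ^ 2‖ₑ := by
          refine lintegral_mono_ae ?_
          filter_upwards [ht] with x hx
          rw [enorm_le_iff_norm_le, norm_pow, norm_pow, norm_norm]
          exact pow_le_pow_left₀ (norm_nonneg _) (hx.trans (le_abs_self _)) 2
      _ = volume Ω * ‖h t ^ 2‖ₑ := by simp [mul_comm]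
  refine (lintegral_mono_ae hle').trans_lt ?_
  rw [lintegral_const_mul' _ _ hb.measure_lt_top.ne]
  exact ENNReal.mul_lt_top hb.measure_lt_top (hasFiniteIntegral_iff_enorm.1 hh.integrable_sq.2)

/-- A vector field that is bounded in time with values in `L¹` may be paired with `div S(∇u)`. -/
lemma integrable_norm_mul_divStress (hw : IsTestTriple Ω T w H) (c : Coeffs)
    {X : ℝ × Sp d → Sp d} (hX : AEStronglyMeasurable X (volume.restrict (slab Ω T)))
    {C : ℝ≥0∞} (hC : C ≠ ⊤)
    (hXC : ∀ᵐ t ∂(volume.restrict (Ioo 0 T)), ∫⁻ x in Ω, ‖X (t, x)‖ₑ ≤ C) :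
    Integrable (fun q => ‖X q‖ * ‖divStress c (H q.1 q.2)‖) (volume.restrict (slab Ω T)) := by
  obtain ⟨h, hh, hle⟩ := hw.exists_divStress_bound c
  have hm := hw.aestronglyMeasurable_divStress c
  rw [volume_restrict_slab] at hm hX ⊢
  refine integrable_mul_of_time_bound hC hX.norm ?_ hm.norm hh ?_
  · simpa only [enorm_norm] using hXC
  · simpa only [norm_norm] using hle

end IsTestTriple

/-! ### Integrability of the remainder terms -/

section Terms

variable {d : ℕ} {c : Coeffs} {Ω : Set (Sp d)} {T : ℝ}
  {V : ℝ → Sp d → ProbabilityMeasure (Phase d)} {ρ₀ θ₀ : Sp d → ℝ} {u₀ : Sp d → Sp d}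
  {G : ℝ → Sp d → Mat d} {E : ℝ → Measure (Sp d)} {D : Measure (ℝ × Sp d)}
  {R : ℝ → Fin d → Fin d → SignedMeasure (Sp d)} {w : Triple d}
  {H : ℝ → Sp d → Fin d → Fin d → Fin d → ℝ}

/-- The mean values at `(t,x)` exist. -/
abbrev HasStateMeans (c : Coeffs) (V : ℝ → Sp d → ProbabilityMeasure (Phase d)) (t : ℝ)
    (x : Sp d) : Prop :=
  StateMeans c (V t x : Measure (Phase d)) (avg V (fun y => y.1) t x)
    (avg V (fun y => y.1 • y.2.2) t x) (avg V (fun y => y.1 * Real.log y.2.1) t x)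
    (avg V (fun y => (y.1 * Real.log y.2.1) • y.2.2) t x)
    (Matrix.of fun i j => avg V (momFlux c i j) t x)
    (avg V (fun y => pressure c (y.1 * y.2.1)) t x) (meanVel V t x) (avg V (energyDensity c) t x)

lemma IsDMVSolution.ae_hasStateMeans (hV : IsDMVSolution c Ω T ρ₀ θ₀ u₀ V G E D R)
    (hB : MomentBounds c Ω T V) :
    ∀ᵐ q ∂(volume.restrict (slab Ω T)), HasStateMeans c V q.1 q.2 := by
  filter_upwards [hB.supp, hB.phase_density, hB.phase_momentum, hB.phase_log, hB.phase_logFlux,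
    ae_all_iff.2 fun i => ae_all_iff.2 fun j => hB.phase_momFlux i j, hB.phase_pressure,
    hV.vel_integrable, hV.energy_phase] with q h1 h2 h3 h4 h5 h6 h7 h8 h9
  exact ⟨h1, .of_integrable h2, .of_integrable h3, .of_integrable h4, .of_integrable h5,
    fun i j => .of_integrable (h6 i j), .of_integrable h7, .of_integrable h8, .of_integrable h9⟩

lemma IsTestTriple.inv_ρ_C1 (hw : IsTestTriple Ω T w H) :
    IsC1Closed Ω T (fun t x => (w.ρ t x)⁻¹) :=
  hw.ρ_C1.comp (U := {z : ℝ | z ≠ 0}) isOpen_ne (contDiffOn_id.inv fun _ hz => hz)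
    fun t ht x hx => (hw.ρ_pos t ht x hx).ne'

lemma MomentBounds.integrable_momentum_sub (hB : MomentBounds c Ω T V) (hΩ : IsOpen Ω)
    (hb : Bornology.IsBounded Ω) (hw : IsTestTriple Ω T w H) :
    IntegrableOn (fun q : ℝ × Sp d => avg V (fun y => y.1) q.1 q.2 • w.u q.1 q.2
      - avg V (fun y => y.1 • y.2.2) q.1 q.2) (slab Ω T) :=
  (hB.density.smul_memLp_top (hw.u_C1.memLp_top hΩ hb)).sub hB.momentum

/-- As div S(∇u) need not be bounded in time, space-time integrability of the moments would not
suffice. The bounds of density and momentum in L^∞(0,T;L¹) compensate for it. -/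
lemma MomentBounds.integrable_mul_divStress (hB : MomentBounds c Ω T V) (hΩ : IsOpen Ω)
    (hb : Bornology.IsBounded Ω) (hw : IsTestTriple Ω T w H) :
    IntegrableOn (fun q : ℝ × Sp d => inner ℝ (divStress c (H q.1 q.2))
      (avg V (fun y => y.1) q.1 q.2 • w.u q.1 q.2
        - avg V (fun y => y.1 • y.2.2) q.1 q.2)) (slab Ω T) := by
  obtain ⟨C₁, hC₁, h1⟩ := hB.density_time
  obtain ⟨C₂, hC₂, h2⟩ := hB.momentum_time
  obtain ⟨B, hu⟩ := hw.u_C1.exists_bound hb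
  have hX := hB.integrable_momentum_sub hΩ hb hw
  have h3 := hw.integrable_norm_mul_divStress c hX.aestronglyMeasurable
    (C := C₁ * ‖B‖ₑ + C₂) (ENNReal.add_ne_top.2 ⟨ENNReal.mul_ne_top hC₁ enorm_ne_top, hC₂⟩) ?_
  · refine h3.mono ((hw.aestronglyMeasurable_divStress c).inner hX.aestronglyMeasurable)
      (Eventually.of_forall fun q => ?_)
    rw [norm_mul, norm_norm, norm_norm, mul_comm]
    exact norm_inner_le_norm _ _
  · have hr := hB.density.aestronglyMeasurable
    rw [volume_restrict_slab] at hr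
    filter_upwards [h1, h2, hr.prodMk_left, ae_restrict_mem measurableSet_Ioo] with t ht1 ht2 hrt ht
    calc ∫⁻ x in Ω, ‖avg V (fun y => y.1) t x • w.u t x - avg V (fun y => y.1 • y.2.2) t x‖ₑ
        ≤ ∫⁻ x in Ω, (‖avg V (fun y => y.1) t x‖ₑ * ‖B‖ₑ + ‖avg V (fun y => y.1 • y.2.2) t x‖ₑ) := by
          refine setLIntegral_mono_ae' hΩ.measurableSet (Eventually.of_forall fun x hx => ?_)
          refine enorm_sub_le.trans (add_le_add ?_ le_rfl)
          rw [enorm_smul]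
          refine mul_le_mul_right ?_ _
          exact enorm_le_iff_norm_le.2 ((hu (t, x) ⟨Ioo_subset_Icc_self ht, subset_closure hx⟩).trans
            (le_abs_self _))
      _ = (∫⁻ x in Ω, ‖avg V (fun y => y.1) t x‖ₑ) * ‖B‖ₑ
            + ∫⁻ x in Ω, ‖avg V (fun y => y.1 • y.2.2) t x‖ₑ := by
          rw [lintegral_add_left' (hrt.enorm.mul_const _), lintegral_mul_const' _ _ enorm_ne_top]
      _ ≤ C₁ * ‖B‖ₑ + C₂ := by gcongr

/-- `StateMeans` expresses each average through integrable moments, and the velocity where it occurs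
without density. The coefficients are bounded except for div S(∇u) and the gradient of u_V, which
are treated separately. -/
lemma IsDMVSolution.termsWellDefined (ha : 0 < c.a) (hγ : 1 < c.gamma) (hΩ : IsOpen Ω)
    (hb : Bornology.IsBounded Ω) (hT : 0 < T) (hV : IsDMVSolution c Ω T ρ₀ θ₀ u₀ V G E D R)
    (hw : IsTestTriple Ω T w H) : TermsWellDefined c V w Ω T G H R := by
  have hB := hV.momentBounds ha hγ hb
  have hM := hV.ae_hasStateMeans hB
  have hm := (isOpen_slab hΩ T).measurableSet
  have hfin := volume_slab_finite hb T
  have hρ : ∀ q ∈ slab Ω T, 0 < w.ρ q.1 q.2 := fun q hq =>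
    have hq' := slab_subset_closedSlab Ω T hq
    hw.ρ_pos q.1 hq'.1 q.2 hq'.2
  have hi := hw.inv_ρ_C1.memLp_top hΩ hb
  have hρb := hw.ρ_C1.memLp_top hΩ hb
  have hub := hw.u_C1.memLp_top hΩ hb
  have hpρ := (hw.p_ρ_C1 ha hγ hΩ).memLp_top hΩ hb
  have hpS := (hw.p_S_C1 ha hγ hΩ).memLp_top hΩ hb
  have hS := (hw.S_C1 (c := c) ha hΩ).memLp_top hΩ hb
  have hp := (hw.p_C1 ha hγ hΩ).memLp_top hΩ hb
  have hdiv := hw.u_C1.memLp_top_divg hΩ hb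
  have hDu := hw.u_C1.memLp_top_fderiv_apply hΩ hb hw.u_C1
  have hGu := hw.u_C1.memLp_top_gradMat hΩ hb
  have hX := hB.integrable_momentum_sub hΩ hb hw
  have hXH := hB.integrable_mul_divStress hΩ hb hw
  have hE := (hB.density.const_mul (Real.log c.a / (c.gamma - 1))).add
    (hB.log.const_mul (c.gamma / (c.gamma - 1)))
  have hρr := (hρb.integrable le_top).sub hB.density
  have hGu2 : ∀ i j, MemLp (fun q : ℝ × Sp d => gradMat (w.u q.1) q.2 i j) 2
      (volume.restrict (slab Ω T)) := fun i j => (hGu i j).mono_exponent le_top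
  refine
    { conv_phase := hM.mono fun q hq => hq.conv.1
      press_phase := hM.mono fun q hq => (hq.press ha hγ).1
      mom_phase := hM.mono fun q hq => hq.mom.1
      mass_phase := hM.mono fun q hq => hq.mass.1
      ent_phase := hM.mono fun q hq => hq.ent.1
      temp_phase := hM.mono fun q hq => (hq.temp ha).1
      flux_phase := hM.mono fun q hq => (hq.flux ha).1
      visc_phase := ?_
      diss := ?_
      conv := ?_
      press := ?_
      mom := ?_
      mass := ?_
      ent := ?_
      temp := ?_
      flux := ?_
      visc := ?_
      reynolds := integrableOn_termReynolds hT hb hV.reynolds_defect hw.u_C1 }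
  · filter_upwards [hM, ae_restrict_mem hm] with q hq hqs using (hq.visc (hρ q hqs).ne').1
  · exact integrable_frob_stress c (fun i j => (hV.vel_mem.2.1 i j).sub (hGu2 i j))
      fun i j => (hV.vel_mem.2.1 i j).sub (hGu2 i j)
  · have h1 : IntegrableOn (fun q : ℝ × Sp d =>
        frob (Matrix.of fun i j => avg V (momFlux c i j) q.1 q.2) (gradMat (w.u q.1) q.2))
        (slab Ω T) :=
      integrable_finsetSum _ fun i _ => integrable_finsetSum _ fun j _ =>
        (hB.momFlux i j).mul_memLp_top (hGu i j)
    have h2 := hB.pressure.mul_memLp_top hdiv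
    have h3 := hB.momentum.inner_memLp_top hDu
    have h4 : IntegrableOn (fun q : ℝ × Sp d => inner ℝ (w.u q.1 q.2)
        (fderiv ℝ (w.u q.1) q.2 (avg V (fun y => y.1 • y.2.2) q.1 q.2))) (slab Ω T) := by
      simp only [gradMat_eq_frob]
      refine integrable_finsetSum _ fun i _ => integrable_finsetSum _ fun j _ => ?_
      refine (((hB.momentum.coord j).mul_memLp_top (hub.coord i)).mul_memLp_top (hGu i j)).congr
        (Eventually.of_forall fun q => ?_)
      ring
    have h5 := (hB.density.smul_memLp_top hub).inner_memLp_top hDu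
    refine ((((h1.sub h2).sub h3).sub h4).add h5).congr ?_
    filter_upwards [hM] with q hq
    rw [termConv, avg, hq.conv.2]
    simp only [Pi.add_apply, Pi.sub_apply, real_inner_smul_left]
  · have h1 := (((hB.pressure.sub (hρr.neg.mul_memLp_top hpρ)).sub
      ((hE.sub (hS.integrable le_top)).mul_memLp_top hpS)).sub
      (hp.integrable le_top)).mul_memLp_top hdiv
    refine h1.congr ?_
    filter_upwards [hM] with q hq
    rw [termPress, avg, (hq.press ha hγ).2]
    simp only [Pi.add_apply, Pi.sub_apply, Pi.neg_apply]
    ring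
  -- The bounded part of the momentum residual is separated from div S(∇u), which goes into `hXH`.
  · have hY : MemLp (fun q : ℝ × Sp d => w.ρ q.1 q.2 • dt w.u q.1 q.2
        + w.ρ q.1 q.2 • fderiv ℝ (w.u q.1) q.2 (w.u q.1 q.2) + gradient (w.p c q.1) q.2) ⊤
        (volume.restrict (slab Ω T)) :=
      ((hw.u_C1.memLp_top_dt hΩ hb).smul hρb |>.add (hDu.smul hρb)).add
        ((hw.p_C1 ha hγ hΩ).memLp_top_gradient hΩ hb)
    have h1 := (hX.inner_memLp_top hY).sub hXH
    refine (h1.mul_memLp_top hi).congr ?_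
    filter_upwards [hM] with q hq
    rw [termMom, avg, hq.mom.2, inner_sub_right]
    simp only [Pi.sub_apply, real_inner_smul_left, real_inner_comm _ (divStress c (H q.1 q.2))]
    ring
  · have h1 := ((hρr.mul_memLp_top hi).mul_memLp_top hpρ).mul_memLp_top
      ((hw.ρ_C1.memLp_top_dt hΩ hb).add ((hw.ρ_C1.smul hw.u_C1).memLp_top_divg hΩ hb))
    refine h1.congr ?_
    filter_upwards [hM] with q hq
    rw [termMass, avg, hq.mass.2]
    simp
  · have h1 := ((hρr.mul_memLp_top hi).mul_memLp_top hpS).mul_memLp_top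
      (((hw.S_C1 (c := c) ha hΩ).memLp_top_dt hΩ hb).add
        (((hw.S_C1 (c := c) ha hΩ).smul hw.u_C1).memLp_top_divg hΩ hb))
    refine h1.congr ?_
    filter_upwards [hM] with q hq
    rw [termEnt, avg, hq.ent.2]
    simp
  · have ht := hw.temp_C1 ha hγ hΩ
    have h1 := (((hB.density.mul_memLp_top hi).mul_memLp_top hS).sub hE).mul_memLp_top
      (((ht.memLp_top_dt hΩ hb).add (ht.memLp_top_fderiv_apply hΩ hb hw.u_C1)).add
        (hdiv.mul' hpS))
    refine h1.congr ?_
    filter_upwards [hM, ae_restrict_mem hm] with q hq hqs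
    rw [termTemp, avg, (hq.temp ha).2, ht.inner_gradient' hqs, ← ht.fderiv_apply hqs]
    simp [div_eq_mul_inv]
  · have ht := (hw.temp_C1 ha hγ hΩ).memLp_top_gradient hΩ hb
    have h1 := (hX.neg.memLp_top_smul (hi.mul' hS)).sub (Integrable.smul (Real.log c.a / (c.gamma - 1)) hX.neg)
    have h2 := Integrable.smul (c.gamma / (c.gamma - 1))
      (hB.logFlux.sub (hB.log.smul_memLp_top hub))
    refine ((h1.sub h2).inner_memLp_top ht).congr ?_
    filter_upwards [hM] with q hq
    rw [termFlux, avg, (hq.flux ha).2]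
    congr 1
    simp only [Pi.sub_apply, Pi.neg_apply, Pi.smul_apply, neg_sub, sub_smul, div_eq_mul_inv]
  -- The part without density weight pairs two functions that are square integrable in space-time.
  · have hv : MemLp (fun q : ℝ × Sp d => w.u q.1 q.2 - meanVel V q.1 q.2) 2
        (volume.restrict (slab Ω T)) := (hub.mono_exponent le_top).sub hV.vel_mem.1
    have h2 : IntegrableOn (fun q : ℝ × Sp d => inner ℝ (divStress c (H q.1 q.2))
        (w.u q.1 q.2 - meanVel V q.1 q.2)) (slab Ω T) := by
      have hH := hw.memLp_divStress hb c
      refine (hH.norm.integrable_mul hv.norm).mono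
        (hH.aestronglyMeasurable.inner hv.aestronglyMeasurable) (Eventually.of_forall fun q => ?_)
      rw [Pi.mul_apply, norm_mul, norm_norm, norm_norm]
      exact norm_inner_le_norm _ _
    refine ((hXH.mul_memLp_top hi).sub h2).congr ?_
    filter_upwards [hM, ae_restrict_mem hm] with q hq hqs
    rw [termVisc, avg, (hq.visc (hρ q hqs).ne').2]
    simp only [Pi.sub_apply]
    ring

end Terms

/-! ### Integration by parts for the test velocity -/

section Slices

variable {d : ℕ} {c : Coeffs} {Ω : Set (Sp d)} {T : ℝ}

lemma _root_.MeasureTheory.MemLp.ae_slice_slab {f : ℝ × Sp d → ℝ}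
    (hf : MemLp f 2 (volume.restrict (slab Ω T))) :
    ∀ᵐ t ∂(volume.restrict (Ioo 0 T)), MemLp (fun x => f (t, x)) 2 (volume.restrict Ω) := by
  have h1 := hf.integrable_sq
  have h2 := hf.aestronglyMeasurable
  rw [volume_restrict_slab] at h1 h2
  filter_upwards [h1.prod_right_ae, h2.prodMk_left] with t ht1 ht2
  exact (memLp_two_iff_integrable_sq ht2).2 ht1

lemma setIntegral_slab_eq_zero {f : ℝ × Sp d → ℝ} (hf : IntegrableOn f (slab Ω T))
    (h0 : ∀ᵐ t ∂(volume.restrict (Ioo 0 T)), ∫ x in Ω, f (t, x) = 0) {τ : ℝ} (hτ : τ ≤ T) :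
    ∫ q in slab Ω τ, f q = 0 := by
  have h1 := hf.mono_set (slab_mono Ω hτ)
  rw [IntegrableOn, volume_restrict_slab] at h1
  rw [volume_restrict_slab, integral_prod _ h1]
  exact integral_eq_zero_of_ae (ae_restrict_of_ae_restrict_of_subset (Ioo_subset_Ioo_right hτ) h0)

/-- Integration by parts for the viscous stress. -/
lemma IsW012.hasMean_frob_stress {w : Sp d → Sp d} {W : Sp d → Mat d} (hw : IsW012 Ω w W)
    (c : Coeffs) {A : Sp d → Mat d} {h : Sp d → Fin d → Fin d → Fin d → ℝ}
    (hA : ∀ i j, MemLp (fun x => A x i j) 2 (volume.restrict Ω))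
    (hh : ∀ i j k, MemLp (fun x => h x i j k) 2 (volume.restrict Ω))
    (hweak : ∀ i j k, ∀ ψ : Sp d → ℝ, ContDiff ℝ ∞ ψ → HasCompactSupport ψ → tsupport ψ ⊆ Ω →
      ∫ x in Ω, A x i j * fderiv ℝ ψ x (basisVec k) = - ∫ x in Ω, h x i j k * ψ x) :
    HasMean (volume.restrict Ω)
      (fun x => frob (stress c (A x)) (W x) + inner ℝ (divStress c (h x)) (w x)) 0 := by
  have h1 : ∀ i j k l, HasMean (volume.restrict Ω) (fun x => A x i j * W x l k)
      (-∫ x in Ω, h x i j k * w x l) := fun i j k l =>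
    ⟨(hA i j).integrable_mul (hw.2.1 l k), hw.integral_mul_eq_neg (hA i j) (hh i j k)
      (hweak i j k) l⟩
  have h2 : ∀ i j k l, HasMean (volume.restrict Ω) (fun x => h x i j k * w x l)
      (∫ x in Ω, h x i j k * w x l) := fun i j k l =>
    .of_integrable ((hh i j k).integrable_mul (hw.1.coord l))
  have h3 : ∀ i j k l, HasMean (volume.restrict Ω)
      (fun x => A x i j * W x l k + h x i j k * w x l) 0 := fun i j k l =>
    ((h1 i j k l).add (h2 i j k l)).congr (Eventually.of_forall fun _ => rfl) (by ring)
  -- The three index patterns correspond to the contributions of A, of its transpose and of the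
  -- trace in the viscous stress.
  have h4 := (((HasMean.sum (s := Finset.univ) fun i _ => HasMean.sum (s := Finset.univ)
      fun j _ => h3 i j j i).add
    (HasMean.sum (s := Finset.univ) fun i _ => HasMean.sum (s := Finset.univ)
      fun j _ => h3 j i j i)).const_mul c.mu).add
    ((HasMean.sum (s := Finset.univ) fun i _ => HasMean.sum (s := Finset.univ)
      fun k _ => h3 k k i i).const_mul (c.lam - c.mu * (2 / (d : ℝ))))
  refine h4.congr (Eventually.of_forall fun x => ?_) (by simp)
  rw [frob_stress, inner_eq_sum, Finset.sum_mul_sum, Finset.sum_comm (f := fun i j => A x i i * W x j j)]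
  simp only [divStress_apply, add_mul, Finset.sum_mul, Finset.mul_sum, mul_add,
    Finset.sum_add_distrib, mul_assoc]
  ring

/-- Integration by parts for a `C¹` pressure. -/
lemma IsW012.hasMean_divergence {w : Sp d → Sp d} {W : Sp d → Mat d} (hw : IsW012 Ω w W)
    {f : Sp d → ℝ} {g : Fin d → Sp d → ℝ} (hf : MemLp f 2 (volume.restrict Ω))
    (hg : ∀ k, MemLp (g k) 2 (volume.restrict Ω))
    (hweak : ∀ k, ∀ ψ : Sp d → ℝ, ContDiff ℝ ∞ ψ → HasCompactSupport ψ → tsupport ψ ⊆ Ω →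
      ∫ x in Ω, f x * fderiv ℝ ψ x (basisVec k) = - ∫ x in Ω, g k x * ψ x) :
    HasMean (volume.restrict Ω) (fun x => f x * (∑ k, W x k k) + ∑ k, g k x * w x k) 0 := by
  have h1 : ∀ k, HasMean (volume.restrict Ω) (fun x => f x * W x k k)
      (-∫ x in Ω, g k x * w x k) := fun k =>
    ⟨hf.integrable_mul (hw.2.1 k k), hw.integral_mul_eq_neg hf (hg k) (hweak k) k⟩
  have h2 : ∀ k, HasMean (volume.restrict Ω) (fun x => g k x * w x k)
      (∫ x in Ω, g k x * w x k) := fun k =>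
    .of_integrable ((hg k).integrable_mul (hw.1.coord k))
  refine (HasMean.sum (s := Finset.univ) fun k _ => (h1 k).add (h2 k)).congr
    (Eventually.of_forall fun x => ?_) (by simp)
  rw [Finset.sum_add_distrib, Finset.mul_sum]

end Slices

namespace IsTestTriple

variable {d : ℕ} {c : Coeffs} {Ω : Set (Sp d)} {T : ℝ} {w : Triple d}
  {H : ℝ → Sp d → Fin d → Fin d → Fin d → ℝ}

/-- At interior times the slice is C¹ in Ω with bounded gradient, continuous up to ∂Ω and zero
there, so `isW012_of_contDiffOn` applies. Interior times are used because derivatives are available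
only in the open cylinder. -/
lemma isW012_u (hw : IsTestTriple Ω T w H) (hΩ : IsOpen Ω) (hb : Bornology.IsBounded Ω) {t : ℝ}
    (ht : t ∈ Ioo 0 T) : IsW012 Ω (w.u t) (gradMat (w.u t)) := by
  have ht' := Ioo_subset_Icc_self ht
  obtain ⟨C, hC0, hC⟩ := hw.u_C1.exists_bound_stDeriv hb
  have hD : ∀ x ∈ Ω, HasFDerivAt (w.u t) _ x := fun x hx =>
    hw.u_C1.hasFDerivAt_space (q := (t, x)) ⟨ht, hx⟩
  have hc : ContinuousOn (fun x => fderiv ℝ (w.u t) x) Ω := by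
    have : ContinuousOn (fun x => stDeriv w.u (t, x)) Ω :=
      hw.u_C1.continuousOn_stDeriv.comp (f := fun x => (t, x)) (by fun_prop) fun x hx => ⟨ht, hx⟩
    exact (this.clm_comp continuousOn_const).congr fun x hx => (hD x hx).fderiv
  have hcd : ContDiffOn ℝ 1 (w.u t) Ω := by
    rw [← zero_add (1 : WithTop ℕ∞), contDiffOn_succ_iff_fderiv_of_isOpen hΩ]
    exact ⟨fun x hx => (hD x hx).differentiableAt.differentiableWithinAt, by simp,
      contDiffOn_zero.2 hc⟩
  refine isW012_of_contDiffOn hΩ hb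
    (hw.u_C1.1.comp (f := fun x => (t, x)) (by fun_prop) fun x hx => ⟨ht', hx⟩)
    (hw.u_bdry t ht') hcd (C := C) fun x hx => ?_
  refine ContinuousLinearMap.opNorm_le_bound _ hC0 fun v => ?_
  rw [hw.u_C1.fderiv_apply (q := (t, x)) ⟨ht, hx⟩]
  refine ((stDeriv w.u (t, x)).le_opNorm _).trans (mul_le_mul (hC _ ⟨ht, hx⟩) ?_ (norm_nonneg _) hC0)
  simp [Prod.norm_def]

lemma ae_memLp_H (hw : IsTestTriple Ω T w H) (hb : Bornology.IsBounded Ω) :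
    ∀ᵐ t ∂(volume.restrict (Ioo 0 T)), ∀ i j k,
      MemLp (fun x => H t x i j k) 2 (volume.restrict Ω) := by
  have := volume_Ω_finite hb
  obtain ⟨h, -, hle⟩ := hw.H_bound
  have hm := hw.H_meas
  rw [volume_restrict_slab] at hm
  filter_upwards [hle, hm.prodMk_left] with t ht1 ht2 i j k
  have hc : Continuous fun A : Fin d → Fin d → Fin d → ℝ => A i j k := by fun_prop
  refine (memLp_top_of_bound (hc.comp_aestronglyMeasurable ht2) (h t) ?_).mono_exponent le_top
  filter_upwards [ht1] with x hx
  exact (norm_le_pi_norm (H t x i j) k).trans ((norm_le_pi_norm (H t x i) j).trans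
    ((norm_le_pi_norm (H t x) i).trans hx))

lemma ae_memLp_gradMat (hw : IsTestTriple Ω T w H) (hΩ : IsOpen Ω) (hb : Bornology.IsBounded Ω) :
    ∀ᵐ t ∂(volume.restrict (Ioo 0 T)), ∀ i j,
      MemLp (fun x => gradMat (w.u t) x i j) 2 (volume.restrict Ω) := by
  have := volume_slab_finite hb T
  exact ae_all_iff.2 fun i => ae_all_iff.2 fun j => MemLp.ae_slice_slab
    ((hw.u_C1.memLp_top_gradMat hΩ hb i j).mono_exponent le_top)

/-- The viscous terms of the momentum equation for the test velocity cancel. -/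
lemma integral_stress_eq_zero (hw : IsTestTriple Ω T w H) (c : Coeffs) (hΩ : IsOpen Ω)
    (hb : Bornology.IsBounded Ω) {U : ℝ → Sp d → Sp d} {G : ℝ → Sp d → Mat d}
    (hU : IsL2W012 Ω T U G) {τ : ℝ} (hτ : τ ≤ T) :
    IntegrableOn (fun q : ℝ × Sp d =>
      frob (stress c (gradMat (w.u q.1) q.2)) (G q.1 q.2 - gradMat (w.u q.1) q.2)
        + inner ℝ (divStress c (H q.1 q.2)) (U q.1 q.2 - w.u q.1 q.2)) (slab Ω T) ∧
    ∫ q in slab Ω τ,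
      (frob (stress c (gradMat (w.u q.1) q.2)) (G q.1 q.2 - gradMat (w.u q.1) q.2)
        + inner ℝ (divStress c (H q.1 q.2)) (U q.1 q.2 - w.u q.1 q.2)) = 0 := by
  have := volume_slab_finite hb T
  have hGu2 : ∀ i j, MemLp (fun q : ℝ × Sp d => gradMat (w.u q.1) q.2 i j) 2
      (volume.restrict (slab Ω T)) :=
    fun i j => (hw.u_C1.memLp_top_gradMat hΩ hb i j).mono_exponent le_top
  have hint : IntegrableOn (fun q : ℝ × Sp d =>
      frob (stress c (gradMat (w.u q.1) q.2)) (G q.1 q.2 - gradMat (w.u q.1) q.2)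
        + inner ℝ (divStress c (H q.1 q.2)) (U q.1 q.2 - w.u q.1 q.2)) (slab Ω T) := by
    refine (integrable_frob_stress c hGu2 fun i j => (hU.2.1 i j).sub (hGu2 i j)).add ?_
    have hv := hU.1.sub ((hw.u_C1.memLp_top hΩ hb).mono_exponent (p := 2) le_top)
    have hH := hw.memLp_divStress hb c
    refine (hH.norm.integrable_mul hv.norm).mono
      (hH.aestronglyMeasurable.inner hv.aestronglyMeasurable) (Eventually.of_forall fun q => ?_)
    rw [Pi.mul_apply, norm_mul, norm_norm, norm_norm]
    exact norm_inner_le_norm _ _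
  refine ⟨hint, setIntegral_slab_eq_zero hint ?_ hτ⟩
  filter_upwards [hU.2.2, hw.ae_memLp_H hb, hw.ae_memLp_gradMat hΩ hb, hw.H_weak,
    ae_restrict_mem measurableSet_Ioo] with t h1 h2 h3 h4 ht
  -- The weak second derivatives of u are tested with u_V and with u, both in W_0^{1,2}, and the
  -- results are subtracted.
  have h5 := (h1.hasMean_frob_stress c h3 h2 h4).sub
    ((hw.isW012_u hΩ hb ht).hasMean_frob_stress c h3 h2 h4)
  refine (h5.congr (Eventually.of_forall fun x => ?_) (sub_zero 0)).2
  rw [frob_sub_right, inner_sub_right]; ring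

/-- `∫ div(p u) = 0`. -/
lemma integral_pressure_eq_zero (hw : IsTestTriple Ω T w H) (hΩ : IsOpen Ω)
    (hb : Bornology.IsBounded Ω) {p : ℝ → Sp d → ℝ} (hp : IsC1Closed Ω T p) {τ : ℝ} (hτ : τ ≤ T) :
    IntegrableOn (fun q : ℝ × Sp d => p q.1 q.2 * divg (w.u q.1) q.2
      + stDeriv p q (0, w.u q.1 q.2)) (slab Ω T) ∧
    ∫ q in slab Ω τ, (p q.1 q.2 * divg (w.u q.1) q.2 + stDeriv p q (0, w.u q.1 q.2)) = 0 := by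
  have := volume_slab_finite hb T
  have hm := (isOpen_slab hΩ T).measurableSet
  have hDp : MemLp (fun q : ℝ × Sp d => stDeriv p q (0, w.u q.1 q.2)) ⊤
      (volume.restrict (slab Ω T)) :=
    (hp.memLp_top_fderiv_apply hΩ hb hw.u_C1).ae_eq
      (ae_restrict_of_forall_mem hm fun q hq => hp.fderiv_apply hq _)
  have hp0 := hp.memLp_top hΩ hb
  have hint : IntegrableOn (fun q : ℝ × Sp d => p q.1 q.2 * divg (w.u q.1) q.2
      + stDeriv p q (0, w.u q.1 q.2)) (slab Ω T) :=
    ((hp0.integrable le_top).mul_memLp_top (hw.u_C1.memLp_top_divg hΩ hb)).add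
      (hDp.integrable le_top)
  have hDk : ∀ k : Fin d, MemLp (fun q : ℝ × Sp d => stDeriv p q (0, basisVec k)) ⊤
      (volume.restrict (slab Ω T)) := fun k =>
    hp.memLp_top_stDeriv_apply hΩ hb (v := fun _ => (0, basisVec k)) continuousOn_const
      fun _ _ => le_rfl
  refine ⟨hint, setIntegral_slab_eq_zero hint ?_ hτ⟩
  filter_upwards [(hp0.mono_exponent (p := 2) le_top).ae_slice_slab,
    ae_all_iff.2 fun k => ((hDk k).mono_exponent (p := 2) le_top).ae_slice_slab,
    ae_restrict_mem measurableSet_Ioo] with t h1 h2 ht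
  have hD : ∀ x ∈ Ω, HasFDerivAt (p t) _ x := fun x hx =>
    hp.hasFDerivAt_space (q := (t, x)) ⟨ht, hx⟩
  have hc : ContinuousOn (fun x => stDeriv p (t, x)) Ω :=
    hp.continuousOn_stDeriv.comp (f := fun x => (t, x)) (by fun_prop) fun x hx => ⟨ht, hx⟩
  -- Only u vanishes on the boundary. It is u that is approximated by test functions, and p is
  -- differentiated classically against them.
  have h5 := (hw.isW012_u hΩ hb ht).hasMean_divergence h1 h2 fun k ψ hψ hψc hψs => by
    rw [setIntegral_mul_fderiv_eq_neg hΩ hD (hc.clm_comp continuousOn_const)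
      (hψ.of_le (by norm_cast)) hψc hψs]
    simp
  refine (h5.congr (Eventually.of_forall fun x => ?_) rfl).2
  have e1 : ((0 : ℝ), w.u t x) = ContinuousLinearMap.inr ℝ ℝ (Sp d) (w.u t x) := rfl
  have e2 := clm_apply_eq_sum ((stDeriv p (t, x)).comp (ContinuousLinearMap.inr ℝ ℝ (Sp d)))
    (w.u t x)
  simp only [ContinuousLinearMap.comp_apply, ContinuousLinearMap.inr_apply, smul_eq_mul] at e2
  rw [e2]
  simp only [mul_comm (stDeriv p (t, x) _), divg, gradMat, Matrix.of_apply]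

end IsTestTriple

/-! ### The initial relative energy -/

section Initial

variable {d : ℕ} {c : Coeffs} {Ω : Set (Sp d)} {T : ℝ}

/-- Convexity of the pressure potential. -/
lemma pot_tangent_le (ha : 0 < c.a) (hγ : 1 < c.gamma) {z z₀ : ℝ} (hz : 0 ≤ z) (hz₀ : 0 ≤ z₀) :
    pot c z₀ + c.a / (c.gamma - 1) * (c.gamma * z₀ ^ (c.gamma - 1)) * (z - z₀) ≤ pot c z := by
  have hg : 0 < c.gamma - 1 := by linarith
  suffices h : z₀ ^ c.gamma + c.gamma * z₀ ^ (c.gamma - 1) * (z - z₀) ≤ z ^ c.gamma by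
    have := mul_le_mul_of_nonneg_left h (div_pos ha hg).le
    rw [pot, pot]; linarith
  -- At z₀ = 0 the tangent is horizontal, because γ > 1 makes 0^(γ-1) = 0. Otherwise the claim is
  -- Bernoulli's inequality for z/z₀, scaled by z₀^γ.
  rcases hz₀.eq_or_lt with rfl | h0
  · rw [Real.zero_rpow (by linarith), Real.zero_rpow hg.ne']
    simpa using Real.rpow_nonneg hz _
  · have h1 := one_add_mul_self_le_rpow_one_add (s := z / z₀ - 1)
      (by linarith [div_nonneg hz hz₀]) hγ.le
    have h2 : (1 + (z / z₀ - 1)) ^ c.gamma = z ^ c.gamma / z₀ ^ c.gamma := by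
      rw [← Real.div_rpow hz hz₀]; ring_nf
    have h3 : z₀ ^ (c.gamma - 1) = z₀ ^ c.gamma / z₀ := Real.rpow_sub_one h0.ne' _
    have h4 : 0 < z₀ ^ c.gamma := Real.rpow_pos_of_pos h0 _
    rw [h2, le_div_iff₀ h4] at h1
    rw [h3]
    refine le_trans (le_of_eq ?_) h1
    field_simp

/-- Discarding the negative part only increases the integral. The right-hand side is the form in
which a possibly infinite initial relative energy is expressed. -/
lemma ofReal_integral_le_lintegral {X : Type*} [MeasurableSpace X] {μ : Measure X} {f : X → ℝ}
    (hf : Integrable f μ) : ENNReal.ofReal (∫ x, f x ∂μ) ≤ ∫⁻ x, ENNReal.ofReal (f x) ∂μ := by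
  rw [integral_eq_lintegral_pos_part_sub_lintegral_neg_part hf]
  exact (ENNReal.ofReal_le_ofReal (sub_le_self _ ENNReal.toReal_nonneg)).trans
    ENNReal.ofReal_toReal_le

/-- Jensen's inequality for the relative energy of a state with given mean density, momentum,
total potential temperature and entropy. -/
lemma ofReal_le_lintegral_relDensity (ha : 0 < c.a) (hγ : 1 < c.gamma) {w : Triple d} {t : ℝ}
    {x : Sp d} (hρ : 0 < w.ρ t x) {μ : Measure (Phase d)} [IsProbabilityMeasure μ]
    (hsupp : ∀ᵐ y ∂μ, 0 ≤ y.1 ∧ 0 < y.2.1) {r θ L : ℝ} {u : Sp d}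
    (h1 : HasMean μ (fun y => y.1) r) (h2 : HasMean μ (fun y => y.1 • y.2.2) (r • u))
    (h3 : HasMean μ (fun y => y.1 * y.2.1) (r * θ))
    (h4 : HasMean μ (fun y => y.1 * Real.log y.2.1) L) :
    ENNReal.ofReal (energyDensity c (r, θ, u) - inner ℝ (r • u) (w.u t x) + r * densityTest c w t x
      - c.gamma / (c.gamma - 1) * (L * w.temp c t x) + w.p c t x)
      ≤ ∫⁻ y, ENNReal.ofReal (relDensity c w t x y) ∂μ := by
  have hz₀ : 0 ≤ r * θ := by
    rw [← h3.2]
    exact integral_nonneg_of_ae (hsupp.mono fun y hy => mul_nonneg hy.1 hy.2.le)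
  -- Slope of the pressure potential at the mean rθ of ϱ̃θ̃.
  set k : ℝ := c.a / (c.gamma - 1) * (c.gamma * (r * θ) ^ (c.gamma - 1)) with hk
  -- An affine minorant of the relative energy density: ½ϱ̃|ũ|² is replaced by ϱ̃ũ·u - ½ϱ̃|u|²,
  -- which is smaller by ½ϱ̃|ũ - u|², with u here the velocity of the data, and the potential by its
  -- tangent at rθ. Being affine in moments with known means, it averages exactly to the left-hand
  -- side.
  have hlow := ((((((h2.inner_const u).sub (h1.const_mul (1 / 2 * ‖u‖ ^ 2))).add
    ((HasMean.const (pot c (r * θ))).add ((h3.sub (HasMean.const (r * θ))).const_mul k))).sub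
    (h2.inner_const (w.u t x))).add (h1.smul_const (densityTest c w t x))).sub
    ((h4.smul_const (w.temp c t x)).const_mul (c.gamma / (c.gamma - 1)))).add
    (HasMean.const (w.p c t x))
  have hmean := hlow.congr (Eventually.of_forall fun _ => rfl)
    (J := energyDensity c (r, θ, u) - inner ℝ (r • u) (w.u t x) + r * densityTest c w t x
      - c.gamma / (c.gamma - 1) * (L * w.temp c t x) + w.p c t x) (by
    rw [energyDensity, real_inner_comm (w.u t x), real_inner_smul_right, real_inner_self_eq_norm_sq]
    simp only [smul_eq_mul]
    ring)
  rw [← hmean.2]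
  refine (ofReal_integral_le_lintegral hmean.1).trans (lintegral_mono_ae ?_)
  filter_upwards [hsupp] with y hy
  refine ENNReal.ofReal_le_ofReal ?_
  have e1 := pot_tangent_le ha hγ (mul_nonneg hy.1 hy.2.le) hz₀
  have e2 : 0 ≤ 1 / 2 * y.1 * ‖y.2.2 - u‖ ^ 2 := by have := hy.1; positivity
  rw [norm_sub_sq_real] at e2
  rw [relDensity_eq ha hγ hρ hy.1 hy.2, energyDensity, real_inner_comm (w.u t x),
    real_inner_smul_right u, real_inner_comm y.2.2 u, densityTest]
  rw [← hk] at e1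
  simp only [smul_eq_mul]
  linarith

lemma IsC1Closed.memLp_top_slice {F : Type*} [NormedAddCommGroup F] [NormedSpace ℝ F]
    [SecondCountableTopology F] (hΩ : IsOpen Ω)
    (hb : Bornology.IsBounded Ω) {f : ℝ → Sp d → F} (h : IsC1Closed Ω T f) {t : ℝ}
    (ht : t ∈ Icc 0 T) : MemLp (f t) ⊤ (volume.restrict Ω) := by
  obtain ⟨C, hC⟩ := h.exists_bound hb
  have hc : ContinuousOn (f t) Ω :=
    h.1.comp (f := fun x => (t, x)) (by fun_prop) fun x hx => ⟨ht, subset_closure hx⟩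
  exact memLp_top_of_bound (hc.aestronglyMeasurable hΩ.measurableSet) C
    (ae_restrict_of_forall_mem hΩ.measurableSet fun x hx => hC (t, x) ⟨ht, subset_closure hx⟩)

lemma IsCWeak.integrable {F : Type*} [NormedAddCommGroup F] [InnerProductSpace ℝ F]
    (hb : Bornology.IsBounded Ω) {p : ℝ} (hp : 1 ≤ p) {f : ℝ → Sp d → F} (h : IsCWeak Ω T p f)
    {t : ℝ} (ht : t ∈ Icc 0 T) : Integrable (f t) (volume.restrict Ω) := by
  have := volume_Ω_finite hb
  exact (h.1 t ht).integrable (by simpa using ENNReal.ofReal_le_ofReal hp)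

variable {V : ℝ → Sp d → ProbabilityMeasure (Phase d)} {ρ₀ θ₀ : Sp d → ℝ} {u₀ : Sp d → Sp d}
  {G : ℝ → Sp d → Mat d} {E : ℝ → Measure (Sp d)} {D : Measure (ℝ × Sp d)}
  {R : ℝ → Fin d → Fin d → SignedMeasure (Sp d)} {w : Triple d}
  {H : ℝ → Sp d → Fin d → Fin d → Fin d → ℝ}

/-- Since log c_⋆ ≤ log θ̃ ≤ θ̃, the average lies between log c_⋆ times the initial density and the
initial total potential temperature, both integrable over Ω through their weakly continuous
representatives. -/
lemma IsDMVSolution.integrable_log_zero (hγ : 1 < c.gamma) (hb : Bornology.IsBounded Ω)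
    (hT : 0 < T) (hV : IsDMVSolution c Ω T ρ₀ θ₀ u₀ V G E D R) :
    IntegrableOn (fun x => avg V (fun y => y.1 * Real.log y.2.1) 0 x) Ω := by
  obtain ⟨cs, hcs, -, hsupp⟩ := hV.support
  obtain ⟨r, hr, -, hr0, -⟩ := hV.continuity
  obtain ⟨z, hz, -, hz0, -⟩ := hV.temperature
  have h0 : (0 : ℝ) ∈ Icc 0 T := ⟨le_rfl, hT.le⟩
  have hdom := ((hr.integrable hb hγ.le h0).norm.const_mul |Real.log cs|).add
    (hz.integrable hb hγ.le h0).norm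
  refine hdom.mono' (aestronglyMeasurable_integral_probabilityMeasure hV.meas_zero
    (Measurable.stronglyMeasurable (by fun_prop))) ?_
  filter_upwards [hsupp, hr0, hz0, hV.init] with x hs h1 h2 h3
  have hup : avg V (fun y => y.1 * Real.log y.2.1) 0 x ≤ z 0 x := by
    rw [h2, ← h3.2.2.1.2]
    refine integral_mono_ae h3.2.2.2.1 h3.2.2.1.1 (hs.mono fun y hy => ?_)
    exact mul_le_mul_of_nonneg_left (Real.log_le_self (hcs.le.trans hy.2)) hy.1
  have hlow : Real.log cs * r 0 x ≤ avg V (fun y => y.1 * Real.log y.2.1) 0 x := by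
    rw [h1, ← h3.1.2, avg, ← integral_const_mul]
    refine integral_mono_ae (h3.1.1.const_mul _) h3.2.2.2.1 (hs.mono fun y hy => ?_)
    have := mul_le_mul_of_nonneg_left (Real.log_le_log hcs hy.2) hy.1
    simpa [mul_comm] using this
  simp only [Pi.add_apply, Real.norm_eq_abs, abs_le, ← abs_mul]
  have e1 := neg_abs_le (Real.log cs * r 0 x)
  have e2 := le_abs_self (z 0 x)
  have e3 := abs_nonneg (z 0 x)
  have e4 := abs_nonneg (Real.log cs * r 0 x)
  constructor <;> linarith

lemma IsDMVSolution.relDensity_zero_nonneg (ha : 0 < c.a) (hγ : 1 < c.gamma) (hΩ : IsOpen Ω)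
    (hT : 0 < T) (hV : IsDMVSolution c Ω T ρ₀ θ₀ u₀ V G E D R) (hw : IsTestTriple Ω T w H) :
    ∀ᵐ x ∂(volume.restrict Ω), ∀ᵐ y ∂(V 0 x : Measure (Phase d)), 0 ≤ relDensity c w 0 x y := by
  obtain ⟨cs, hcs, -, hsupp⟩ := hV.support
  filter_upwards [hsupp, ae_restrict_mem hΩ.measurableSet] with x hx hxΩ
  filter_upwards [hx] with y hy
  exact relDensity_nonneg ha hγ (hw.ρ_pos 0 ⟨le_rfl, hT.le⟩ x (subset_closure hxΩ)) hy.1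
    (hcs.trans_le hy.2)

/-- The initial relative energy of the measures dominates that of the initial data. -/
lemma IsDMVSolution.integral_le_initRelEnergy (ha : 0 < c.a) (hγ : 1 < c.gamma) (hΩ : IsOpen Ω)
    (hT : 0 < T) (hV : IsDMVSolution c Ω T ρ₀ θ₀ u₀ V G E D R) (hw : IsTestTriple Ω T w H)
    {e₀ : Sp d → ℝ} (he₀ : IntegrableOn e₀ Ω)
    (he : ∀ᵐ x ∂(volume.restrict Ω), e₀ x = energyDensity c (ρ₀ x, θ₀ x, u₀ x)
      - inner ℝ (ρ₀ x • u₀ x) (w.u 0 x) + ρ₀ x * densityTest c w 0 x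
      - c.gamma / (c.gamma - 1) * (avg V (fun y => y.1 * Real.log y.2.1) 0 x * w.temp c 0 x)
      + w.p c 0 x) :
    ((∫ x in Ω, e₀ x : ℝ) : EReal) ≤ (initRelEnergy c Ω V w : EReal) := by
  obtain ⟨cs, hcs, -, hsupp⟩ := hV.support
  have h1 : ENNReal.ofReal (∫ x in Ω, e₀ x) ≤ initRelEnergy c Ω V w := by
    refine (ofReal_integral_le_lintegral he₀).trans (lintegral_mono_ae ?_)
    filter_upwards [hsupp, he, hV.init, ae_restrict_mem hΩ.measurableSet] with x hs h2 h3 hx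
    rw [h2]
    exact ofReal_le_lintegral_relDensity ha hγ
      (hw.ρ_pos 0 ⟨le_rfl, hT.le⟩ x (subset_closure hx))
      (hs.mono fun y hy => ⟨hy.1, hcs.trans_le hy.2⟩) ⟨h3.1.1, h3.1.2⟩ ⟨h3.2.1.1, h3.2.1.2⟩
      ⟨h3.2.2.1.1, h3.2.2.1.2⟩ (.of_integrable h3.2.2.2.1)
  -- `ENNReal.ofReal` truncates at 0, which can only enlarge a real number.
  refine le_trans ?_ (EReal.coe_ennreal_le_coe_ennreal_iff.2 h1)
  rw [EReal.coe_ennreal_ofReal]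
  exact EReal.coe_le_coe_iff.2 (le_max_left _ _)

end Initial

/-! ### The remainder -/

section Remainder

variable {d : ℕ} {c : Coeffs} {Ω : Set (Sp d)} {T : ℝ}

/-- The whole algebra of the relative energy inequality, in scalars. The subscripts t, u, m, F on a
quantity denote its derivative in time, along u, along the mean momentum m and along the mean flux
of ϱ̃ ln θ̃. `Pt` and `Pm` differentiate ∂P/∂ϱ, and φ is `densityTest`. The a's and b's pair m or u
with spatial and time derivatives of u, and the s's are pairings with div S(∇u). The Gibbs–Duhem
hypotheses are solved for `Pt` and `Pm`; after the chain rule for p the rest is polynomial in the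
remaining letters and 1/ϱ. -/
lemma remainder_scalar_identity {ρ r L P S p pρ pS div k₀ k₁ fK a₁ a₂ a₃ b₁ b₂ pu pm sU sM sV ρt ρu
    St Su ϑt ϑu ϑm ϑF Pt Pm φt φm A₂ A₃ Z : ℝ} {pt : ℝ} (hρ : ρ ≠ 0)
    (hφt : φt = b₁ - Pt - ϑt * k₀) (hφm : φm = a₂ - Pm - ϑm * k₀)
    (hGt : ρ * Pt + S * ϑt = pt) (hGm : ρ * Pm + S * ϑm = pm)
    (hpt : pt = pρ * ρt + pS * St) (hpu : pu = pρ * ρu + pS * Su) :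
    -A₃ - (b₂ + fK) + A₂ + (r * φt + φm) - k₁ * (L * ϑt + ϑF) + pt + (A₃ - A₂ - Z)
      + (fK - P * div - a₁ - a₂ + r * a₃)
      + (P - pρ * (r - ρ) - pS * (k₀ * r + k₁ * L - S) - p) * div
      - 1 / ρ * (r * (ρ * b₁ + ρ * a₃ + pu - sU) - (ρ * b₂ + ρ * a₁ + pm - sM))
      - (ρ - r) * (1 / ρ) * pρ * (ρt + (ρu + ρ * div))
      - (ρ - r) * (1 / ρ) * pS * (St + (Su + S * div))
      - (r / ρ * S - (k₀ * r + k₁ * L)) * (ϑt + ϑu + pS * div)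
      - ((S / ρ - k₀) * (ϑm - r * ϑu) - k₁ * (ϑF - L * ϑu))
      - (1 / ρ * (r * sU - sM) - (sU - sV))
      + (Z + (sV - sU)) + (p * div + pu) = 0 := by
  have e1 : Pt = (pρ * ρt + pS * St - S * ϑt) / ρ := by
    rw [eq_div_iff hρ]; linarith
  have e2 : Pm = (pm - S * ϑm) / ρ := by
    rw [eq_div_iff hρ]; linarith
  subst hφt hφm
  rw [e1, e2, hpt, hpu]
  field_simp
  ring

variable {V : ℝ → Sp d → ProbabilityMeasure (Phase d)} {G : ℝ → Sp d → Mat d} {w : Triple d}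
  {H : ℝ → Sp d → Fin d → Fin d → Fin d → ℝ}

/-- The integrands of the balance laws, tested with the components of the test triple, combine to
those of the relative energy inequality up to terms whose integrals vanish. -/
lemma IsTestTriple.remainder_identity (hw : IsTestTriple Ω T w H) (ha : 0 < c.a) (hγ : 1 < c.gamma)
    (hΩ : IsOpen Ω) {q : ℝ × Sp d} (hq : q ∈ slab Ω T) (hM : HasStateMeans c V q.1 q.2) :
    -frob (stress c (G q.1 q.2)) (G q.1 q.2)
      - (inner ℝ (avg V (fun y => y.1 • y.2.2) q.1 q.2) (dt w.u q.1 q.2)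
        + frob (Matrix.of fun i j => avg V (momFlux c i j) q.1 q.2) (gradMat (w.u q.1) q.2))
      + frob (stress c (G q.1 q.2)) (gradMat (w.u q.1) q.2)
      + (avg V (fun y => y.1) q.1 q.2 * dt (densityTest c w) q.1 q.2
        + inner ℝ (avg V (fun y => y.1 • y.2.2) q.1 q.2) (gradient (densityTest c w q.1) q.2))
      - c.gamma / (c.gamma - 1) *
        (avg V (fun y => y.1 * Real.log y.2.1) q.1 q.2 * dt (w.temp c) q.1 q.2
        + inner ℝ (avg V (fun y => (y.1 * Real.log y.2.1) • y.2.2) q.1 q.2)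
          (gradient (w.temp c q.1) q.2))
      + dt (w.p c) q.1 q.2 + termDiss c w G q.1 q.2
      + termConv V w q.1 q.2 + termPress c V w q.1 q.2 - termMom c V w H q.1 q.2
      - termMass c V w q.1 q.2 - termEnt c V w q.1 q.2 - termTemp c V w q.1 q.2
      - termFlux c V w q.1 q.2 - termVisc c V w H q.1 q.2
      + (frob (stress c (gradMat (w.u q.1) q.2)) (G q.1 q.2 - gradMat (w.u q.1) q.2)
        + inner ℝ (divStress c (H q.1 q.2)) (meanVel V q.1 q.2 - w.u q.1 q.2))
      + (w.p c q.1 q.2 * divg (w.u q.1) q.2 + stDeriv (w.p c) q (0, w.u q.1 q.2)) = 0 := by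
  have hq' := slab_subset_closedSlab Ω T hq
  have hρ := hw.ρ_pos q.1 hq'.1 q.2 hq'.2
  have hu := hw.u_C1
  have hS := hw.S_C1 (c := c) ha hΩ
  have hp := hw.p_C1 (c := c) ha hγ hΩ
  have hϑ := hw.temp_C1 (c := c) ha hγ hΩ
  have hφ := hw.densityTest_C1 (c := c) ha hγ hΩ
  set m := avg V (fun y => y.1 • y.2.2) q.1 q.2 with hm
  set u := w.u q.1 q.2 with hudef
  have hx := fun {F : Type} [NormedAddCommGroup F] [NormedSpace ℝ F] {f : ℝ → Sp d → F}
    (h : IsC1Closed Ω T f) => (h.hasFDerivAt_space hq).differentiableAt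
  have key := remainder_scalar_identity (r := avg V (fun y => y.1) q.1 q.2)
    (L := avg V (fun y => y.1 * Real.log y.2.1) q.1 q.2)
    (P := avg V (fun y => pressure c (y.1 * y.2.1)) q.1 q.2)
    (p := w.p c q.1 q.2) (pρ := w.p_ρ c q.1 q.2) (pS := w.p_S c q.1 q.2)
    (div := divg (w.u q.1) q.2) (k₁ := c.gamma / (c.gamma - 1))
    (fK := frob (Matrix.of fun i j => avg V (momFlux c i j) q.1 q.2) (gradMat (w.u q.1) q.2))
    (a₁ := inner ℝ m (stDeriv w.u q (0, u))) (a₃ := inner ℝ u (stDeriv w.u q (0, u)))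
    (b₂ := inner ℝ m (stDeriv w.u q (1, 0)))
    (sU := inner ℝ (divStress c (H q.1 q.2)) u) (sM := inner ℝ (divStress c (H q.1 q.2)) m)
    (sV := inner ℝ (divStress c (H q.1 q.2)) (meanVel V q.1 q.2))
    (ϑu := stDeriv (w.temp c) q (0, u))
    (ϑF := stDeriv (w.temp c) q (0, avg V (fun y => (y.1 * Real.log y.2.1) • y.2.2) q.1 q.2))
    (A₂ := frob (stress c (G q.1 q.2)) (gradMat (w.u q.1) q.2))
    (A₃ := frob (stress c (G q.1 q.2)) (G q.1 q.2))
    (Z := frob (stress c (gradMat (w.u q.1) q.2)) (G q.1 q.2 - gradMat (w.u q.1) q.2))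
    hρ.ne' (hw.stDeriv_densityTest (c := c) ha hγ hΩ hq (1, 0))
    (hw.stDeriv_densityTest (c := c) ha hγ hΩ hq (0, m)) (hw.gibbs_duhem ha hγ hΩ hq (1, 0))
    (hw.gibbs_duhem ha hγ hΩ hq (0, m))
    (congrArg (fun A : ℝ × Sp d →L[ℝ] ℝ => A (1, 0)) (hw.stDeriv_p ha hΩ hq))
    (congrArg (fun A : ℝ × Sp d →L[ℝ] ℝ => A (0, u)) (hw.stDeriv_p ha hΩ hq))
  have hdiss : termDiss c w G q.1 q.2 = frob (stress c (G q.1 q.2)) (G q.1 q.2)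
      - frob (stress c (G q.1 q.2)) (gradMat (w.u q.1) q.2)
      - frob (stress c (gradMat (w.u q.1) q.2)) (G q.1 q.2 - gradMat (w.u q.1) q.2) := by
    rw [termDiss, stress_sub, frob_sub_left, frob_sub_right (stress c (G q.1 q.2))]
  have hmom : termMom c V w H q.1 q.2 = 1 / w.ρ q.1 q.2 *
      (avg V (fun y => y.1) q.1 q.2 * (w.ρ q.1 q.2 * inner ℝ u (stDeriv w.u q (1, 0))
          + w.ρ q.1 q.2 * inner ℝ u (stDeriv w.u q (0, u)) + stDeriv (w.p c) q (0, u)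
          - inner ℝ (divStress c (H q.1 q.2)) u)
        - (w.ρ q.1 q.2 * inner ℝ m (stDeriv w.u q (1, 0))
          + w.ρ q.1 q.2 * inner ℝ m (stDeriv w.u q (0, u)) + stDeriv (w.p c) q (0, m)
          - inner ℝ (divStress c (H q.1 q.2)) m)) := by
    rw [termMom, avg, hM.mom.2, hu.dt_eq hq, hu.fderiv_apply hq, real_inner_smul_left,
      inner_sub_left, real_inner_smul_left]
    simp only [inner_add_right, inner_sub_right, real_inner_smul_right, hp.inner_gradient' hq,
      real_inner_comm (divStress c (H q.1 q.2))]
    rfl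
  have hconv : termConv V w q.1 q.2 = _ := hM.conv.2
  have hpress : termPress c V w q.1 q.2 = _ * divg (w.u q.1) q.2 :=
    congrArg (· * _) (hM.press ha hγ).2
  have hmass : termMass c V w q.1 q.2 = _ * (dt w.ρ q.1 q.2 + _) := congrArg₂ (· * ·) hM.mass.2
    (congrArg _ (divg_smul (hx hw.ρ_C1) (hx hu)))
  have hent : termEnt c V w q.1 q.2 = _ * (dt (w.S c) q.1 q.2 + _) := congrArg₂ (· * ·) hM.ent.2
    (congrArg _ (divg_smul (hx hS) (hx hu)))
  have htemp : termTemp c V w q.1 q.2 = _ * _ := congrArg (· * _) (hM.temp ha).2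
  have hflux : termFlux c V w q.1 q.2 = (w.S c q.1 q.2 / w.ρ q.1 q.2
        - Real.log c.a / (c.gamma - 1)) * (stDeriv (w.temp c) q (0, m)
          - avg V (fun y => y.1) q.1 q.2 * stDeriv (w.temp c) q (0, u))
      - c.gamma / (c.gamma - 1) *
        (stDeriv (w.temp c) q (0, avg V (fun y => (y.1 * Real.log y.2.1) • y.2.2) q.1 q.2)
          - avg V (fun y => y.1 * Real.log y.2.1) q.1 q.2 * stDeriv (w.temp c) q (0, u)) := by
    rw [termFlux, avg, (hM.flux ha).2]
    simp only [inner_sub_left, real_inner_smul_left]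
    simp only [hϑ.inner_gradient' hq]
    rfl
  have hvisc : termVisc c V w H q.1 q.2 = 1 / w.ρ q.1 q.2 *
      (avg V (fun y => y.1) q.1 q.2 * inner ℝ (divStress c (H q.1 q.2)) u
        - inner ℝ (divStress c (H q.1 q.2)) m)
      - (inner ℝ (divStress c (H q.1 q.2)) u
        - inner ℝ (divStress c (H q.1 q.2)) (meanVel V q.1 q.2)) := by
    rw [termVisc, avg, (hM.visc hρ.ne').2, inner_sub_right, inner_sub_right, real_inner_smul_right]
  rw [hdiss, hmom, hconv, hpress, hmass, hent, htemp, hflux, hvisc, hu.dt_eq hq, hφ.dt_eq hq,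
    hϑ.dt_eq hq, hp.dt_eq hq, hw.ρ_C1.dt_eq hq, hS.dt_eq hq, hφ.inner_gradient' hq,
    hϑ.inner_gradient' hq, hϑ.inner_gradient' hq, hu.fderiv_apply hq, hu.fderiv_apply hq,
    hw.ρ_C1.fderiv_apply hq, hS.fderiv_apply hq, inner_sub_right]
  exact key

end Remainder

/-! ### Integration of the remainder -/

section Assembly

variable {d : ℕ} {c : Coeffs} {Ω : Set (Sp d)} {T : ℝ}
  {V : ℝ → Sp d → ProbabilityMeasure (Phase d)} {ρ₀ θ₀ : Sp d → ℝ} {u₀ : Sp d → Sp d}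
  {G : ℝ → Sp d → Mat d} {E : ℝ → Measure (Sp d)} {D : Measure (ℝ × Sp d)}
  {R : ℝ → Fin d → Fin d → SignedMeasure (Sp d)} {w : Triple d}
  {H : ℝ → Sp d → Fin d → Fin d → Fin d → ℝ}

/-- The pointwise identity is integrated over the cylinder, where its last two groups vanish by
integration by parts. `HasMean` carries the integrability needed to split the integral into separate
terms. -/
lemma IsDMVSolution.integral_remainder (ha : 0 < c.a) (hγ : 1 < c.gamma) (hΩ : IsOpen Ω)
    (hb : Bornology.IsBounded Ω) (hT : 0 < T) (hV : IsDMVSolution c Ω T ρ₀ θ₀ u₀ V G E D R)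
    (hw : IsTestTriple Ω T w H) {τ : ℝ} (hτ : τ ≤ T) :
    -(∫ q in slab Ω τ, frob (stress c (G q.1 q.2)) (G q.1 q.2))
      - (∫ q in slab Ω τ, (inner ℝ (avg V (fun y => y.1 • y.2.2) q.1 q.2) (dt w.u q.1 q.2)
        + frob (Matrix.of fun i j => avg V (momFlux c i j) q.1 q.2) (gradMat (w.u q.1) q.2)))
      + (∫ q in slab Ω τ, frob (stress c (G q.1 q.2)) (gradMat (w.u q.1) q.2))
      + (∫ q in slab Ω τ, (avg V (fun y => y.1) q.1 q.2 * dt (densityTest c w) q.1 q.2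
        + inner ℝ (avg V (fun y => y.1 • y.2.2) q.1 q.2) (gradient (densityTest c w q.1) q.2)))
      - c.gamma / (c.gamma - 1) * (∫ q in slab Ω τ,
        (avg V (fun y => y.1 * Real.log y.2.1) q.1 q.2 * dt (w.temp c) q.1 q.2
        + inner ℝ (avg V (fun y => (y.1 * Real.log y.2.1) • y.2.2) q.1 q.2)
          (gradient (w.temp c q.1) q.2)))
      + (∫ q in slab Ω τ, dt (w.p c) q.1 q.2) + (∫ q in slab Ω τ, termDiss c w G q.1 q.2)
      + (∫ q in slab Ω τ, termConv V w q.1 q.2) + (∫ q in slab Ω τ, termPress c V w q.1 q.2)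
      - (∫ q in slab Ω τ, termMom c V w H q.1 q.2) - (∫ q in slab Ω τ, termMass c V w q.1 q.2)
      - (∫ q in slab Ω τ, termEnt c V w q.1 q.2) - (∫ q in slab Ω τ, termTemp c V w q.1 q.2)
      - (∫ q in slab Ω τ, termFlux c V w q.1 q.2)
      - (∫ q in slab Ω τ, termVisc c V w H q.1 q.2) = 0 := by
  have := volume_slab_finite hb T
  have hB := hV.momentBounds ha hγ hb
  have hW := hV.termsWellDefined ha hγ hΩ hb hT hw
  have hsub := slab_mono Ω hτ
  have hGu := hw.u_C1.memLp_top_gradMat hΩ hb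
  have hp := hw.p_C1 (c := c) ha hγ hΩ
  have hϑ := hw.temp_C1 (c := c) ha hγ hΩ
  have hφ := hw.densityTest_C1 (c := c) ha hγ hΩ
  have hm : ∀ {f : ℝ × Sp d → ℝ}, IntegrableOn f (slab Ω T) →
      HasMean (volume.restrict (slab Ω τ)) f (∫ q in slab Ω τ, f q) :=
    fun hf => .of_integrable (hf.mono_set hsub)
  have h3 := hm (integrable_frob_stress c hV.vel_mem.2.1 hV.vel_mem.2.1)
  have h2 := hm (integrable_frob_stress c hV.vel_mem.2.1
    fun i j => (hGu i j).mono_exponent le_top)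
  have h1 := hm (f := fun q => inner ℝ (avg V (fun y => y.1 • y.2.2) q.1 q.2) (dt w.u q.1 q.2)
        + frob (Matrix.of fun i j => avg V (momFlux c i j) q.1 q.2) (gradMat (w.u q.1) q.2))
    ((hB.momentum.inner_memLp_top (hw.u_C1.memLp_top_dt hΩ hb)).add
      (integrable_finsetSum _ fun i _ => integrable_finsetSum _ fun j _ =>
        (hB.momFlux i j).mul_memLp_top (hGu i j)))
  have h4 := hm (f := fun q => avg V (fun y => y.1) q.1 q.2 * dt (densityTest c w) q.1 q.2
        + inner ℝ (avg V (fun y => y.1 • y.2.2) q.1 q.2) (gradient (densityTest c w q.1) q.2))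
    ((hB.density.mul_memLp_top (hφ.memLp_top_dt hΩ hb)).add
      (hB.momentum.inner_memLp_top (hφ.memLp_top_gradient hΩ hb)))
  have h5 := hm (f := fun q => avg V (fun y => y.1 * Real.log y.2.1) q.1 q.2
          * dt (w.temp c) q.1 q.2
        + inner ℝ (avg V (fun y => (y.1 * Real.log y.2.1) • y.2.2) q.1 q.2)
          (gradient (w.temp c q.1) q.2))
    ((hB.log.mul_memLp_top (hϑ.memLp_top_dt hΩ hb)).add
      (hB.logFlux.inner_memLp_top (hϑ.memLp_top_gradient hΩ hb)))
  have h6 := hm ((hp.memLp_top_dt hΩ hb).integrable le_top)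
  obtain ⟨i1, z1⟩ := hw.integral_stress_eq_zero c hΩ hb hV.vel_mem hτ
  obtain ⟨i2, z2⟩ := hw.integral_pressure_eq_zero hΩ hb hp hτ
  have hneg := (h3.const_mul (-1)).congr (Eventually.of_forall fun q => (neg_one_mul _).symm)
    (neg_one_mul _)
  have hsum := (((((((((((((hneg.sub h1).add h2).add h4).sub
    (h5.const_mul (c.gamma / (c.gamma - 1)))).add h6).add (hm hW.diss)).add (hm hW.conv)).add
    (hm hW.press)).sub (hm hW.mom)).sub (hm hW.mass)).sub (hm hW.ent)).sub (hm hW.temp)).sub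
    (hm hW.flux)).sub (hm hW.visc)
  have hall := (hsum.add (hm i1)).add (hm i2)
  rw [z1, z2, add_zero, add_zero] at hall
  refine hall.2.symm.trans (integral_eq_zero_of_ae ?_)
  filter_upwards [ae_restrict_of_ae_restrict_of_subset hsub (hV.ae_hasStateMeans hB),
    ae_restrict_mem (isOpen_slab hΩ τ).measurableSet] with q hM hq
  exact hw.remainder_identity ha hγ hΩ (hsub hq) hM

/-- The relative energy at almost every time in terms of the conserved quantities. -/
lemma hasMean_relEnergy (hΩ : IsOpen Ω) (hb : Bornology.IsBounded Ω) (ha : 0 < c.a)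
    (hγ : 1 < c.gamma) (hw : IsTestTriple Ω T w H) {t : ℝ} (ht : t ∈ Icc 0 T) {e r L : Sp d → ℝ}
    {m : Sp d → Sp d} (he : IntegrableOn e Ω) (hr : IntegrableOn r Ω) (hL : IntegrableOn L Ω)
    (hm : IntegrableOn m Ω) :
    HasMean (volume.restrict Ω) (fun x => e x - inner ℝ (m x) (w.u t x) + r x * densityTest c w t x
        - c.gamma / (c.gamma - 1) * (L x * w.temp c t x) + w.p c t x)
      ((∫ x in Ω, e x) - (∫ x in Ω, inner ℝ (m x) (w.u t x))
        + (∫ x in Ω, r x * densityTest c w t x)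
        - c.gamma / (c.gamma - 1) * (∫ x in Ω, L x * w.temp c t x) + ∫ x in Ω, w.p c t x) := by
  have := volume_Ω_finite hb
  exact ((((HasMean.of_integrable he).sub
    (.of_integrable (hm.inner_memLp_top (hw.u_C1.memLp_top_slice hΩ hb ht)))).add
    (.of_integrable (hr.mul_memLp_top
      ((hw.densityTest_C1 ha hγ hΩ).memLp_top_slice hΩ hb ht)))).sub
    ((HasMean.of_integrable (hL.mul_memLp_top
      ((hw.temp_C1 ha hγ hΩ).memLp_top_slice hΩ hb ht))).const_mul _)).add
    (.of_integrable (((hw.p_C1 ha hγ hΩ).memLp_top_slice hΩ hb ht).integrable le_top))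

end Assembly

end NSPT

end

/-! ### The relative energy inequality -/

theorem lemma3p1 (d : ℕ) (hd : d = 2 ∨ d = 3) (c : Coeffs)
    (ha : 0 < c.a) (hγ : 1 < c.gamma) (hμ : 0 < c.mu) (hlam : -(2 / (d : ℝ)) * c.mu ≤ c.lam)
    (Ω : Set (Sp d)) (hΩo : IsOpen Ω) (hΩc : IsConnected Ω) (hΩb : Bornology.IsBounded Ω)
    (T : ℝ) (hT : 0 < T)
    (ρ₀ θ₀ : Sp d → ℝ) (u₀ : Sp d → Sp d)
    (V : ℝ → Sp d → ProbabilityMeasure (Phase d)) (G : ℝ → Sp d → Mat d)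
    (E : ℝ → Measure (Sp d)) (D : Measure (ℝ × Sp d))
    (R : ℝ → Fin d → Fin d → SignedMeasure (Sp d))
    (hV : IsDMVSolution c Ω T ρ₀ θ₀ u₀ V G E D R)
    (w : Triple d) (H : ℝ → Sp d → Fin d → Fin d → Fin d → ℝ)
    (hw : IsTestTriple Ω T w H) :
    TermsWellDefined c V w Ω T G H R ∧
    (∀ᵐ x ∂(volume.restrict Ω), ∀ᵐ y ∂(V 0 x : Measure (Phase d)), 0 ≤ relDensity c w 0 x y) ∧
    ∀ᵐ τ ∂(volume.restrict (Ioo 0 T)),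
      (∀ᵐ x ∂(volume.restrict Ω), Integrable (relDensity c w τ x) (V τ x : Measure (Phase d))) ∧
      IntegrableOn (relEnergy c V w τ) Ω ∧
      (((∫ x in Ω, relEnergy c V w τ x)
          + (E τ).real (closure Ω)
          + D.real (closedSlab Ω τ)
          + (∫ q in slab Ω τ, termDiss c w G q.1 q.2) : ℝ) : EReal)
        ≤ (initRelEnergy c Ω V w : EReal)
          + ((- (∫ q in slab Ω τ, termConv V w q.1 q.2)
              - (∫ q in slab Ω τ, termPress c V w q.1 q.2)
              + (∫ q in slab Ω τ, termMom c V w H q.1 q.2)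
              + (∫ q in slab Ω τ, termMass c V w q.1 q.2)
              + (∫ q in slab Ω τ, termEnt c V w q.1 q.2)
              + (∫ q in slab Ω τ, termTemp c V w q.1 q.2)
              + (∫ q in slab Ω τ, termFlux c V w q.1 q.2)
              - (∫ t in Ioo 0 τ, termReynolds w Ω T R t)
              + (∫ q in slab Ω τ, termVisc c V w H q.1 q.2) : ℝ) : EReal) := by
  have hB := hV.momentBounds ha hγ hΩb
  have hM := hV.ae_hasStateMeans hB
  refine ⟨hV.termsWellDefined ha hγ hΩo hΩb hT hw,
    hV.relDensity_zero_nonneg ha hγ hΩo hT hw, ?_⟩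
  have h0 : (0 : ℝ) ∈ Icc 0 T := ⟨le_rfl, hT.le⟩
  have hϑ := hw.temp_C1 (c := c) ha hγ hΩo
  have hk : 0 < c.gamma / (c.gamma - 1) := div_pos (by linarith) (by linarith)
  have hlog0 := hV.integrable_log_zero hγ hΩb hT
  obtain ⟨r, hr, hravg, hr0, hcont⟩ := hV.continuity
  obtain ⟨m, hm, hmavg, hm0, hmom⟩ := hV.momentum
  have hexp : 1 ≤ 2 * c.gamma / (c.gamma + 1) := by
    rw [le_div_iff₀ (by linarith)]; linarith
  -- The energy used at t = 0 is that of the data, as on the right of the energy inequality. The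
  -- passage to the average over the initial measures is Jensen's inequality in `hle`.
  have hinit := hasMean_relEnergy hΩo hΩb ha hγ hw h0 hV.energy_init
    (hr.integrable hΩb hγ.le h0) hlog0 (hm.integrable hΩb hexp h0)
  have hle := hV.integral_le_initRelEnergy ha hγ hΩo hT hw hinit.1 (by
    filter_upwards [hr0, hm0] with x h1 h2
    rw [h1, h2])
  rw [hinit.2] at hle
  have henergy := hV.energy_integrable
  have hlog := hB.log
  rw [IntegrableOn, volume_restrict_slab] at henergy hlog
  rw [volume_restrict_slab] at hM hravg hmavg
  filter_upwards [hV.energy_ineq,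
    hV.entropy_ineq _ _ _ (hϑ.isW1Inf hΩo hΩb) fun t ht x hx =>
      hw.temp_nonneg hγ ht (subset_closure hx),
    Measure.ae_ae_of_ae_prod hM, Measure.ae_ae_of_ae_prod hravg, Measure.ae_ae_of_ae_prod hmavg,
    henergy.prod_right_ae, hlog.prod_right_ae, ae_restrict_mem measurableSet_Ioo]
    with τ hE hS hMτ hrτ hmτ heτ hlτ hτ
  have hτ' := Ioo_subset_Icc_self hτ
  -- For almost every τ the weakly continuous representatives of density and momentum coincide a.e.
  -- in Ω with the averages. The balance laws can then be read as statements about the relative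
  -- energy at τ.
  have hrel := (hasMean_relEnergy hΩo hΩb ha hγ hw hτ' heτ (hr.integrable hΩb hγ.le hτ') hlτ
    (hm.integrable hΩb hexp hτ')).congr (g := relEnergy c V w τ) (by
      filter_upwards [hMτ, hrτ, hmτ, ae_restrict_mem hΩo.measurableSet] with x h1 h2 h3 hx
      rw [relEnergy, avg, (h1.rel ha hγ (hw.ρ_pos τ hτ' x (subset_closure hx))).2, h2, h3]) rfl
  refine ⟨?_, hrel.1, ?_⟩
  · filter_upwards [hMτ, ae_restrict_mem hΩo.measurableSet] with x h1 hx
    exact (h1.rel ha hγ (hw.ρ_pos τ hτ' x (subset_closure hx))).1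
  -- The laws are now evaluated at τ. Multiplying the entropy inequality by γ/(γ-1) > 0 preserves
  -- its direction.
  have e1 := hcont _ _ _ ((hw.densityTest_C1 (c := c) ha hγ hΩo).isW1Inf hΩo hΩb) τ hτ'
  have e2 := hmom _ hw.u_C1 hw.u_bdry τ hτ'
  have e3 := (hw.p_C1 (c := c) ha hγ hΩo).integral_sub_eq hΩo hΩb hτ
  have e4 := hV.integral_remainder ha hγ hΩo hΩb hT hw hτ.2.le
  have e5 := mul_le_mul_of_nonneg_left (ge_iff_le.1 hS) hk.le
  have e6 : (∫ t in Ioo 0 τ, termReynolds w Ω T R t)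
      = ∫ t in Ioo 0 τ, pairing Ω (closedGrad Ω T w.u t) (R t) := rfl
  -- Replacing the initial term by its finite lower bound reduces the claim to an inequality between
  -- real numbers, a linear combination of the balance laws and the integrated remainder identity.
  refine le_trans ?_ (add_le_add_left hle _)
  rw [← EReal.coe_add, EReal.coe_le_coe_iff, hrel.2, e6]
  rw [mul_sub] at e5
  linarith
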